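/- All graphs are finite and loopless. For an abelian group $S$ and a graph $G$ with a fixed orientation, a function $\gamma:V(G)\to S$ with $\sum_{v}\gamma(v)=0$ is called a zero-sum boundary; $G$ is \emph{$S$-connected} if for every zero-sum boundary $\gamma$ there is $\varphi:E(G)\to S\setminus\{0\}$ such that at every vertex $v$ the sum of $\varphi$ over the edges leaving $v$ minus the sum of $\varphi$ over the edges entering $v$ equals $\gamma(v)$ (this does not depend on the orientation). \textbf{Theorem.} (1) There exists a $3$-edge-connected cubic graph which is $\mathbb Z_4$-connected but not $\mathbb Z_2^2$-connected. (2) There exists a $3$-edge-connected cubic graph which is $\mathbb Z_2^2$-connected but not $\mathbb Z_4$-connected. More precisely, let $H$ have vertices $0,1,\dots,14$ and the $18$ edges $0\,1,\;1\,2,\;2\,3,\;5\,0$; $\;1\,6,\;2\,7,\;3\,8,\;4\,9,\;5\,10$; $\;10\,6,\;6\,7,\;7\,11,\;11\,8,\;8\,9,\;9\,13,\;13\,10$; $\;0\,12,\;12\,11$. Let $H_1$ be $H$ together with the edges $3\,4,\;4\,14,\;14\,5$, and let $H_2$ be $H$ together with the edges $4\,5,\;3\,14,\;14\,4$. In both graphs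 the vertices $12,13,14$ have degree $2$ and all others have degree $3$. (a) Replace every vertex of $K_4$ by a copy of $H_1$, and in each copy attach the three edges of $K_4$ at the replaced vertex to the three vertices of degree $2$, bijectively and otherwise arbitrarily. Every graph obtained in this way is cubic, $3$-edge-connected, and $\mathbb Z_2^2$-connected but not $\mathbb Z_4$-connected. (b) The $3$-prism (two disjoint triangles joined by a perfect matching) has a proper $3$-edge-colouring, unique up to a permutation of the colours. Fix one, with the three colours $a,b,c$, let $x,y,z$ be the vertices of degree $2$ of $H_2$ in some order, and let $(p_i,q_i,r_i)$, $1\le i\le 6$, be the six permutations of $(a,b,c)$, assigned bijectively to the six vertices of the prism. Replace the $i$-th vertex of the prism by a copy of $H_2$, in which $x,y,z$ are attached to the edges of the prism at that vertex of colours $p_i,q_i,r_i$, respectively. Every graph obtained in this way is cubic, $3$-edge-connected, and $\mathbb Z_4$-connected but not $\mathbb Z_2^2$-connected. (c) Infinitely many graphs as in (1), and infinitely many as in (2), arise by repeatedly substituting vertices by triangles (a vertex $v$ of degree $3$ is replaced by a triangle, whose three vertices are joined to the three neighbours of $v$, respectively): if a simple graph $G$ has the properties in (1), or those in (2), then so does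 every graph obtained from $G$ by any finite number of such substitutions, and for every $n\ge 0$ there are graphs obtained in this way with $|V(G)|+2n$ vertices. -/

import Mathlib

namespace GroupConn

/-- An orientation of `G`: every edge gets a tail and a head, which are its two ends. -/
structure Orientation {V : Type*} (G : SimpleGraph V) where
  tail : G.edgeSet → V
  head : G.edgeSet → V
  ends : ∀ e : G.edgeSet, s(tail e, head e) = (e : Sym2 V)

open Classical in
/-- The boundary of `φ` at `u`: the sum of `φ` over the edges directed away from `u`, minus the
sum of `φ` over the edges directed into `u`. -/
noncomputable def boundary {V : Type*} [Fintype V] {G : SimpleGraph V} {S : Type*}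
    [AddCommGroup S] (D : Orientation G) (φ : G.edgeSet → S) (u : V) : S :=
  (∑ e : G.edgeSet with D.tail e = u, φ e) - ∑ e : G.edgeSet with D.head e = u, φ e

/-- `G` is `S`-connected: every zero-sum function `γ` on the vertices is the boundary of a
nowhere-zero function on the edges. (Reversing an edge amounts to replacing `φ e` by `- φ e`, so
the choice of the orientation does not matter.) -/
def GroupConnected {V : Type*} [Fintype V] (G : SimpleGraph V) (S : Type*) [AddCommGroup S] :
    Prop :=
  ∀ D : Orientation G, ∀ γ : V → S, ∑ u, γ u = 0 →
    ∃ φ : G.edgeSet → S, (∀ e, φ e ≠ 0) ∧ ∀ u, boundary D φ u = γ u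

open Classical in
/-- `G` is cubic, 3-edge-connected, `S`-connected, and not `T`-connected. -/
def IsCubicExample {V : Type*} [Fintype V] (S T : Type*) [AddCommGroup S] [AddCommGroup T]
    (G : SimpleGraph V) : Prop :=
  G.IsRegularOfDegree 3 ∧ G.IsEdgeConnected 3 ∧ GroupConnected G S ∧ ¬ GroupConnected G T

/-- The eighteen edges common to the graphs `H₁` and `H₂`. -/
def commonEdges : Finset (Sym2 (Fin 15)) :=
  {s(0, 1), s(1, 2), s(2, 3), s(5, 0),
   s(1, 6), s(2, 7), s(3, 8), s(4, 9), s(5, 10),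
   s(10, 6), s(6, 7), s(7, 11), s(11, 8), s(8, 9), s(9, 13), s(13, 10),
   s(0, 12), s(12, 11)}

/-- The graph `H₁`: outer cycle `0 1 2 3 4 14 5`, inner cycle `6 7 11 8 9 13 10`, and the
connections `1 6`, `2 7`, `3 8`, `4 9`, `5 10`, `0 12 11`. -/
def H₁ : SimpleGraph (Fin 15) :=
  SimpleGraph.fromEdgeSet (commonEdges ∪ {s(3, 4), s(4, 14), s(14, 5)} : Finset (Sym2 (Fin 15)))

/-- The graph `H₂`: the same as `H₁`, except that the vertex `14` of degree two subdivides `3 4`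
instead of `4 5`. -/
def H₂ : SimpleGraph (Fin 15) :=
  SimpleGraph.fromEdgeSet (commonEdges ∪ {s(4, 5), s(3, 14), s(14, 4)} : Finset (Sym2 (Fin 15)))

/-- The complete graph on four vertices. -/
def K₄ : SimpleGraph (Fin 4) := ⊤

/-- The 3-prism: two disjoint triangles joined by a perfect matching. -/
def prism : SimpleGraph (Fin 3 × Fin 2) :=
  SimpleGraph.boxProd (⊤ : SimpleGraph (Fin 3)) (⊤ : SimpleGraph (Fin 2))

open Classical in
/-- The vertices of degree two. -/
def twoVertices {W : Type*} [Fintype W] (H : SimpleGraph W) : Set W := {w | H.degree w = 2}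

/-- The graph obtained from `F` by replacing every vertex by a copy of `H`; the edge `uv` of `F`
becomes an edge between the vertex `att u v` of the copy at `u` and the vertex `att v u` of the
copy at `v`. -/
def replaceVertices {V W : Type*} (F : SimpleGraph V) (H : SimpleGraph W) (att : V → V → W) :
    SimpleGraph (V × W) where
  Adj p q := (p.1 = q.1 ∧ H.Adj p.2 q.2) ∨
    (F.Adj p.1 q.1 ∧ p.2 = att p.1 q.1 ∧ q.2 = att q.1 p.1)
  symm := ⟨by
    rintro p q (⟨h, h'⟩ | ⟨h, h', h''⟩)
    · exact Or.inl ⟨h.symm, h'.symm⟩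
    · exact Or.inr ⟨h.symm, h'', h'⟩⟩
  loopless := ⟨by
    rintro p (⟨_, h⟩ | ⟨h, _⟩)
    · exact H.irrefl h
    · exact F.irrefl h⟩

/-- In every copy of `H`, the edges of `F` at the replaced vertex are attached bijectively to the
vertices of degree two of `H`. -/
def IsAttachment {V W : Type*} [Fintype W] (F : SimpleGraph V) (H : SimpleGraph W)
    (att : V → V → W) : Prop :=
  ∀ u, Set.BijOn (att u) (F.neighborSet u) (twoVertices H)

/-- The attachment according to the colour permutations: `c` is a proper 3-edge-colouring of `F`,
`t 0`, `t 1`, `t 2` are the vertices of degree two of `H`, and `σ` assigns to the vertices of `F`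
the permutations of the three colours, each used exactly once; in the copy of `H` at `u`, the
vertex `t j` is attached to the edge at `u` of colour `σ u j`. -/
def IsPermutationAttachment {V W : Type*} [Fintype W] (F : SimpleGraph V) (H : SimpleGraph W)
    (att : V → V → W) : Prop :=
  ∃ (c : F.lineGraph.Coloring (Fin 3)) (t : Fin 3 → W) (σ : V ≃ Equiv.Perm (Fin 3)),
    Set.BijOn t Set.univ (twoVertices H) ∧
    ∀ (u v : V) (h : F.Adj u v) (j : Fin 3), c ⟨s(u, v), h⟩ = σ u j → att u v = t j

/-- Substitution of a vertex `v` of degree three by a triangle: the vertices of the triangle are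
indexed by the neighbours of `v`, and each of them is joined to its neighbour. -/
def triangleSubst {V : Type*} (G : SimpleGraph V) (v : V) :
    SimpleGraph ({u : V // u ≠ v} ⊕ G.neighborSet v) where
  Adj
    | .inl a, .inl b => G.Adj a b
    | .inl a, .inr w => (a : V) = w
    | .inr w, .inl a => (a : V) = w
    | .inr w, .inr w' => w ≠ w'
  symm := ⟨by
    rintro (a | w) (b | w') h
    · exact SimpleGraph.Adj.symm h
    · exact h
    · exact h
    · exact Ne.symm h⟩
  loopless := ⟨by
    rintro (a | w) h
    · exact G.irrefl h
    · exact h rfl⟩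

/-- `TriangleDerived G H`: up to isomorphism, `H` is obtained from `G` by finitely many (possibly
no) substitutions of a vertex of degree three by a triangle. -/
inductive TriangleDerived {V : Type} (G : SimpleGraph V) :
    ∀ {W : Type}, SimpleGraph W → Prop
  | of_iso {W : Type} {H : SimpleGraph W} (e : Nonempty (G ≃g H)) : TriangleDerived G H
  | step {W W' : Type} {H : SimpleGraph W} {K : SimpleGraph W'} (hH : TriangleDerived G H)
      (v : W) (hv : (H.neighborSet v).ncard = 3) (e : Nonempty (triangleSubst H v ≃g K)) :
      TriangleDerived G K

/-- Every graph derived from `G` by substituting triangles for vertices is again cubic,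
3-edge-connected, `S`-connected and not `T`-connected, and there are such graphs with
`|V(G)| + 2n` vertices for every `n`. -/
def TriangleFamily {V : Type} [Fintype V] (S T : Type*) [AddCommGroup S] [AddCommGroup T]
    (G : SimpleGraph V) : Prop :=
  (∀ (W : Type) [Fintype W] (H : SimpleGraph W), TriangleDerived G H → IsCubicExample S T H) ∧
  ∀ n : ℕ, ∃ H : SimpleGraph (Fin (Fintype.card V + 2 * n)), TriangleDerived G H

end GroupConn

open GroupConn

/-! A boundary on a composite graph can be handled in two layers. If every vertex of `G` is blown up
into a piece, the boundary is first summed over each piece and solved on `G`; what remains has sum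
zero on each piece and is solved there. So a blowup is `S`-connected when `G` and all pieces are
(`IsBlowup.flowConnected`). Conversely, contracting pieces turns flows into flows, so
`S`-connectivity passes to `G` (`IsBlowup.flowConnected_base`). The triangle is connected for both
groups of order four, whence triangle substitution preserves all required properties.

For the two examples, the piece `H` is connected for the wanted group `S` but has a bad boundary
`γ₀` for the other group `T`. The base graph gets outgoing values `τ u v`, chosen such that every
nowhere-zero `T`-flow with the boundary of `τ` agrees with `τ` around at least one vertex. Give the
composite the boundary `γ₀` in every copy, increased by `τ u v` at the attachment vertices. In the
copy at a vertex where the flow agrees with `τ`, the outer edges carry exactly the added amounts, so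
the inner edges would realise `γ₀`, which is impossible (`not_flowConnected_replaceVertices`).

For `K₄` and `ℤ₄`, `τ` is constantly `1`: every flow with boundary `3` everywhere has a vertex with
three outgoing values `1`. For the prism and `ℤ₂²`, a flow with zero boundary is a 3-edge-colouring.
As the colouring is unique up to a permutation, there are six flows, and each of the six vertices is
in charge of one of them through `τ`.

That `H₁` and `H₂` are connected for one group concerns `4 ^ 14` boundaries. The vertices are
eliminated one after another with at most four open at a time besides a root, and the set of
attainable partial boundaries of the open vertices is followed. These sets matter only up to
translation, and shrinking them is harmless, so small families suffice; tables list them and the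
kernel checks them (`solvable_of_checkFamilies`). The bad boundaries are refuted by exhaustive
search.

Edge connectivity is treated through cuts (`IsBlowup.isEdgeConnected`): each piece, with the outside
contracted to one further vertex, has no cut smaller than three. -/

namespace GroupConn

/-! ### Flows on ordered pairs of vertices -/

/-- `f` is a nowhere-zero `S`-valued function on the darts of `G`, where `f v u = - f u v`, with
boundary `γ`. -/
structure IsFlow {V : Type*} [Fintype V] {S : Type*} [AddCommGroup S] (G : SimpleGraph V)
    (γ : V → S) (f : V → V → S) : Prop where
  antisymm : ∀ u v, f v u = - f u v
  ne_zero : ∀ u v, G.Adj u v → f u v ≠ 0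
  eq_zero : ∀ u v, ¬ G.Adj u v → f u v = 0
  sum_eq : ∀ u, ∑ v, f u v = γ u

/-- `S`-connectivity of `G`, without reference to an orientation. -/
def FlowConnected {V : Type*} [Fintype V] (G : SimpleGraph V) (S : Type*) [AddCommGroup S] : Prop :=
  ∀ γ : V → S, ∑ u, γ u = 0 → ∃ f, IsFlow G γ f

section

variable {V : Type*} {G : SimpleGraph V} (D : Orientation G)

lemma Orientation.adj (e : G.edgeSet) : G.Adj (D.tail e) (D.head e) := by
  rw [← SimpleGraph.mem_edgeSet, D.ends]
  exact e.2

lemma exists_edge_of_adj {u v : V} (h : G.Adj u v) :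
    ∃ e, (D.tail e = u ∧ D.head e = v) ∨ (D.tail e = v ∧ D.head e = u) :=
  ⟨⟨s(u, v), h⟩, Sym2.eq_iff.1 (D.ends ⟨s(u, v), h⟩)⟩

lemma nonempty_orientation (G : SimpleGraph V) : Nonempty (Orientation G) :=
  ⟨⟨fun e => (Quot.out e.1).1, fun e => (Quot.out e.1).2, fun e => Quot.out_eq e.1⟩⟩

variable [Fintype V] {S : Type*} [AddCommGroup S]

open Classical in
/-- The function on pairs of vertices given by a function on the edges. -/
noncomputable def ofEdges (φ : G.edgeSet → S) (u v : V) : S :=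
  (∑ e : G.edgeSet, if D.tail e = u ∧ D.head e = v then φ e else 0) -
    ∑ e : G.edgeSet, if D.head e = u ∧ D.tail e = v then φ e else 0

lemma sum_ofEdges (φ : G.edgeSet → S) (u : V) : ∑ v, ofEdges D φ u v = boundary D φ u := by
  classical
  simp only [ofEdges, boundary, Finset.sum_sub_distrib]
  congr 1
  · rw [Finset.sum_comm, Finset.sum_filter]
    refine Finset.sum_congr rfl fun e _ => ?_
    by_cases h : D.tail e = u <;> simp [h]
  · rw [Finset.sum_comm, Finset.sum_filter]
    refine Finset.sum_congr rfl fun e _ => ?_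
    by_cases h : D.head e = u <;> simp [h]

lemma ofEdges_swap (φ : G.edgeSet → S) (u v : V) : ofEdges D φ v u = - ofEdges D φ u v := by
  classical
  rw [ofEdges, ofEdges, neg_sub]
  congr 1 <;> exact Finset.sum_congr rfl fun e _ => if_congr and_comm rfl rfl

lemma ofEdges_of_not_adj (φ : G.edgeSet → S) {u v : V} (h : ¬ G.Adj u v) :
    ofEdges D φ u v = 0 := by
  rw [ofEdges, Finset.sum_eq_zero, Finset.sum_eq_zero, sub_zero]
  · rintro e -
    exact if_neg fun ⟨h1, h2⟩ => h (h1 ▸ h2 ▸ (D.adj e).symm)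
  · rintro e -
    exact if_neg fun ⟨h1, h2⟩ => h (h1 ▸ h2 ▸ D.adj e)

lemma ofEdges_tail_head (φ : G.edgeSet → S) (e : G.edgeSet) :
    ofEdges D φ (D.tail e) (D.head e) = φ e := by
  rw [ofEdges, Finset.sum_eq_single e, Finset.sum_eq_zero, sub_zero, if_pos ⟨rfl, rfl⟩]
  · rintro e' -
    refine if_neg fun ⟨h1, h2⟩ => ?_
    have : e' = e := by
      rw [Subtype.ext_iff, ← D.ends, ← D.ends, h1, h2, Sym2.eq_swap]
    subst this
    exact (D.adj e').ne h2
  · rintro e' - hne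
    refine if_neg fun ⟨h1, h2⟩ => hne ?_
    rw [Subtype.ext_iff, ← D.ends, ← D.ends, h1, h2]
  · simp

lemma isFlow_ofEdges {φ : G.edgeSet → S} (hφ : ∀ e, φ e ≠ 0) :
    IsFlow G (boundary D φ) (ofEdges D φ) where
  antisymm := ofEdges_swap D φ
  ne_zero u v h := by
    obtain ⟨e, ⟨rfl, rfl⟩ | ⟨rfl, rfl⟩⟩ := exists_edge_of_adj D h
    · rw [ofEdges_tail_head]
      exact hφ e
    · rw [ofEdges_swap, ofEdges_tail_head]
      exact neg_ne_zero.2 (hφ e)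
  eq_zero _ _ := ofEdges_of_not_adj D φ
  sum_eq := sum_ofEdges D φ

lemma IsFlow.boundary_eq {γ : V → S} {f : V → V → S} (hf : IsFlow G γ f) (u : V) :
    boundary D (fun e => f (D.tail e) (D.head e)) u = γ u := by
  rw [← hf.sum_eq, ← sum_ofEdges]
  refine Finset.sum_congr rfl fun v _ => ?_
  by_cases h : G.Adj u v
  · obtain ⟨e, ⟨rfl, rfl⟩ | ⟨rfl, rfl⟩⟩ := exists_edge_of_adj D h
    · rw [ofEdges_tail_head]
    · rw [ofEdges_swap, ofEdges_tail_head, ← hf.antisymm]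
  · rw [ofEdges_of_not_adj D _ h, hf.eq_zero u v h]

/-- An antisymmetric function on ordered pairs stores both directions of an edge, so no orientation
needs to be carried along when flows are glued, restricted or contracted. -/
theorem groupConnected_iff : GroupConnected G S ↔ FlowConnected G S := by
  constructor
  · intro h γ hγ
    obtain ⟨D⟩ := nonempty_orientation G
    obtain ⟨φ, hφ, hb⟩ := h D γ hγ
    exact ⟨_, funext hb ▸ isFlow_ofEdges D hφ⟩
  · intro h D γ hγ
    obtain ⟨f, hf⟩ := h γ hγ
    exact ⟨_, fun e => hf.ne_zero _ _ (D.adj e), hf.boundary_eq D⟩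

end

/-! ### Cuts and edge connectivity -/

lemma sum_sum_eq_zero_of_antisymm {V S : Type*} [AddCommGroup S] (s : Finset V) {f : V → V → S}
    (h : ∀ u v, f v u = - f u v) (h0 : ∀ u, f u u = 0) : ∑ u ∈ s, ∑ v ∈ s, f u v = 0 := by
  rw [← Finset.sum_product']
  refine Finset.sum_involution (fun p _ => (p.2, p.1)) ?_ ?_ ?_ ?_
  · rintro ⟨u, v⟩ -
    simp [h u v]
  · rintro ⟨u, v⟩ - hne heq
    simp only [Prod.mk.injEq] at heq
    obtain ⟨rfl, -⟩ := heq
    exact hne (h0 _)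
  · rintro ⟨u, v⟩ hm
    simpa [and_comm] using hm
  · rintro ⟨u, v⟩ -
    rfl

/-- The number of edges leading from `X` to its complement. -/
noncomputable def cutSize {V : Type*} [Fintype V] (G : SimpleGraph V) (X : Set V) : ℕ :=
  open Classical in
  ∑ p, ∑ q, if p ∈ X ∧ q ∉ X ∧ G.Adj p q then 1 else 0

open Classical in
lemma cutSize_eq_card {V : Type*} [Fintype V] (G : SimpleGraph V) (X : Set V) :
    cutSize G X =
      (Finset.univ.filter fun x : V × V => x.1 ∈ X ∧ x.2 ∉ X ∧ G.Adj x.1 x.2).card := by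
  rw [cutSize, Finset.card_filter, Fintype.sum_prod_type]

/-- A walk from one side to the other crosses the cut, so deleting a small cut separates.
Conversely, if deleting `s` separates `u` from `v`, the component of `u` has all its leaving edges
in `s`. -/
theorem isEdgeConnected_iff {V : Type*} [Fintype V] {G : SimpleGraph V} {k : ℕ} :
    G.IsEdgeConnected k ↔ ∀ X : Set V, X.Nonempty → Xᶜ.Nonempty → k ≤ cutSize G X := by
  classical
  constructor
  · rintro h X ⟨u, hu⟩ ⟨v, hv⟩
    by_contra! hlt
    set s : Finset (Sym2 V) := (Finset.univ.filter
      fun x : V × V => x.1 ∈ X ∧ x.2 ∉ X ∧ G.Adj x.1 x.2).image fun x => s(x.1, x.2) with hs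
    have hcard : (s : Set (Sym2 V)).encard < k := by
      rw [Set.encard_coe_eq_coe_finsetCard]
      refine Nat.cast_lt.2 (Finset.card_image_le.trans_lt ?_)
      rwa [← cutSize_eq_card]
    obtain ⟨w⟩ := h u v hcard
    obtain ⟨d, hd, h1, h2⟩ := w.exists_boundary_dart X hu hv
    have := d.adj
    rw [SimpleGraph.deleteEdges_adj] at this
    refine this.2 ?_
    exact Finset.mem_coe.2 (Finset.mem_image.2 ⟨(d.fst, d.snd), by simp [h1, h2, this.1], rfl⟩)
  · intro h u v s hs
    by_contra hr
    set X : Set V := {w | (G.deleteEdges s).Reachable u w} with hX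
    have hle := h X ⟨u, .rfl⟩ ⟨v, hr⟩
    refine hs.not_ge ?_
    refine le_trans (Nat.cast_le.2 hle) ?_
    rw [cutSize_eq_card, ← Set.encard_coe_eq_coe_finsetCard]
    refine Set.encard_le_encard_of_injOn (f := fun x : V × V => s(x.1, x.2)) ?_ ?_
    · rintro ⟨p, q⟩ hpq
      simp only [Finset.coe_filter, Finset.mem_univ, true_and, Set.mem_ofPred_eq] at hpq
      by_contra hns
      refine hpq.2.1 (SimpleGraph.Reachable.trans hpq.1 (SimpleGraph.Adj.reachable ?_))
      rw [SimpleGraph.deleteEdges_adj]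
      exact ⟨hpq.2.2, hns⟩
    · rintro ⟨p, q⟩ hpq ⟨p', q'⟩ hpq' he
      simp only [Finset.coe_filter, Finset.mem_univ, true_and, Set.mem_ofPred_eq] at hpq hpq'
      rcases Sym2.eq_iff.1 he with ⟨rfl, rfl⟩ | ⟨rfl, rfl⟩
      · rfl
      · exact absurd hpq.1 hpq'.2.1

lemma cutSize_compl {V : Type*} [Fintype V] (G : SimpleGraph V) (X : Set V) :
    cutSize G Xᶜ = cutSize G X := by
  classical
  rw [cutSize, cutSize, Finset.sum_comm]
  refine Finset.sum_congr rfl fun p _ => Finset.sum_congr rfl fun q _ => ?_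
  simp only [Set.mem_compl_iff, not_not, G.adj_comm q p]
  congr 1
  exact propext (by tauto)

/-! ### Blowups -/

/-- `G'` is obtained from `G` by replacing every vertex `u` by the graph on the fibre `π ⁻¹ u`; the
edge `uv` of `G` is attached to the vertex `att u v` of the fibre of `u`. -/
structure IsBlowup {V V' : Type*} (G' : SimpleGraph V') (G : SimpleGraph V) (π : V' → V)
    (att : V → V → V') : Prop where
  proj_att : ∀ u v, G.Adj u v → π (att u v) = u
  adj_iff : ∀ p q, π q ≠ π p →
    (G'.Adj p q ↔ G.Adj (π p) (π q) ∧ att (π p) (π q) = p ∧ att (π q) (π p) = q)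

/-- The edges of `G'` within the fibre of `u`. -/
def fibreGraph {V V' : Type*} (G' : SimpleGraph V') (π : V' → V) (u : V) : SimpleGraph V' where
  Adj p q := G'.Adj p q ∧ π p = u ∧ π q = u
  symm := ⟨fun _ _ h => ⟨h.1.symm, h.2.2, h.2.1⟩⟩
  loopless := ⟨fun _ h => G'.irrefl h.1⟩

lemma IsBlowup.att_proj {V V' : Type*} {G' : SimpleGraph V'} {G : SimpleGraph V} {π : V' → V}
    {att : V → V → V'} (hB : IsBlowup G' G π att) {p q : V'} (h : G'.Adj p q) (hne : π q ≠ π p) :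
    att (π p) (π q) = p :=
  ((hB.adj_iff p q hne).1 h).2.1

lemma IsBlowup.adj_proj {V V' : Type*} {G' : SimpleGraph V'} {G : SimpleGraph V} {π : V' → V}
    {att : V → V → V'} (hB : IsBlowup G' G π att) {p q : V'} (h : G'.Adj p q) (hne : π q ≠ π p) :
    G.Adj (π p) (π q) :=
  ((hB.adj_iff p q hne).1 h).1

lemma IsBlowup.adj_att {V V' : Type*} {G' : SimpleGraph V'} {G : SimpleGraph V} {π : V' → V}
    {att : V → V → V'} (hB : IsBlowup G' G π att) {u v : V} (h : G.Adj u v) :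
    G'.Adj (att u v) (att v u) := by
  have h1 := hB.proj_att u v h
  have h2 := hB.proj_att v u h.symm
  rw [hB.adj_iff _ _ (by rw [h1, h2]; exact h.ne'), h1, h2]
  exact ⟨h, rfl, rfl⟩

section

set_option linter.unusedSectionVars false

variable {V V' : Type*} [Fintype V] [Fintype V'] {G' : SimpleGraph V'} {G : SimpleGraph V}
  {π : V' → V} {att : V → V → V'} (hB : IsBlowup G' G π att)

open Classical

lemma sum_fibre {M : Type*} [AddCommMonoid M] (π : V' → V) (h : V' → M) :
    ∑ u, ∑ p, (if π p = u then h p else 0) = ∑ p, h p := by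
  rw [Finset.sum_comm]
  simp

include hB in
-- By `adj_iff`, an edge leaving the fibre at `p` is determined by the base vertex it leads to, so
-- `π` and `att` are inverse bijections between such neighbours and base edges attached at `p`.
lemma IsBlowup.sum_outer {M : Type*} [AddCommMonoid M] (p : V') (h : V' → M) :
    ∑ q, (if G'.Adj p q ∧ π q ≠ π p then h q else 0) =
      ∑ v, if G.Adj (π p) v ∧ att (π p) v = p then h (att v (π p)) else 0 := by
  rw [← Finset.sum_filter, ← Finset.sum_filter]
  refine Finset.sum_bij' (fun q _ => π q) (fun v _ => att v (π p)) ?_ ?_ ?_ ?_ ?_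
  · intro q hq
    simp only [Finset.mem_filter, Finset.mem_univ, true_and] at hq ⊢
    exact ⟨hB.adj_proj hq.1 hq.2, hB.att_proj hq.1 hq.2⟩
  · intro v hv
    simp only [Finset.mem_filter, Finset.mem_univ, true_and] at hv ⊢
    have h1 := hB.adj_att hv.1
    rw [hv.2] at h1
    exact ⟨h1, by rw [hB.proj_att v _ hv.1.symm]; exact hv.1.ne'⟩
  · intro q hq
    simp only [Finset.mem_filter, Finset.mem_univ, true_and] at hq
    exact hB.att_proj hq.1.symm hq.2.symm
  · intro v hv
    simp only [Finset.mem_filter, Finset.mem_univ, true_and] at hv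
    exact hB.proj_att v _ hv.1.symm
  · intro q hq
    simp only [Finset.mem_filter, Finset.mem_univ, true_and] at hq
    rw [hB.att_proj hq.1.symm hq.2.symm]

include hB in
-- Each base edge at `u` is met at exactly one vertex of the fibre, namely `att u v`; several edges
-- may share that vertex.
lemma IsBlowup.sum_ports {M : Type*} [AddCommMonoid M] (u : V) (k : V' → V → M) :
    ∑ p, (if π p = u then ∑ v, (if G.Adj (π p) v ∧ att (π p) v = p then k p v else 0) else 0) =
      ∑ v, if G.Adj u v then k (att u v) v else 0 := by
  have h1 : ∀ p, (if π p = u then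
      ∑ v, (if G.Adj (π p) v ∧ att (π p) v = p then k p v else 0) else 0) =
      ∑ v, if att u v = p then (if G.Adj u v then k (att u v) v else 0) else 0 := by
    intro p
    split_ifs with hp
    · subst hp
      refine Finset.sum_congr rfl fun v _ => ?_
      by_cases ha : att (π p) v = p <;> simp [ha]
    · refine (Finset.sum_eq_zero fun v _ => ?_).symm
      split_ifs with ha hadj
      · exact absurd (ha ▸ hB.proj_att u v hadj) hp
      · rfl
      · rfl
  simp only [h1]
  rw [Finset.sum_comm]
  simp

include hB in
lemma IsBlowup.sum_all_ports {M : Type*} [AddCommMonoid M] (k : V' → V → M) :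
    ∑ p, ∑ v, (if G.Adj (π p) v ∧ att (π p) v = p then k p v else 0) =
      ∑ u, ∑ v, if G.Adj u v then k (att u v) v else 0 := by
  rw [← sum_fibre π]
  exact Finset.sum_congr rfl fun u _ => hB.sum_ports u k

include hB in
/-- Flows extend to blowups all of whose fibres are `S`-connected. -/
theorem IsBlowup.flowConnected {S : Type*} [AddCommGroup S] (hG : FlowConnected G S)
    (hfib : ∀ u (δ : V' → S), (∀ p, π p ≠ u → δ p = 0) → ∑ p, δ p = 0 →
      ∃ g, IsFlow (fibreGraph G' π u) δ g) : FlowConnected G' S := by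
  intro γ hγ
  obtain ⟨f, hf⟩ := hG (fun u => ∑ p, if π p = u then γ p else 0) (by rw [sum_fibre, hγ])
  -- `F` lifts the base flow to the edges between different fibres.
  set F : V' → V' → S := fun p q => if G'.Adj p q ∧ π q ≠ π p then f (π p) (π q) else 0 with hF
  have hFsum : ∀ u, ∑ p, (if π p = u then ∑ q, F p q else 0) =
      ∑ p, if π p = u then γ p else 0 := by
    intro u
    rw [← hf.sum_eq u]
    trans ∑ v, if G.Adj u v then f (π (att u v)) (π (att v (π (att u v)))) else 0
    · rw [← hB.sum_ports u fun p v => f (π p) (π (att v (π p)))]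
      refine Finset.sum_congr rfl fun p _ => ?_
      rw [← hB.sum_outer p fun q => f (π p) (π q)]
    · refine Finset.sum_congr rfl fun v _ => ?_
      split_ifs with h
      · rw [hB.proj_att u v h, hB.proj_att v u h.symm]
      · exact (hf.eq_zero u v h).symm
  -- The demand left inside the fibre of `u` has sum zero, because the base flow was solved for the
  -- total of `γ` on that fibre.
  have hδ : ∀ u, ∃ g, IsFlow (fibreGraph G' π u)
      (fun p => if π p = u then γ p - ∑ q, F p q else 0) g := by
    intro u
    refine hfib u _ (fun p hp => if_neg hp) ?_
    have : ∀ p, (if π p = u then γ p - ∑ q, F p q else 0) =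
        (if π p = u then γ p else 0) - if π p = u then ∑ q, F p q else 0 := by
      intro p
      split_ifs <;> simp
    simp only [this, Finset.sum_sub_distrib, hFsum, sub_self]
  choose g hg using hδ
  -- Between fibres the second summand vanishes, within a fibre the first one does.
  refine ⟨fun p q => F p q + g (π p) p q, ⟨?_, ?_, ?_, ?_⟩⟩
  · intro p q
    by_cases h : π q = π p
    · simp [hF, h, (hg (π p)).antisymm p q]
    · rw [(hg (π p)).eq_zero p q fun h' => h h'.2.2, (hg (π q)).eq_zero q p fun h' => h h'.2.2.symm]
      simp only [hF, G'.adj_comm q p, ne_comm (a := π p), add_zero]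
      split_ifs
      · exact hf.antisymm _ _
      · simp
  · intro p q h
    by_cases hne : π q = π p
    · have := (hg (π p)).ne_zero p q ⟨h, rfl, hne⟩
      simpa [hF, hne] using this
    · rw [(hg (π p)).eq_zero p q fun h' => hne h'.2.2]
      simp only [hF, h, ne_eq, hne, not_false_eq_true, and_self, if_true, add_zero]
      exact hf.ne_zero _ _ (hB.adj_proj h hne)
  · intro p q h
    rw [(hg (π p)).eq_zero p q fun h' => h h'.1]
    simp [hF, h]
  · intro p
    rw [Finset.sum_add_distrib, (hg (π p)).sum_eq p, if_pos rfl]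
    abel

/-- The function on the pairs of vertices of `V` obtained by contracting the fibres. -/
noncomputable def contract {S : Type*} [AddCommGroup S] (π : V' → V) (f : V' → V' → S) (u v : V) :
    S :=
  ∑ p, ∑ q, if π p = u ∧ π q = v then f p q else 0

include hB in
lemma IsBlowup.contract_apply {S : Type*} [AddCommGroup S] {γ : V' → S} {f : V' → V' → S}
    (hf : IsFlow G' γ f) {u v : V} (h : G.Adj u v) :
    contract π f u v = f (att u v) (att v u) := by
  rw [contract, Finset.sum_eq_single (att u v), Finset.sum_eq_single (att v u)]
  · rw [if_pos ⟨hB.proj_att u v h, hB.proj_att v u h.symm⟩]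
  · rintro q - hq
    split_ifs with hπ
    · refine hf.eq_zero _ _ fun hadj => hq ?_
      rw [← hB.att_proj hadj.symm (by rw [hπ.1, hπ.2]; exact h.ne), hπ.1, hπ.2]
    · rfl
  · simp
  · rintro p - hp
    refine Finset.sum_eq_zero fun q _ => ?_
    split_ifs with hπ
    · refine hf.eq_zero _ _ fun hadj => hp ?_
      rw [← hB.att_proj hadj (by rw [hπ.1, hπ.2]; exact h.ne'), hπ.1, hπ.2]
    · rfl
  · simp

include hB in
lemma IsBlowup.isFlow_contract {S : Type*} [AddCommGroup S] {γ : V' → S} {f : V' → V' → S}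
    (hf : IsFlow G' γ f) :
    IsFlow G (fun u => ∑ p, if π p = u then γ p else 0) (contract π f) where
  antisymm u v := by
    rw [contract, contract, Finset.sum_comm, ← Finset.sum_neg_distrib]
    refine Finset.sum_congr rfl fun p _ => ?_
    rw [← Finset.sum_neg_distrib]
    refine Finset.sum_congr rfl fun q _ => ?_
    simp only [hf.antisymm p q, and_comm (a := π q = v)]
    split_ifs <;> simp
  ne_zero u v h := by
    rw [hB.contract_apply hf h]
    exact hf.ne_zero _ _ (hB.adj_att h)
  eq_zero u v h := by
    rcases eq_or_ne u v with rfl | hne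
    -- The entry at `(u, u)` collects the flow inside one fibre, which cancels in pairs.
    · have := sum_sum_eq_zero_of_antisymm (Finset.univ.filter fun p => π p = u) hf.antisymm
        fun p => hf.eq_zero p p G'.irrefl
      rw [← this, contract, Finset.sum_filter]
      refine Finset.sum_congr rfl fun p _ => ?_
      by_cases hp : π p = u <;> simp [hp, Finset.sum_filter]
    · refine Finset.sum_eq_zero fun p _ => Finset.sum_eq_zero fun q _ => ?_
      split_ifs with hπ
      · refine hf.eq_zero _ _ fun hadj => h ?_
        rw [← hπ.1, ← hπ.2]
        exact hB.adj_proj hadj (by rw [hπ.1, hπ.2]; exact hne.symm)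
      · rfl
  sum_eq u := by
    simp only [contract]
    rw [Finset.sum_comm]
    refine Finset.sum_congr rfl fun p _ => ?_
    rw [Finset.sum_comm]
    by_cases hp : π p = u <;> simp [hp, hf.sum_eq]

include hB in
/-- Contracting the fibres preserves `S`-connectivity. -/
theorem IsBlowup.flowConnected_base {S : Type*} [AddCommGroup S] (hsurj : Function.Surjective π)
    (hG' : FlowConnected G' S) : FlowConnected G S := by
  intro γ hγ
  -- The boundary of the base vertex is concentrated at one representative of its fibre.
  choose r hr using hsurj
  have hsum : ∀ u, ∑ p, (if π p = u then (if r (π p) = p then γ (π p) else 0) else 0) = γ u := by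
    intro u
    rw [Finset.sum_eq_single (r u)]
    · simp [hr]
    · rintro p - hp
      split_ifs with h1 h2
      · exact absurd (h1 ▸ h2).symm hp
      · rfl
      · rfl
    · simp
  obtain ⟨f, hf⟩ := hG' (fun p => if r (π p) = p then γ (π p) else 0) 
    ((sum_fibre π _).symm.trans ((Finset.sum_congr rfl fun u _ => hsum u).trans hγ))
  have := hB.isFlow_contract hf
  simp only [hsum] at this
  exact ⟨_, this⟩

lemma degree_eq_sum (G : SimpleGraph V) (u : V) [Fintype (G.neighborSet u)] :
    G.degree u = ∑ v, if G.Adj u v then 1 else 0 := by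
  rw [← Finset.card_filter, ← SimpleGraph.card_neighborFinset_eq_degree]
  congr 1
  ext v
  simp

include hB in
lemma IsBlowup.sum_adj (p : V') :
    ∑ q, (if G'.Adj p q then 1 else 0) = ∑ q, (if G'.Adj p q ∧ π q = π p then 1 else 0) +
      ∑ v, if G.Adj (π p) v ∧ att (π p) v = p then 1 else 0 := by
  rw [← hB.sum_outer p fun _ => 1, ← Finset.sum_add_distrib]
  refine Finset.sum_congr rfl fun q _ => ?_
  by_cases h1 : G'.Adj p q <;> by_cases h2 : π q = π p <;> simp [h1, h2]

include hB in
lemma IsBlowup.cutSize_eq (X : Set V') :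
    cutSize G' X = ∑ u, cutSize (fibreGraph G' π u) X +
      ∑ u, ∑ v, if G.Adj u v ∧ att u v ∈ X ∧ att v u ∉ X then 1 else 0 := by
  have h1 : ∑ u, cutSize (fibreGraph G' π u) X =
      ∑ p, ∑ q, if p ∈ X ∧ q ∉ X ∧ G'.Adj p q ∧ π q = π p then 1 else 0 := by
    simp only [cutSize]
    rw [Finset.sum_comm]
    refine Finset.sum_congr rfl fun p _ => ?_
    rw [Finset.sum_comm]
    refine Finset.sum_congr rfl fun q _ => ?_
    rw [Finset.sum_eq_single (π p)]
    · simp [fibreGraph]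
    · rintro u - hu
      exact if_neg fun h => hu h.2.2.2.1.symm
    · simp
  have h2 : ∑ u, ∑ v, (if G.Adj u v ∧ att u v ∈ X ∧ att v u ∉ X then 1 else 0) =
      ∑ p, ∑ q, if p ∈ X ∧ q ∉ X ∧ G'.Adj p q ∧ π q ≠ π p then 1 else 0 := by
    trans ∑ u, ∑ v, if G.Adj u v then
        (if att u v ∈ X ∧ att v (π (att u v)) ∉ X then 1 else 0) else 0
    · refine Finset.sum_congr rfl fun u _ => Finset.sum_congr rfl fun v _ => ?_
      by_cases h : G.Adj u v
      · simp [h, hB.proj_att u v h]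
      · simp [h]
    · rw [← hB.sum_all_ports fun p v => if p ∈ X ∧ att v (π p) ∉ X then 1 else 0]
      refine Finset.sum_congr rfl fun p _ => ?_
      rw [← hB.sum_outer p fun q => if p ∈ X ∧ q ∉ X then 1 else 0]
      refine Finset.sum_congr rfl fun q _ => ?_
      by_cases h1 : G'.Adj p q <;> by_cases h2 : π q = π p <;> simp [h1, h2]
  rw [h1, h2, cutSize, ← Finset.sum_add_distrib]
  refine Finset.sum_congr rfl fun p _ => ?_
  rw [← Finset.sum_add_distrib]
  refine Finset.sum_congr rfl fun q _ => ?_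
  by_cases h1 : G'.Adj p q <;> by_cases h2 : π q = π p <;> simp [h1, h2]

include hB in
-- The argument goes by the number of fibres which `X` splits. A split fibre contributes at least
-- two inner edges, so two split fibres give four. If none is split, the cut is a cut of `G`. If
-- only `w` is split, either all other fibres lie on one side and `hfib` applies, or the cuts of `G`
-- around the fully contained fibres, with and without `w`, give at least two further edges away
-- from `w`.
theorem IsBlowup.isEdgeConnected (hG : G.IsEdgeConnected 3)
    (hdeg : ∀ u, ∑ v, (if G.Adj u v then 1 else 0) = 3)
    (hfib : ∀ u (X : Set V'), (∃ p ∈ X, π p = u) → (∃ p ∉ X, π p = u) →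
      3 ≤ cutSize (fibreGraph G' π u) X + ∑ v, if G.Adj u v ∧ att u v ∈ X then 1 else 0) :
    G'.IsEdgeConnected 3 := by
  rw [isEdgeConnected_iff] at hG ⊢
  rintro X ⟨x, hx⟩ ⟨y, hy⟩
  have hfib' : ∀ u, (∃ p ∈ X, π p = u) → (∃ p ∉ X, π p = u) →
      3 ≤ cutSize (fibreGraph G' π u) X + ∑ v, if G.Adj u v ∧ att u v ∉ X then 1 else 0 := by
    intro u h1 h2
    have := hfib u Xᶜ h2 (by simpa using h1)
    simpa only [cutSize_compl, Set.mem_compl_iff] using this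
  -- The three base edges at `u` are shared between `X` and its complement, so `hfib` for both sides
  -- gives `6 ≤ 2 * cut + 3`.
  have hsplit : ∀ u, (∃ p ∈ X, π p = u) → (∃ p ∉ X, π p = u) →
      2 ≤ cutSize (fibreGraph G' π u) X := by
    intro u h1 h2
    have ha := hfib u X h1 h2
    have hb := hfib' u h1 h2
    have hab : ∑ v, (if G.Adj u v ∧ att u v ∈ X then 1 else 0) +
        ∑ v, (if G.Adj u v ∧ att u v ∉ X then 1 else 0) = 3 := by
      rw [← hdeg u, ← Finset.sum_add_distrib]
      refine Finset.sum_congr rfl fun v _ => ?_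
      by_cases h : G.Adj u v <;> by_cases h' : att u v ∈ X <;> simp [h, h']
    omega
  rw [hB.cutSize_eq]
  set c := ∑ u, ∑ v, if G.Adj u v ∧ att u v ∈ X ∧ att v u ∉ X then 1 else 0 with hc
  by_cases hex : ∃ u, (∃ p ∈ X, π p = u) ∧ ∃ p ∉ X, π p = u
  · obtain ⟨w, hw1, hw2⟩ := hex
    have hdw := hsplit w hw1 hw2
    have hle : cutSize (fibreGraph G' π w) X ≤ ∑ u, cutSize (fibreGraph G' π u) X :=
      Finset.single_le_sum (f := fun u => cutSize (fibreGraph G' π u) X)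
        (fun _ _ => Nat.zero_le _) (Finset.mem_univ w)
    by_cases hex2 : ∃ u, u ≠ w ∧ (∃ p ∈ X, π p = u) ∧ ∃ p ∉ X, π p = u
    · obtain ⟨u, hne, hu1, hu2⟩ := hex2
      have hdu := hsplit u hu1 hu2
      have := Finset.sum_le_sum_of_subset (f := fun u => cutSize (fibreGraph G' π u) X)
        (Finset.subset_univ {u, w})
      rw [Finset.sum_pair hne] at this
      omega
    push Not at hex2
    by_cases hY : ∀ u, u ≠ w → ∀ p, π p = u → p ∉ X
    · have : ∑ v, (if G.Adj w v ∧ att w v ∈ X then 1 else 0) ≤ c := by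
        refine le_trans (Finset.sum_le_sum fun v _ => ?_) (Finset.single_le_sum (f := fun u =>
          ∑ v, if G.Adj u v ∧ att u v ∈ X ∧ att v u ∉ X then 1 else 0)
          (fun _ _ => Nat.zero_le _) (Finset.mem_univ w))
        by_cases h : G.Adj w v
        · have := hY v h.ne' _ (hB.proj_att v w h.symm)
          simp [h, this]
        · simp [h]
      have := hfib w X hw1 hw2
      omega
    by_cases hZ : ∀ u, u ≠ w → ∀ p, π p = u → p ∈ X
    · have : ∑ v, (if G.Adj w v ∧ att w v ∉ X then 1 else 0) ≤ c := by
        rw [hc, Finset.sum_comm]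
        refine le_trans (Finset.sum_le_sum fun v _ => ?_) (Finset.single_le_sum (f := fun v =>
          ∑ u, if G.Adj u v ∧ att u v ∈ X ∧ att v u ∉ X then 1 else 0)
          (fun _ _ => Nat.zero_le _) (Finset.mem_univ w))
        by_cases h : G.Adj w v
        · have := hZ v h.ne' _ (hB.proj_att v w h.symm)
          simp [h, h.symm, this]
        · simp [h]
      have := hfib' w hw1 hw2
      omega
    push Not at hY hZ
    obtain ⟨y, hyw, p, hpy, hpX⟩ := hY
    obtain ⟨z, hzw, q, hqz, hqX⟩ := hZ
    set Y : Set V := {u | u ≠ w ∧ ∃ p ∈ X, π p = u} with hYdef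
    have hYX : ∀ u ∈ Y, ∀ p, π p = u → p ∈ X := fun u hu p hp =>
      by_contra fun h => hex2 u hu.1 hu.2 p h hp
    have hzY : z ∉ Y := fun h => hqX (hYX z h q hqz)
    have h1 := hG Y ⟨y, hyw, p, hpX, hpy⟩ ⟨z, hzY⟩
    have h2 := hG (insert w Y) ⟨w, Set.mem_insert _ _⟩ ⟨z, by simp [hzw, hzY]⟩
    -- The edges from `Y` to the outside which avoid `w`; they survive in the cut of `X`.
    set e := ∑ u, ∑ v, if u ∈ Y ∧ v ∉ Y ∧ v ≠ w ∧ G.Adj u v then 1 else 0 with he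
    have hec : e ≤ c := by
      refine Finset.sum_le_sum fun u _ => Finset.sum_le_sum fun v _ => ?_
      by_cases h : u ∈ Y ∧ v ∉ Y ∧ v ≠ w ∧ G.Adj u v
      · have hv : att v u ∉ X := fun hv => h.2.1 ⟨h.2.2.1, _, hv, hB.proj_att v u h.2.2.2.symm⟩
        have hu : att u v ∈ X := hYX u h.1 _ (hB.proj_att u v h.2.2.2)
        simp [h, hv, hu]
      · simp [h]
    -- Edges avoiding `w` count in both cuts, while each of the three edges at `w` counts in only
    -- one: in the first if it leads into `Y`, in the second otherwise. As both cuts have size at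
    -- least three, `e` is at least two.
    have hsum : cutSize G Y + cutSize G (insert w Y) ≤ 2 * e + 3 := by
      have hw3 : ∑ u, ∑ v, ((if u = w ∧ v ∉ Y ∧ G.Adj u v then 1 else 0) +
          (if v = w ∧ u ∈ Y ∧ G.Adj u v then 1 else 0)) = 3 := by
        have h3 : ∑ u, ∑ v, (if u = w ∧ v ∉ Y ∧ G.Adj u v then 1 else 0) =
            ∑ v, if v ∉ Y ∧ G.Adj w v then 1 else 0 := by
          rw [Finset.sum_eq_single w]
          · simp
          · rintro u - hu
            simp [hu]
          · simp
        have h4 : ∑ u, ∑ v, (if v = w ∧ u ∈ Y ∧ G.Adj u v then 1 else 0) =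
            ∑ u, if u ∈ Y ∧ G.Adj w u then 1 else 0 := by
          refine Finset.sum_congr rfl fun u _ => ?_
          rw [Finset.sum_eq_single w]
          · simp [G.adj_comm u w]
          · rintro v - hv
            simp [hv]
          · simp
        simp only [Finset.sum_add_distrib]
        rw [h3, h4, ← Finset.sum_add_distrib, ← hdeg w]
        refine Finset.sum_congr rfl fun v _ => ?_
        by_cases hv : v ∈ Y <;> by_cases ha : G.Adj w v <;> simp [hv, ha]
      rw [← hw3, he, cutSize, cutSize, Finset.mul_sum, ← Finset.sum_add_distrib,
        ← Finset.sum_add_distrib]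
      refine Finset.sum_le_sum fun u _ => ?_
      rw [Finset.mul_sum, ← Finset.sum_add_distrib, ← Finset.sum_add_distrib]
      refine Finset.sum_le_sum fun v _ => ?_
      have hwY : w ∉ Y := fun h => h.1 rfl
      by_cases ha : G.Adj u v
      · by_cases huw : u = w
        · subst huw
          by_cases hv : v ∈ Y <;> simp [hv, ha, hwY, ha.ne']
        · by_cases hvw : v = w
          · subst hvw
            by_cases hu : u ∈ Y <;> simp [hu, ha, hwY, huw]
          · by_cases hu : u ∈ Y <;> by_cases hv : v ∈ Y <;> simp [hu, hv, ha, huw, hvw]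
      · simp [ha]
    omega
  · push Not at hex
    set Y : Set V := {u | ∃ p ∈ X, π p = u} with hYdef
    refine le_trans (hG Y ⟨π x, x, hx, rfl⟩ ⟨π y, fun h => hex _ h y hy rfl⟩)
      (le_trans ?_ (Nat.le_add_left _ _))
    refine Finset.sum_le_sum fun u _ => Finset.sum_le_sum fun v _ => ?_
    by_cases h : u ∈ Y ∧ v ∉ Y ∧ G.Adj u v
    · have hv : att v u ∉ X := fun hv => h.2.1 ⟨_, hv, hB.proj_att v u h.2.2.symm⟩
      have hu : att u v ∈ X := by_contra fun hu => hex u h.1 _ hu (hB.proj_att u v h.2.2)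
      simp [h, hv, hu]
    · simp [h]

end

/-! ### Cubic connected graphs, embedded pieces and isomorphisms -/

open Classical in
/-- `G` is cubic, 3-edge-connected and `S`-connected. -/
structure CubicConnected {V : Type*} [Fintype V] (S : Type*) [AddCommGroup S]
    (G : SimpleGraph V) : Prop where
  sum_adj : ∀ u, ∑ v, (if G.Adj u v then 1 else 0) = 3
  isEdgeConnected : G.IsEdgeConnected 3
  flowConnected : FlowConnected G S

lemma isCubicExample_iff {V : Type*} [Fintype V] {S T : Type*} [AddCommGroup S] [AddCommGroup T]
    {G : SimpleGraph V} : IsCubicExample S T G ↔ CubicConnected S G ∧ ¬ FlowConnected G T := by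
  simp only [IsCubicExample, groupConnected_iff, SimpleGraph.IsRegularOfDegree, degree_eq_sum]
  exact ⟨fun h => ⟨⟨h.1, h.2.1, h.2.2.1⟩, h.2.2.2⟩, fun h => ⟨h.1.1, h.1.2, h.1.3, h.2⟩⟩

section Embedding

variable {W V' : Type*} [Fintype W] [Fintype V'] {K : SimpleGraph W} {L : SimpleGraph V'}
  {ι : W → V'}

/-- Fibre graphs live on the whole vertex set, with isolated vertices outside the fibre. Flows of
the abstract piece `K` are pushed forward to such a graph `L`. -/
lemma exists_isFlow_of_injective {S : Type*} [AddCommGroup S] (hι : Function.Injective ι)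
    (hL : ∀ p q, L.Adj p q ↔ ∃ a b, K.Adj a b ∧ ι a = p ∧ ι b = q) (hK : FlowConnected K S)
    {δ : V' → S} (hδ : ∀ p, p ∉ Set.range ι → δ p = 0) (hsum : ∑ p, δ p = 0) :
    ∃ g, IsFlow L δ g := by
  classical
  have hpull : ∀ p, ∑ a, (if ι a = p then δ (ι a) else 0) = δ p := by
    intro p
    by_cases hp : p ∈ Set.range ι
    · obtain ⟨a, rfl⟩ := hp
      rw [Finset.sum_eq_single a]
      · simp
      · rintro b - hb
        exact if_neg fun h => hb (hι h)
      · simp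
    · rw [hδ p hp]
      exact Finset.sum_eq_zero fun a _ => if_neg fun h => hp ⟨a, h⟩
  obtain ⟨f, hf⟩ := hK (δ ∘ ι) (by
    rw [← hsum, Finset.sum_congr rfl fun p _ => (hpull p).symm, Finset.sum_comm]
    simp)
  have happ : ∀ a b, ∑ a', ∑ b', (if ι a' = ι a ∧ ι b' = ι b then f a' b' else 0) = f a b := by
    intro a b
    rw [Finset.sum_eq_single a, Finset.sum_eq_single b]
    · simp
    · rintro b' - hb
      exact if_neg fun h => hb (hι h.2)
    · simp
    · rintro a' - ha
      exact Finset.sum_eq_zero fun b' _ => if_neg fun h => ha (hι h.1)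
    · simp
  refine ⟨fun p q => ∑ a, ∑ b, if ι a = p ∧ ι b = q then f a b else 0, ⟨?_, ?_, ?_, ?_⟩⟩
  · intro p q
    rw [Finset.sum_comm, ← Finset.sum_neg_distrib]
    refine Finset.sum_congr rfl fun a _ => ?_
    rw [← Finset.sum_neg_distrib]
    refine Finset.sum_congr rfl fun b _ => ?_
    simp only [hf.antisymm a b, and_comm (a := ι b = q)]
    split_ifs <;> simp
  · intro p q h
    obtain ⟨a, b, hab, rfl, rfl⟩ := (hL p q).1 h
    rw [happ]
    exact hf.ne_zero a b hab
  · intro p q h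
    refine Finset.sum_eq_zero fun a _ => Finset.sum_eq_zero fun b _ => ?_
    split_ifs with hab
    · exact hf.eq_zero a b fun hadj => h ((hL p q).2 ⟨a, b, hadj, hab⟩)
    · rfl
  · intro p
    rw [Finset.sum_comm, ← hpull p]
    refine Finset.sum_congr rfl fun a _ => ?_
    rw [Finset.sum_comm]
    by_cases ha : ι a = p
    · subst ha
      simp [hf.sum_eq]
    · simp [ha]

lemma cutSize_preimage_le (hι : Function.Injective ι)
    (hL : ∀ p q, L.Adj p q ↔ ∃ a b, K.Adj a b ∧ ι a = p ∧ ι b = q) (X : Set V') :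
    cutSize K (ι ⁻¹' X) ≤ cutSize L X := by
  classical
  rw [cutSize_eq_card, cutSize_eq_card]
  refine Finset.card_le_card_of_injOn (fun x => (ι x.1, ι x.2)) ?_ ?_
  · rintro ⟨a, b⟩ h
    simp only [Finset.coe_filter, Finset.mem_univ, true_and, Set.mem_ofPred_eq,
      Set.mem_preimage] at h ⊢
    exact ⟨h.1, h.2.1, (hL _ _).2 ⟨a, b, h.2.2, rfl, rfl⟩⟩
  · rintro ⟨a, b⟩ - ⟨a', b'⟩ - h
    simp only [Prod.mk.injEq] at h
    exact Prod.ext (hι h.1) (hι h.2)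

end Embedding

section

variable {V V' : Type*} [Fintype V'] {G' : SimpleGraph V'} {π : V' → V}

lemma exists_isFlow_of_subsingleton_fibre {S : Type*} [AddCommGroup S] {u : V}
    (hu : ∀ p q, π p = u → π q = u → p = q) {δ : V' → S} (hδ : ∀ p, π p ≠ u → δ p = 0)
    (hsum : ∑ p, δ p = 0) : ∃ g, IsFlow (fibreGraph G' π u) δ g := by
  have h0 : ∀ p, δ p = 0 := by
    intro p
    by_cases hp : π p = u
    · rwa [Finset.sum_eq_single p] at hsum
      · exact fun q _ hq => hδ q fun h => hq (hu q p h hp)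
      · simp
    · exact hδ p hp
  exact ⟨fun _ _ => 0, by simp, fun p q h => absurd (hu p q h.2.1 h.2.2) h.1.ne, by simp,
    by simp [h0]⟩

end

section

set_option linter.unusedSectionVars false

variable {V V' : Type*} [Fintype V] [Fintype V'] {G' : SimpleGraph V'} {G : SimpleGraph V}
  {π : V' → V} {att : V → V → V'}

open Classical in
theorem IsBlowup.cubicConnected {S : Type*} [AddCommGroup S]
    (hB : IsBlowup G' G π att) (hG : CubicConnected S G)
    (hdeg : ∀ p, ∑ q, (if G'.Adj p q ∧ π q = π p then 1 else 0) +
      ∑ v, (if G.Adj (π p) v ∧ att (π p) v = p then 1 else 0) = 3)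
    (hcut : ∀ u (X : Set V'), (∃ p ∈ X, π p = u) → (∃ p ∉ X, π p = u) →
      3 ≤ cutSize (fibreGraph G' π u) X + ∑ v, if G.Adj u v ∧ att u v ∈ X then 1 else 0)
    (hfib : ∀ u (δ : V' → S), (∀ p, π p ≠ u → δ p = 0) → ∑ p, δ p = 0 →
      ∃ g, IsFlow (fibreGraph G' π u) δ g) : CubicConnected S G' :=
  ⟨fun p => (hB.sum_adj p).trans (hdeg p), hB.isEdgeConnected hG.2 hG.1 hcut,
    hB.flowConnected hG.3 hfib⟩

/-- An isomorphism is a blowup with one-vertex fibres, so invariance under isomorphism needs no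
separate proof. -/
lemma isBlowup_of_iso (e : G ≃g G') : IsBlowup G' G e.symm (fun u _ => e u) where
  proj_att u v _ := e.symm_apply_apply u
  adj_iff p q _ := by
    have := e.symm.map_adj_iff (v := p) (w := q)
    simp [this]

theorem CubicConnected.of_iso {S : Type*} [AddCommGroup S]
    (hG : CubicConnected S G) (e : G ≃g G') : CubicConnected S G' := by
  classical
  have hinj : ∀ u p q, e.symm p = u → e.symm q = u → p = q :=
    fun u p q h1 h2 => e.symm.injective (h1.trans h2.symm)
  refine (isBlowup_of_iso e).cubicConnected hG ?_ ?_ ?_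
  · intro p
    rw [Finset.sum_eq_zero, zero_add]
    · rw [← hG.1 (e.symm p)]
      simp
    · rintro q -
      exact if_neg fun h => h.1.ne (hinj _ _ _ h.2 rfl).symm
  · rintro u X ⟨p, hp, h1⟩ ⟨q, hq, h2⟩
    exact absurd (hinj u p q h1 h2 ▸ hp) hq
  · exact fun u δ hδ hsum => exists_isFlow_of_subsingleton_fibre (hinj u) hδ hsum

theorem IsCubicExample.of_iso {S T : Type*} [AddCommGroup S] [AddCommGroup T]
    (hG : IsCubicExample S T G) (e : G ≃g G') : IsCubicExample S T G' := by
  rw [isCubicExample_iff] at hG ⊢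
  exact ⟨hG.1.of_iso e,
    fun h => hG.2 ((isBlowup_of_iso e).flowConnected_base e.symm.surjective h)⟩

end

/-! ### Substituting triangles for vertices -/

section Triangle

/-- Orient the triangle cyclically, with `x i` on the edge from `i` to `i + 1`; in `Fin 3` the index
`i + 2` is the predecessor of `i`. -/
lemma flowConnected_top_fin_three {S : Type*} [AddCommGroup S]
    (hS : ∀ δ : Fin 3 → S, ∑ i, δ i = 0 →
      ∃ x : Fin 3 → S, (∀ i, x i ≠ 0) ∧ ∀ i, x i - x (i + 2) = δ i) :
    FlowConnected (⊤ : SimpleGraph (Fin 3)) S := by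
  intro δ hδ
  obtain ⟨x, hx, h⟩ := hS δ hδ
  refine ⟨fun i j => if j = i + 1 then x i else if i = j + 1 then - x j else 0, ⟨?_, ?_, ?_, ?_⟩⟩
  · intro i j
    fin_cases i <;> fin_cases j <;> simp [Fin.ext_iff]
  · intro i j
    fin_cases i <;> fin_cases j <;> simp [Fin.ext_iff, hx]
  · intro i j
    fin_cases i <;> fin_cases j <;> simp [Fin.ext_iff]
  · intro i
    rw [← h i]
    rw [Fin.sum_univ_three]
    fin_cases i <;> simp only [Fin.zero_eta, Fin.mk_one, Fin.reduceFinMk, Fin.reduceAdd,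
      Fin.isValue, Fin.reduceEq, if_true, if_false] <;> abel

/-- The solutions `x` for a given boundary differ by a common constant. Each of the three edges
excludes one constant, so in a group of order four one remains. The same holds for the Klein group.
-/
theorem flowConnected_triangle_zmod_four : FlowConnected (⊤ : SimpleGraph (Fin 3)) (ZMod 4) := by
  have key : ∀ a b c : ZMod 4, a + b + c = 0 →
      ∃ x y z : ZMod 4, x ≠ 0 ∧ y ≠ 0 ∧ z ≠ 0 ∧ x - z = a ∧ y - x = b ∧ z - y = c := by
    decide +kernel
  refine flowConnected_top_fin_three fun δ hδ => ?_
  obtain ⟨x, y, z, hx, hy, hz, h0, h1, h2⟩ := key (δ 0) (δ 1) (δ 2) (by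
    rw [← hδ, Fin.sum_univ_three])
  exact ⟨![x, y, z], by simp [Fin.forall_fin_succ, hx, hy, hz],
    by simp [Fin.forall_fin_succ, h0, h1, h2]⟩

theorem flowConnected_triangle_klein :
    FlowConnected (⊤ : SimpleGraph (Fin 3)) (ZMod 2 × ZMod 2) := by
  have key : ∀ a b c : ZMod 2 × ZMod 2, a + b + c = 0 →
      ∃ x y z : ZMod 2 × ZMod 2, x ≠ 0 ∧ y ≠ 0 ∧ z ≠ 0 ∧ x - z = a ∧ y - x = b ∧ z - y = c := by
    decide +kernel
  refine flowConnected_top_fin_three fun δ hδ => ?_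
  obtain ⟨x, y, z, hx, hy, hz, h0, h1, h2⟩ := key (δ 0) (δ 1) (δ 2) (by
    rw [← hδ, Fin.sum_univ_three])
  exact ⟨![x, y, z], by simp [Fin.forall_fin_succ, hx, hy, hz],
    by simp [Fin.forall_fin_succ, h0, h1, h2]⟩

lemma cutSize_top {W : Type*} [Fintype W] (X : Set W) :
    cutSize (⊤ : SimpleGraph W) X = X.ncard * Xᶜ.ncard := by
  classical
  rw [cutSize_eq_card, Set.ncard_eq_toFinset_card', Set.ncard_eq_toFinset_card',
    ← Finset.card_product]
  congr 1
  ext ⟨a, b⟩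
  simp only [SimpleGraph.top_adj, Finset.mem_filter, Finset.mem_univ, true_and, Finset.mem_product,
    Set.mem_toFinset, Set.mem_compl_iff]
  exact ⟨fun h => ⟨h.1, h.2.1⟩, fun h => ⟨h.1, h.2, fun hab => h.2 (hab ▸ h.1)⟩⟩

variable {V : Type*} (G : SimpleGraph V) (v : V)

/-- The projection which contracts the triangle substituted for `v`. -/
def triangleProj : {u : V // u ≠ v} ⊕ G.neighborSet v → V :=
  Sum.elim (fun a => a) (fun _ => v)

open Classical in
/-- The ends of the edges of `G` after substituting a triangle for `v`. -/
noncomputable def triangleAtt (w₀ : G.neighborSet v) (u x : V) :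
    {u : V // u ≠ v} ⊕ G.neighborSet v :=
  -- The last value is a default: it concerns only pairs `v`, `x` which are not joined in `G`.
  if h : u ≠ v then .inl ⟨u, h⟩ else if hx : x ∈ G.neighborSet v then .inr ⟨x, hx⟩ else .inr w₀

variable {G v}

lemma triangleAtt_of_ne (w₀ : G.neighborSet v) (a : {u : V // u ≠ v}) (x : V) :
    triangleAtt G v w₀ a x = .inl a := dif_pos a.2

lemma triangleAtt_self (w₀ : G.neighborSet v) (w : G.neighborSet v) :
    triangleAtt G v w₀ v w = .inr w := by
  rw [triangleAtt, dif_neg (by simp), dif_pos w.2]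

lemma isBlowup_triangleSubst (w₀ : G.neighborSet v) :
    IsBlowup (triangleSubst G v) G (triangleProj G v) (triangleAtt G v w₀) where
  proj_att u x h := by
    by_cases hu : u = v
    · subst hu
      rw [triangleAtt_self w₀ ⟨x, h⟩]
      rfl
    · rw [triangleAtt_of_ne w₀ ⟨u, hu⟩]
      rfl
  adj_iff p q hne := by
    rcases p with a | w <;> rcases q with b | w'
    · simp [triangleSubst, triangleProj, triangleAtt_of_ne]
    · simp only [triangleSubst, triangleProj, Sum.elim_inl, Sum.elim_inr, triangleAtt_of_ne,
        true_and]
      constructor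
      · intro h
        have hadj : G.Adj v a := h ▸ w'.2
        exact ⟨hadj.symm, by rw [h, triangleAtt_self]⟩
      · rintro ⟨hadj, h⟩
        rw [triangleAtt_self w₀ ⟨a, hadj.symm⟩] at h
        rw [← Sum.inr_injective h]
    · simp only [triangleSubst, triangleProj, Sum.elim_inl, Sum.elim_inr, triangleAtt_of_ne,
        and_true]
      constructor
      · intro h
        have hadj : G.Adj v b := h ▸ w.2
        exact ⟨hadj, by rw [h, triangleAtt_self]⟩
      · rintro ⟨hadj, h⟩
        rw [triangleAtt_self w₀ ⟨b, hadj⟩] at h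
        rw [← Sum.inr_injective h]
    · exact absurd rfl hne

end Triangle

lemma flowConnected_top_of_card {S : Type*} [AddCommGroup S]
    (hS : FlowConnected (⊤ : SimpleGraph (Fin 3)) S) {W : Type*} [Fintype W]
    (hW : Fintype.card W = 3) : FlowConnected (⊤ : SimpleGraph W) S := by
  intro δ hδ
  let e := (Fintype.equivFinOfCardEq hW).symm
  refine exists_isFlow_of_injective (ι := e) e.injective (fun p q => ?_) hS
    (fun p hp => absurd (e.surjective p) hp) hδ
  constructor
  · intro h
    exact ⟨e.symm p, e.symm q, fun h' => h (e.symm.injective h'), by simp, by simp⟩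
  · rintro ⟨a, b, hab, rfl, rfl⟩ h
    exact hab (e.injective h)

section

open Classical

variable {V : Type*} [Fintype V] {G : SimpleGraph V}

lemma card_neighborSet_of_sum {v : V} (h : ∑ u, (if G.Adj v u then 1 else 0) = 3) :
    Fintype.card (G.neighborSet v) = 3 := by
  rw [SimpleGraph.card_neighborSet_eq_degree, degree_eq_sum, h]

theorem CubicConnected.triangleSubst {S : Type*} [AddCommGroup S]
    (hS : FlowConnected (⊤ : SimpleGraph (Fin 3)) S) (hG : CubicConnected S G) (v : V) :
    CubicConnected S (triangleSubst G v) := by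
  have hsum := hG.1
  have hcard := card_neighborSet_of_sum (hsum v)
  obtain ⟨w₀⟩ : Nonempty (G.neighborSet v) := Fintype.card_pos_iff.1 (by omega)
  have hinj : ∀ u, u ≠ v → ∀ p q, triangleProj G v p = u → triangleProj G v q = u → p = q := by
    rintro u hu (a | w) (b | w') h1 h2
    · exact congrArg _ (Subtype.ext (h1.trans h2.symm))
    · exact absurd h2.symm hu
    · exact absurd h1.symm hu
    · exact absurd h1.symm hu
  have hL : ∀ p q, (fibreGraph (GroupConn.triangleSubst G v) (triangleProj G v) v).Adj p q ↔
      ∃ a b, (⊤ : SimpleGraph (G.neighborSet v)).Adj a b ∧ Sum.inr a = p ∧ Sum.inr b = q := by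
    rintro (a | w) (b | w')
    · simp [fibreGraph, triangleProj, a.2]
    · simp [fibreGraph, triangleProj, a.2]
    · simp [fibreGraph, triangleProj, b.2]
    · simp only [fibreGraph, triangleProj, GroupConn.triangleSubst, Sum.elim_inr, and_true,
        SimpleGraph.top_adj, Sum.inr.injEq]
      exact ⟨fun h => ⟨w, w', h, rfl, rfl⟩, fun ⟨_, _, h, h1, h2⟩ => h1 ▸ h2 ▸ h⟩
  refine (isBlowup_triangleSubst w₀).cubicConnected hG ?_ ?_ ?_
  · rintro (a | w)
    · rw [Finset.sum_eq_zero, zero_add]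
      · rw [← hsum a]
        simp [triangleProj, triangleAtt_of_ne]
      · rintro q -
        exact if_neg fun h => h.1.ne (hinj a a.2 _ _ h.2 rfl).symm
    · have h1 : ∑ q, (if (GroupConn.triangleSubst G v).Adj (.inr w) q ∧
          triangleProj G v q = triangleProj G v (.inr w) then 1 else 0) = 2 := by
        rw [Fintype.sum_sum_type, Finset.sum_eq_zero, zero_add]
        · have : ∀ w', (if (GroupConn.triangleSubst G v).Adj (.inr w) (.inr w') ∧
              triangleProj G v (.inr w') = triangleProj G v (.inr w) then 1 else 0) =
              if w' ∈ Finset.univ.erase w then 1 else 0 := by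
            intro w'
            simp [triangleProj, GroupConn.triangleSubst, eq_comm]
          simp only [this]
          rw [← Finset.card_filter, Finset.filter_mem_eq_inter, Finset.univ_inter,
            Finset.card_erase_of_mem (Finset.mem_univ _), Finset.card_univ, hcard]
        · rintro a -
          exact if_neg fun h => a.2 h.2
      have h2 : ∑ x, (if G.Adj (triangleProj G v (.inr w)) x ∧
          triangleAtt G v w₀ (triangleProj G v (.inr w)) x = .inr w then 1 else 0) = 1 := by
        rw [Finset.sum_eq_single (w : V)]
        · exact if_pos ⟨w.2, triangleAtt_self _ _⟩
        · rintro x - hx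
          refine if_neg fun h => hx ?_
          have := h.2.symm.trans (triangleAtt_self w₀ ⟨x, h.1⟩)
          rw [Sum.inr_injective this]
        · simp
      convert congrArg₂ (· + ·) h1 h2
  · rintro u X ⟨p, hp, hpu⟩ ⟨q, hq, hqu⟩
    by_cases hu : u = v
    · subst hu
      have hle := cutSize_preimage_le Sum.inr_injective hL X
      set Y : Set (G.neighborSet u) := Sum.inr ⁻¹' X with hY
      have hYc : ∑ x, (if G.Adj u x ∧ triangleAtt G u w₀ u x ∈ X then 1 else 0) = Y.ncard := by
        rw [Set.ncard_eq_toFinset_card', ← Finset.card_filter]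
        symm
        refine Finset.card_bij (fun x _ => (x : V)) ?_ ?_ ?_
        · intro x hx
          rw [Set.mem_toFinset] at hx
          rw [Finset.mem_filter, triangleAtt_self]
          exact ⟨Finset.mem_univ _, x.2, hx⟩
        · intro x _ y _ h
          exact Subtype.ext h
        · intro x hx
          rw [Finset.mem_filter] at hx
          refine ⟨⟨x, hx.2.1⟩, ?_, rfl⟩
          rw [Set.mem_toFinset, hY, Set.mem_preimage, ← triangleAtt_self w₀ ⟨x, hx.2.1⟩]
          exact hx.2.2
      rw [hYc]
      have htot : Y.ncard + Yᶜ.ncard = 3 := by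
        rw [Set.ncard_add_ncard_compl, Nat.card_eq_fintype_card, hcard]
      have h1 : 0 < Y.ncard := by
        rcases p with a | w
        · exact absurd hpu a.2
        · exact (Set.ncard_pos).2 ⟨w, hp⟩
      have h2 : 0 < Yᶜ.ncard := by
        rcases q with a | w
        · exact absurd hqu a.2
        · exact (Set.ncard_pos).2 ⟨w, hq⟩
      rw [cutSize_top] at hle
      refine le_trans ?_ (Nat.add_le_add_right hle _)
      -- With `k` triangle vertices in `X`, the bound is `k * (3 - k) + k`, which is `3` for `k = 1`
      -- and `4` for `k = 2`.
      have h3 : Y.ncard = 1 ∨ Y.ncard = 2 := by omega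
      rcases h3 with h3 | h3
      · rw [h3] at htot ⊢; omega
      · rw [h3] at htot ⊢; omega
    · exact absurd (hinj u hu p q hpu hqu ▸ hp) hq
  · intro u δ hδ hδsum
    by_cases hu : u = v
    · subst hu
      refine exists_isFlow_of_injective Sum.inr_injective hL
        (flowConnected_top_of_card hS hcard) (fun p hp => ?_) hδsum
      rcases p with a | w
      · exact hδ _ a.2
      · exact absurd ⟨w, rfl⟩ hp
    · exact exists_isFlow_of_subsingleton_fibre (hinj u hu) hδ hδsum

/-- The failure for `T` survives because contracting the triangle would carry `T`-connectivity back
to `G`. -/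
theorem IsCubicExample.triangleSubst {S T : Type*} [AddCommGroup S] [AddCommGroup T]
    (hS : FlowConnected (⊤ : SimpleGraph (Fin 3)) S) (hG : IsCubicExample S T G) (v : V) :
    IsCubicExample S T (triangleSubst G v) := by
  rw [isCubicExample_iff] at hG ⊢
  have hcard := card_neighborSet_of_sum (hG.1.1 v)
  obtain ⟨w₀⟩ : Nonempty (G.neighborSet v) := Fintype.card_pos_iff.1 (by omega)
  refine ⟨hG.1.triangleSubst hS v,
    fun h => hG.2 ((isBlowup_triangleSubst w₀).flowConnected_base (fun u => ?_) h)⟩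
  by_cases hu : u = v
  · exact ⟨.inr w₀, hu.symm⟩
  · exact ⟨.inl ⟨u, hu⟩, rfl⟩

lemma card_triangleSubst {v : V} (h : Fintype.card (G.neighborSet v) = 3) :
    Nat.card ({u : V // u ≠ v} ⊕ G.neighborSet v) = Fintype.card V + 2 := by
  have : 0 < Fintype.card V := Fintype.card_pos_iff.2 ⟨v⟩
  rw [Nat.card_eq_fintype_card, Fintype.card_sum, h, Fintype.card_subtype_compl,
    Fintype.card_subtype_eq]
  omega

end

/-- Derivations do not mention finiteness of the intermediate vertex types, so it is produced along
the induction. -/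
theorem TriangleDerived.isCubicExample {S T : Type*} [AddCommGroup S] [AddCommGroup T]
    (hS : FlowConnected (⊤ : SimpleGraph (Fin 3)) S) {V : Type} [Fintype V] {G : SimpleGraph V}
    (hG : IsCubicExample S T G) {W : Type} {H : SimpleGraph W} (h : TriangleDerived G H) :
    ∃ _ : Fintype W, IsCubicExample S T H := by
  classical
  induction h with
  | of_iso e =>
    obtain ⟨e⟩ := e
    let _ := Fintype.ofEquiv _ e.toEquiv
    exact ⟨_, hG.of_iso e⟩
  | step _ v _ e ih =>
    obtain ⟨_, ih⟩ := ih
    obtain ⟨e⟩ := e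
    let _ := Fintype.ofEquiv _ e.toEquiv
    exact ⟨_, (ih.triangleSubst hS v).of_iso e⟩

theorem triangleFamily_of_isCubicExample {S T : Type*} [AddCommGroup S] [AddCommGroup T]
    (hS : FlowConnected (⊤ : SimpleGraph (Fin 3)) S) {V : Type} [Fintype V] {G : SimpleGraph V}
    (hG : IsCubicExample S T G) : TriangleFamily S T G := by
  classical
  -- A vertex is needed for every substitution. On an empty vertex set the zero function is a flow,
  -- against the failure of `T`-connectivity.
  have hV : 0 < Fintype.card V := by
    by_contra h0
    have : IsEmpty V := Fintype.card_eq_zero_iff.1 (by omega)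
    refine (isCubicExample_iff.1 hG).2 fun γ _ => ⟨fun _ _ => 0, ?_, ?_, ?_, ?_⟩ <;>
      exact fun u => isEmptyElim u
  refine ⟨fun W _ H hH => ?_, fun n => ?_⟩
  · obtain ⟨i, h⟩ := hH.isCubicExample hS hG
    convert h
  · induction n with
    | zero =>
      exact ⟨_, .of_iso ⟨SimpleGraph.Iso.map (Fintype.equivFinOfCardEq (by simp)) G⟩⟩
    | succ n ih =>
      obtain ⟨H, hH⟩ := ih
      let v : Fin (Fintype.card V + 2 * n) := ⟨0, by omega⟩
      obtain ⟨i, h⟩ := hH.isCubicExample hS hG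
      have hcard : Fintype.card (H.neighborSet v) = 3 := by
        have := card_neighborSet_of_sum ((isCubicExample_iff.1 h).1.1 v)
        convert this
      refine ⟨_, .step hH v ?_ ⟨SimpleGraph.Iso.map (Finite.equivFinOfCardEq ?_) _⟩⟩
      · rw [Set.ncard_eq_toFinset_card', Set.toFinset_card, hcard]
      · rw [card_triangleSubst hcard, ← Nat.card_eq_fintype_card, Nat.card_fin]
        ring

/-! ### Replacing every vertex by a copy of one graph -/

section Replace

variable {V W : Type*} {F : SimpleGraph V} {H : SimpleGraph W} {att : V → V → W}

lemma isBlowup_replaceVertices (F : SimpleGraph V) (H : SimpleGraph W) (att : V → V → W) :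
    IsBlowup (replaceVertices F H att) F Prod.fst (fun u v => (u, att u v)) where
  proj_att _ _ _ := rfl
  adj_iff p q hne := by
    simp only [replaceVertices, Ne.symm hne, false_and, false_or, Prod.ext_iff, true_and]
    exact and_congr_right fun _ => and_congr eq_comm eq_comm

lemma fibreGraph_replaceVertices_adj {u : V} (p q : V × W) :
    (fibreGraph (replaceVertices F H att) Prod.fst u).Adj p q ↔
      ∃ a b, H.Adj a b ∧ (u, a) = p ∧ (u, b) = q := by
  obtain ⟨p₁, p₂⟩ := p
  obtain ⟨q₁, q₂⟩ := q
  simp only [fibreGraph, replaceVertices, Prod.mk.injEq]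
  constructor
  · rintro ⟨⟨h, h'⟩ | ⟨h, -⟩, rfl, rfl⟩
    · exact ⟨p₂, q₂, h', ⟨rfl, rfl⟩, rfl, rfl⟩
    · exact absurd h F.irrefl
  · rintro ⟨a, b, h, ⟨rfl, rfl⟩, rfl, rfl⟩
    exact ⟨Or.inl ⟨rfl, h⟩, rfl, rfl⟩

variable [Fintype V] [Fintype W]

open Classical

lemma IsAttachment.sum_eq_one (hatt : IsAttachment F H att) {u : V} {w : W}
    (hw : w ∈ twoVertices H) : ∑ v, (if F.Adj u v ∧ att u v = w then 1 else 0) = 1 := by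
  obtain ⟨v, hv, rfl⟩ := (hatt u).surjOn hw
  rw [Finset.sum_eq_single v]
  · exact if_pos ⟨hv, rfl⟩
  · rintro v' - hne
    exact if_neg fun h => hne ((hatt u).injOn h.1 hv h.2)
  · simp

lemma IsAttachment.sum_eq_zero (hatt : IsAttachment F H att) {u : V} {w : W}
    (hw : w ∉ twoVertices H) : ∑ v, (if F.Adj u v ∧ att u v = w then 1 else 0) = 0 :=
  Finset.sum_eq_zero fun _ _ => if_neg (by rintro ⟨h, rfl⟩; exact hw ((hatt u).mapsTo h))

lemma IsAttachment.sum_mem (hatt : IsAttachment F H att) (u : V) (Y : Set W) :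
    ∑ v, (if F.Adj u v ∧ att u v ∈ Y then 1 else 0) = (Y ∩ twoVertices H).ncard := by
  rw [Set.ncard_eq_toFinset_card', ← Finset.card_filter]
  refine Finset.card_bij (fun v _ => att u v) ?_ ?_ ?_
  · intro v hv
    rw [Finset.mem_filter] at hv
    exact Set.mem_toFinset.2 ⟨hv.2.2, (hatt u).mapsTo hv.2.1⟩
  · intro v hv v' hv' h
    rw [Finset.mem_filter] at hv hv'
    exact (hatt u).injOn hv.2.1 hv'.2.1 h
  · intro w hw
    rw [Set.mem_toFinset] at hw
    obtain ⟨v, hv, rfl⟩ := (hatt u).surjOn hw.2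
    exact ⟨v, Finset.mem_filter.2 ⟨Finset.mem_univ _, hv, hw.1⟩, rfl⟩

/-- The count of degree-two vertices in `hcut` is the number of outer edges leaving `Y`, since each
such vertex carries exactly one of them. -/
theorem CubicConnected.replaceVertices {S : Type*} [AddCommGroup S] (hF : CubicConnected S F)
    (hatt : IsAttachment F H att)
    (hdeg : ∀ w, w ∉ twoVertices H → H.degree w = 3)
    (hcut : ∀ Y : Set W, Y.Nonempty → Yᶜ.Nonempty →
      3 ≤ cutSize H Y + (Y ∩ twoVertices H).ncard)
    (hH : FlowConnected H S) : CubicConnected S (replaceVertices F H att) := by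
  refine (isBlowup_replaceVertices F H att).cubicConnected hF ?_ ?_ ?_
  · rintro ⟨u, w⟩
    have h1 : ∑ q : V × W, (if (GroupConn.replaceVertices F H att).Adj (u, w) q ∧ q.1 = u
        then 1 else 0) = H.degree w := by
      rw [degree_eq_sum, Fintype.sum_prod_type, Finset.sum_eq_single u]
      · simp [GroupConn.replaceVertices]
      · rintro v - hv
        simp [hv]
      · simp
    have h2 : ∑ v, (if F.Adj u v ∧ (u, att u v) = (u, w) then 1 else 0) =
        ∑ v, if F.Adj u v ∧ att u v = w then 1 else 0 := by
      simp
    by_cases hw : w ∈ twoVertices H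
    · have h3 : H.degree w = 2 := hw
      rw [h3] at h1
      rw [hatt.sum_eq_one hw] at h2
      convert congrArg₂ (· + ·) h1 h2
    · rw [hdeg w hw] at h1
      rw [hatt.sum_eq_zero hw] at h2
      convert congrArg₂ (· + ·) h1 h2
  · rintro u X ⟨⟨_, a⟩, ha, rfl⟩ ⟨⟨_, b⟩, hb, rfl⟩
    rename_i u
    refine (hcut ((fun w => (u, w)) ⁻¹' X) ⟨a, ha⟩ ⟨b, hb⟩).trans (Nat.add_le_add ?_ ?_)
    · exact cutSize_preimage_le (Prod.mk_right_injective u) fibreGraph_replaceVertices_adj X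
    · rw [← hatt.sum_mem u]
      rfl
  · intro u δ hδ hsum
    refine exists_isFlow_of_injective (Prod.mk_right_injective u) fibreGraph_replaceVertices_adj hH
      (fun p hp => hδ p ?_) hsum
    rintro rfl
    exact hp ⟨p.2, rfl⟩

/-- Suppose that `γ₀` is not the boundary of a nowhere-zero function of `H`, and that every
nowhere-zero function of `F` with the same boundary as `τ` agrees with `τ` at some vertex. Then
the graph obtained from `F` by replacing its vertices with `H` is not `T`-connected. -/
theorem not_flowConnected_replaceVertices {T : Type*} [AddCommGroup T] {γ₀ : W → T}
    (h₀ : ∑ w, γ₀ w = 0) (hH : ¬ ∃ g, IsFlow H γ₀ g) {τ : V → V → T}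
    (hτ : ∑ u, ∑ v, (if F.Adj u v then τ u v else 0) = 0)
    (hF : ∀ f, IsFlow F (fun u => ∑ v, if F.Adj u v then τ u v else 0) f →
      ∃ u, ∀ v, F.Adj u v → f u v = τ u v) :
    ¬ FlowConnected (replaceVertices F H att) T := by
  intro h
  have hB := isBlowup_replaceVertices F H att
  -- The bad boundary in every copy, shifted so that outer edges with the values `τ` would exactly
  -- pay for the shift.
  set γ : V × W → T := fun p => γ₀ p.2 + ∑ v, if F.Adj p.1 v ∧ att p.1 v = p.2 then τ p.1 v else 0
    with hγ
  have hγu : ∀ u, ∑ w, γ (u, w) = ∑ v, if F.Adj u v then τ u v else 0 := by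
    intro u
    simp only [hγ]
    rw [Finset.sum_add_distrib, h₀, zero_add, Finset.sum_comm]
    refine Finset.sum_congr rfl fun v _ => ?_
    by_cases hv : F.Adj u v <;> simp [hv]
  obtain ⟨f, hf⟩ := h γ (by
    rw [Fintype.sum_prod_type, ← hτ]
    exact Finset.sum_congr rfl fun u _ => hγu u)
  have hc := hB.isFlow_contract hf
  have hfib : ∀ u, ∑ p : V × W, (if p.1 = u then γ p else 0) = ∑ w, γ (u, w) := by
    intro u
    rw [Fintype.sum_prod_type, Finset.sum_eq_single u]
    · simp
    · rintro v - hv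
      simp [hv]
    · simp
  simp only [hfib, hγu] at hc
  -- In the copy at this `u` the outer edges carry the values `τ`, so the inner flow has boundary
  -- `γ₀`.
  obtain ⟨u, hu⟩ := hF _ hc
  refine hH ⟨fun a b => f (u, a) (u, b), fun a b => hf.antisymm _ _, fun a b hab =>
    hf.ne_zero _ _ (Or.inl ⟨rfl, hab⟩), fun a b hab => hf.eq_zero _ _ ?_, fun a => ?_⟩
  · rintro (h | h)
    · exact hab h.2
    · exact F.irrefl h.1
  · have h1 := hf.sum_eq (u, a)
    have h2 : ∀ q : V × W, f (u, a) q = (if q.1 = u then f (u, a) q else 0) +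
        if (replaceVertices F H att).Adj (u, a) q ∧ q.1 ≠ (u, a).1 then f (u, a) q else 0 := by
      intro q
      by_cases hq : q.1 = u
      · simp [hq]
      · by_cases hadj : (replaceVertices F H att).Adj (u, a) q
        · simp [hq, hadj]
        · simp [hadj, hf.eq_zero _ _ hadj]
    have h3 : ∑ q : V × W, (if q.1 = u then f (u, a) q else 0) = ∑ b, f (u, a) (u, b) := by
      rw [Fintype.sum_prod_type, Finset.sum_eq_single u]
      · simp
      · rintro v - hv
        simp [hv]
      · simp
    have h4 := hB.sum_outer (u, a) (f (u, a))
    have h5 : ∑ v, (if F.Adj u v ∧ (u, att u v) = (u, a) then f (u, a) (v, att v u) else 0) =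
        ∑ v, if F.Adj u v ∧ att u v = a then τ u v else 0 := by
      refine Finset.sum_congr rfl fun v _ => ?_
      by_cases hv : F.Adj u v ∧ att u v = a
      · have := hu v hv.1
        rw [hB.contract_apply hf hv.1, hv.2] at this
        simp [hv, this]
      · have : ¬ (F.Adj u v ∧ (u, att u v) = (u, a)) := by simpa using hv
        rw [if_neg hv, if_neg this]
    have h6 : ∑ q, f (u, a) q = ∑ b, f (u, a) (u, b) +
        ∑ v, if F.Adj u v ∧ att u v = a then τ u v else 0 := by
      rw [← h3, ← h5, Finset.sum_congr rfl fun q _ => h2 q, Finset.sum_add_distrib]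
      convert congrArg _ h4
    rw [h6] at h1
    exact add_right_cancel h1

end Replace

/-! ### The base graphs: cuts from edge lists, K₄ and the prism -/

section Arcs

variable {V : Type*} [Fintype V] {G : SimpleGraph V}

open Classical in
/-- Every arc in a list of pairwise different edges which leads into or out of `Y` contributes to
the size of the cut. -/
lemma countP_le_cutSize {L : List (V × V)} (hL : L.Nodup)
    (hadj : ∀ e ∈ L, G.Adj e.1 e.2 ∧ (e.2, e.1) ∉ L) (Y : Set V) :
    L.countP (fun e => decide (e.1 ∈ Y) != decide (e.2 ∈ Y)) ≤ cutSize G Y := by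
  rw [cutSize_eq_card, List.countP_eq_length_filter,
    ← List.toFinset_card_of_nodup (hL.filter _)]
  refine Finset.card_le_card_of_injOn (fun e => if e.1 ∈ Y then e else (e.2, e.1)) ?_ ?_
  · rintro ⟨a, b⟩ h
    simp only [Finset.mem_coe, List.mem_toFinset, List.mem_filter, bne_iff_ne, ne_eq,
      decide_eq_decide] at h
    have h1 := (hadj _ h.1).1
    by_cases ha : a ∈ Y
    · have hb : b ∉ Y := fun hb => h.2 (iff_of_true ha hb)
      simp [ha, hb, h1]
    · have hb : b ∈ Y := by_contra fun hb => h.2 (iff_of_false ha hb)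
      simp [ha, hb, h1.symm]
  · rintro ⟨a, b⟩ h ⟨a', b'⟩ h' he
    simp only [Finset.mem_coe, List.mem_toFinset, List.mem_filter] at h h'
    by_cases ha : a ∈ Y <;> by_cases ha' : a' ∈ Y <;> simp [ha, ha'] at he
    · exact Prod.ext he.1 he.2
    · exact absurd h.1 (he.1 ▸ he.2 ▸ (hadj _ h'.1).2)
    · exact absurd h'.1 (he.1 ▸ he.2 ▸ (hadj _ h.1).2)
    · exact Prod.ext he.2 he.1

end Arcs

section CompleteGraph

open Classical in
lemma sum_adj_completeGraph (u : Fin 4) : ∑ v, (if K₄.Adj u v then 1 else 0) = 3 := by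
  have : ∀ u : Fin 4, ∑ v, (if u ≠ v then 1 else 0) = 3 := by decide
  simpa [K₄] using this u

lemma isEdgeConnected_completeGraph : K₄.IsEdgeConnected 3 := by
  rw [isEdgeConnected_iff]
  intro X h1 h2
  have h := Set.ncard_add_ncard_compl X
  rw [Nat.card_eq_fintype_card, Fintype.card_fin] at h
  have h1 := (Set.ncard_pos).2 h1
  have h2 := (Set.ncard_pos).2 h2
  rw [K₄, cutSize_top]
  obtain h3 | h3 | h3 : X.ncard = 1 ∨ X.ncard = 2 ∨ X.ncard = 3 := by omega
  all_goals rw [h3] at h ⊢; omega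

/-- The values `x`, `y`, `z` on the triangle `0 1 2` are free; those on the edges to `3` are then
forced, and the boundary at `3` is right because the total is zero. The check `key` says that all
six can be made nonzero. -/
lemma flowConnected_completeGraph : FlowConnected K₄ (ZMod 2 × ZMod 2) := by
  have key : ∀ a b c : ZMod 2 × ZMod 2, ∃ x y z : ZMod 2 × ZMod 2, x ≠ 0 ∧ y ≠ 0 ∧ z ≠ 0 ∧
      a - x - y ≠ 0 ∧ b + x - z ≠ 0 ∧ c + y + z ≠ 0 := by
    decide +kernel
  intro γ hγ
  obtain ⟨x, y, z, hx, hy, hz, h1, h2, h3⟩ := key (γ 0) (γ 1) (γ 2)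
  rw [Fin.sum_univ_four] at hγ
  have h4 : γ 3 = -(γ 0 + γ 1 + γ 2) := by linear_combination hγ
  refine ⟨![![0, x, y, γ 0 - x - y], ![-x, 0, z, γ 1 + x - z], ![-y, -z, 0, γ 2 + y + z],
    ![-(γ 0 - x - y), -(γ 1 + x - z), -(γ 2 + y + z), 0]], ⟨?_, ?_, ?_, ?_⟩⟩
  · intro u v
    fin_cases u <;> fin_cases v <;> simp
  · intro u v
    fin_cases u <;> fin_cases v <;> simp [K₄, hx, hy, hz, h1, h2, h3, -neg_sub, -neg_add_rev,
      neg_eq_zero]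
  · intro u v
    fin_cases u <;> fin_cases v <;> simp [K₄]
  · intro u
    fin_cases u <;> simp [Fin.sum_univ_four, h4] <;> ring

theorem cubicConnected_completeGraph : CubicConnected (ZMod 2 × ZMod 2) K₄ :=
  ⟨sum_adj_completeGraph, isEdgeConnected_completeGraph, flowConnected_completeGraph⟩


/-- Here `a`, `b`, `d` are the values on `0 1`, `0 2`, `1 2`, and the four cases are the four
vertices. Three nonzero elements with sum `3` are `1 1 1`, `1 3 3` or `2 2 3`, so the edges of value
`2` form cycles. Without such edges, direct every edge so that it has value `1`: all out-degrees are
`1` or `3` with total six, so one is `3`. If they form a triangle, its vertices send `3` to the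
fourth, which therefore sends out `1` three times. A 4-cycle is impossible, as a diagonal would have
value `3` in both directions. -/
lemma eq_one_of_zmod_four_sums : ∀ a b d : ZMod 4, a ≠ 0 → b ≠ 0 → d ≠ 0 → 3 - a - b ≠ 0 →
    3 + a - d ≠ 0 → 3 + b + d ≠ 0 →
    (a = 1 ∧ b = 1 ∧ 3 - a - b = 1) ∨ (-a = 1 ∧ d = 1 ∧ 3 + a - d = 1) ∨
      (-b = 1 ∧ -d = 1 ∧ 3 + b + d = 1) ∨
        (-(3 - a - b) = 1 ∧ -(3 + a - d) = 1 ∧ -(3 + b + d) = 1) := by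
  decide +kernel

open Classical in
lemma exists_forall_eq_one_of_isFlow_completeGraph {f : Fin 4 → Fin 4 → ZMod 4}
    (hf : IsFlow K₄ (fun u => ∑ v, if K₄.Adj u v then 1 else 0) f) :
    ∃ u, ∀ v, K₄.Adj u v → f u v = 1 := by
  have hadj : ∀ u v, u ≠ v → f u v ≠ 0 := fun u v h => hf.ne_zero u v (by simpa [K₄] using h)
  have hself : ∀ u, f u u = 0 := fun u => hf.eq_zero u u K₄.irrefl
  have hsum : ∀ u, f u 0 + f u 1 + f u 2 + f u 3 = 3 := by
    intro u
    rw [← Fin.sum_univ_four, hf.sum_eq]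
    have := congrArg (Nat.cast (R := ZMod 4)) (sum_adj_completeGraph u)
    push_cast at this
    exact this
  have h0 := hsum 0
  have h1 := hsum 1
  have h2 := hsum 2
  rw [hself] at h0 h1 h2
  rw [hf.antisymm 0 1] at h1
  rw [hf.antisymm 0 2, hf.antisymm 1 2] at h2
  have h3 : 3 - f 0 1 - f 0 2 = f 0 3 := by linear_combination -h0
  have h4 : 3 + f 0 1 - f 1 2 = f 1 3 := by linear_combination -h1
  have h5 : 3 + f 0 2 + f 1 2 = f 2 3 := by linear_combination -h2
  have := eq_one_of_zmod_four_sums (f 0 1) (f 0 2) (f 1 2) (hadj _ _ (by decide))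
    (hadj _ _ (by decide)) (hadj _ _ (by decide)) (h3 ▸ hadj _ _ (by decide))
    (h4 ▸ hadj _ _ (by decide)) (h5 ▸ hadj _ _ (by decide))
  rw [h3, h4, h5] at this
  simp only [← hf.antisymm] at this
  simp only [Fin.exists_fin_succ, Fin.forall_fin_succ]
  simpa [K₄] using this

end CompleteGraph

section Prism

lemma prism_adj (u v : Fin 3 × Fin 2) :
    prism.Adj u v ↔ (u.1 ≠ v.1 ∧ u.2 = v.2) ∨ (u.2 ≠ v.2 ∧ u.1 = v.1) := by
  simp [prism, SimpleGraph.boxProd_adj]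

open Classical in
lemma sum_adj_prism (u : Fin 3 × Fin 2) : ∑ v, (if prism.Adj u v then 1 else 0) = 3 := by
  have : ∀ u : Fin 3 × Fin 2, ∑ v : Fin 3 × Fin 2,
      (if (u.1 ≠ v.1 ∧ u.2 = v.2) ∨ (u.2 ≠ v.2 ∧ u.1 = v.1) then 1 else 0) = 3 := by decide
  simp only [prism_adj]
  convert this u

lemma three_le_countP_prism : ∀ a b c d e g : Bool, (a || b || c || d || e || g) = true →
    (a && b && c && d && e && g) = false →
    3 ≤ List.countP id [a != b, b != c, c != a, d != e, e != g, g != d, a != d, b != e,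
      c != g] := by
  decide +kernel

/-- The edges of the prism. -/
def prismArcs : List ((Fin 3 × Fin 2) × (Fin 3 × Fin 2)) :=
  [((0, 0), (1, 0)), ((1, 0), (2, 0)), ((2, 0), (0, 0)), ((0, 1), (1, 1)), ((1, 1), (2, 1)),
    ((2, 1), (0, 1)), ((0, 0), (0, 1)), ((1, 0), (1, 1)), ((2, 0), (2, 1))]

lemma isEdgeConnected_prism : prism.IsEdgeConnected 3 := by
  classical
  rw [isEdgeConnected_iff]
  rintro X ⟨x, hx⟩ ⟨y, hy⟩
  have hadj : ∀ e ∈ prismArcs, ((e.1.1 ≠ e.2.1 ∧ e.1.2 = e.2.2) ∨ (e.1.2 ≠ e.2.2 ∧ e.1.1 = e.2.1)) ∧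
      (e.2, e.1) ∉ prismArcs := by decide +kernel
  have hle := countP_le_cutSize (G := prism) (L := prismArcs) (by decide +kernel)
    (by simpa only [prism_adj] using hadj) X
  refine le_trans ?_ hle
  have hx' : ∃ i j, decide ((i, j) ∈ X) = true := ⟨x.1, x.2, decide_eq_true hx⟩
  have hy' : ∃ i j, decide ((i, j) ∈ X) = false := ⟨y.1, y.2, decide_eq_false hy⟩
  simp only [Fin.exists_fin_succ, IsEmpty.exists_iff, Fin.succ_zero_eq_one, or_false,
    Fin.succ_one_eq_two] at hx' hy'
  simp only [prismArcs, List.countP_cons, List.countP_nil]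
  generalize decide ((0, 0) ∈ X) = a at *
  generalize decide ((1, 0) ∈ X) = b at *
  generalize decide ((2, 0) ∈ X) = c at *
  generalize decide ((0, 1) ∈ X) = d at *
  generalize decide ((1, 1) ∈ X) = e at *
  generalize decide ((2, 1) ∈ X) = g at *
  have key := three_le_countP_prism a b c d e g
  simp only [List.countP_cons, List.countP_nil, id] at key
  refine key ?_ ?_
  · revert hx'; clear key hle hy'; revert a b c d e g; decide +kernel
  · revert hy'; clear key hle hx'; revert a b c d e g; decide +kernel

/-- Every element of `ℤ₄` is a sum of three nonzero ones. The three edges between the triangles can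
thus carry the total demand of the first triangle, which leaves a zero-sum boundary on each
triangle. -/
lemma flowConnected_prism : FlowConnected prism (ZMod 4) := by
  have key : ∀ a : ZMod 4, ∃ x y z : ZMod 4, x ≠ 0 ∧ y ≠ 0 ∧ z ≠ 0 ∧ x + y + z = a := by
    decide +kernel
  intro γ hγ
  obtain ⟨s, hs, hsum⟩ : ∃ s : Fin 3 → ZMod 4, (∀ i, s i ≠ 0) ∧ ∑ i, s i = ∑ i, γ (i, 0) := by
    obtain ⟨x, y, z, hx, hy, hz, h⟩ := key (∑ i, γ (i, 0))
    exact ⟨![x, y, z], by simp [Fin.forall_fin_succ, hx, hy, hz],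
      by rw [← h, Fin.sum_univ_three]; rfl⟩
  obtain ⟨h₀, hh₀⟩ := flowConnected_triangle_zmod_four (fun i => γ (i, 0) - s i) (by
    rw [Finset.sum_sub_distrib, hsum, sub_self])
  obtain ⟨h₁, hh₁⟩ := flowConnected_triangle_zmod_four (fun i => γ (i, 1) + s i) (by
    rw [Finset.sum_add_distrib, hsum, add_comm, ← hγ, Fintype.sum_prod_type,
      ← Finset.sum_add_distrib]
    simp [Fin.sum_univ_two])
  set k : Fin 2 → Fin 3 → Fin 3 → ZMod 4 := ![h₀, h₁] with hk
  set t : Fin 2 → Fin 3 → ZMod 4 := ![s, fun i => - s i] with ht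
  refine ⟨fun u v => if u.2 = v.2 then k u.2 u.1 v.1 else if u.1 = v.1 then t u.2 u.1 else 0,
    ⟨?_, ?_, ?_, ?_⟩⟩
  · rintro ⟨i, a⟩ ⟨j, b⟩
    have h1 : ∀ a, k a j i = - k a i j := by
      simp [Fin.forall_fin_two, hk, hh₀.antisymm i j, hh₁.antisymm i j]
    have h2 : ∀ a b, a ≠ b → t b i = - t a i := by
      simp [Fin.forall_fin_two, ht]
    by_cases hab : a = b
    · subst hab
      simp [h1]
    · by_cases hij : i = j
      · subst hij
        simp [hab, Ne.symm hab, h2 a b hab]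
      · simp [hab, Ne.symm hab, hij, Ne.symm hij]
  · rintro ⟨i, a⟩ ⟨j, b⟩ h
    rw [prism_adj] at h
    have h0 := hh₀.ne_zero i j
    have h1 := hh₁.ne_zero i j
    fin_cases a <;> fin_cases b <;> simp_all
  · rintro ⟨i, a⟩ ⟨j, b⟩ h
    rw [prism_adj] at h
    have h0 := hh₀.eq_zero i j
    have h1 := hh₁.eq_zero i j
    fin_cases a <;> fin_cases b <;> simp_all
  · rintro ⟨i, a⟩
    have h0 := hh₀.sum_eq i
    have h1 := hh₁.sum_eq i
    rw [Fintype.sum_prod_type]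
    fin_cases a
    · simp [hk, ht, Finset.sum_add_distrib, h0]
    · simp [hk, ht, Finset.sum_add_distrib, h1]

theorem cubicConnected_prism : CubicConnected (ZMod 4) prism :=
  ⟨sum_adj_prism, isEdgeConnected_prism, flowConnected_prism⟩

end Prism

/-! ### Klein flows and 3-edge-colourings of the prism -/

/-- The nonzero elements of `ℤ₂ × ℤ₂`, as three colours. -/
def kleinColour : Fin 3 → ZMod 2 × ZMod 2 := ![(1, 0), (0, 1), (1, 1)]

set_option synthInstance.maxHeartbeats 400000 in
set_option synthInstance.maxSize 100000 in
-- The indices `1`, `2`, `0` are the sums `i + j` of the ends of the triangle edges `0 1`, `0 2`, `1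
-- 2`, as in `prismColour`.
lemma exists_perm_kleinColour : ∀ a b : ZMod 2 × ZMod 2, a ≠ 0 → b ≠ 0 → a + b ≠ 0 →
    ∃ p : Equiv.Perm (Fin 3), a = kleinColour (p 1) ∧ b = kleinColour (p 2) ∧
      a + b = kleinColour (p 0) := by
  decide +kernel

set_option synthInstance.maxHeartbeats 400000 in
set_option synthInstance.maxSize 100000 in
-- In the Klein group, a nonzero sum means that the summands differ; three different nonzero
-- elements are all of them, and each is the sum of the other two.
lemma klein_triangle : ∀ a b c : ZMod 2 × ZMod 2, a ≠ 0 → b ≠ 0 → c ≠ 0 → a + b ≠ 0 →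
    a + c ≠ 0 → b + c ≠ 0 → a + b = c ∧ a + c = b ∧ b + c = a := by
  decide

lemma fin_three_univ : ∀ i j k : Fin 3, i ≠ j → i ≠ k → j ≠ k →
    (Finset.univ : Finset (Fin 3)) = {i, j, k} := by
  decide

lemma neg_eq_self_klein : ∀ a : ZMod 2 × ZMod 2, -a = a := by
  decide

/-- Signs play no role in the Klein group. At a vertex of a triangle, the edge to the other triangle
is the sum of two triangle edges, hence has the value of the opposite triangle edge. So both
triangles have the same values, and a flow is the standard colouring up to a permutation. -/
theorem exists_perm_of_isFlow_prism {f : Fin 3 × Fin 2 → Fin 3 × Fin 2 → ZMod 2 × ZMod 2}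
    (hf : IsFlow prism (fun _ => 0) f) :
    ∃ p : Equiv.Perm (Fin 3), ∀ u v, prism.Adj u v → f u v = kleinColour (p (u.1 + v.1)) := by
  have hsymm : ∀ u v, f v u = f u v := fun u v => by rw [hf.antisymm, neg_eq_self_klein]
  have hne : ∀ u v, ((u.1 ≠ v.1 ∧ u.2 = v.2) ∨ (u.2 ≠ v.2 ∧ u.1 = v.1)) → f u v ≠ 0 :=
    fun u v h => hf.ne_zero u v ((prism_adj u v).2 h)
  have hzero : ∀ u v, ¬ ((u.1 ≠ v.1 ∧ u.2 = v.2) ∨ (u.2 ≠ v.2 ∧ u.1 = v.1)) → f u v = 0 :=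
    fun u v h => hf.eq_zero u v fun h' => h ((prism_adj u v).1 h')
  have hsum : ∀ a : Fin 2, ∀ i j k : Fin 3, i ≠ j → i ≠ k → j ≠ k →
      f (i, a) (j, a) + f (i, a) (k, a) = f (i, 0) (i, 1) := by
    intro a i j k hij hik hjk
    have h := hf.sum_eq (i, a)
    have hs : ∀ b : Fin 2, ∑ l, f (i, a) (l, b) =
        f (i, a) (i, b) + f (i, a) (j, b) + f (i, a) (k, b) := by
      intro b
      rw [fin_three_univ i j k hij hik hjk, Finset.sum_insert (by simp [hij, hik]),
        Finset.sum_pair hjk, add_assoc]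
    rw [Fintype.sum_prod_type_right, Fin.sum_univ_two, hs, hs] at h
    rw [← sub_eq_zero, sub_eq_add_neg, neg_eq_self_klein, ← h]
    fin_cases a
    · simp only [Fin.zero_eta, Fin.isValue]
      rw [hzero (i, 0) (i, 0) (by simp), hzero (i, 0) (j, 1) (by simp [hij]),
        hzero (i, 0) (k, 1) (by simp [hik])]
      abel
    · simp only [Fin.mk_one, Fin.isValue]
      rw [hzero (i, 1) (i, 1) (by simp), hzero (i, 1) (j, 0) (by simp [hij]),
        hzero (i, 1) (k, 0) (by simp [hik]), hsymm (i, 0) (i, 1)]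
      abel
  have htri : ∀ a : Fin 2, _ := fun a => klein_triangle (f (0, a) (1, a)) (f (0, a) (2, a))
    (f (1, a) (2, a)) (hne _ _ (by simp)) (hne _ _ (by simp)) (hne _ _ (by simp))
    (by rw [hsum a 0 1 2 (by decide) (by decide) (by decide)]; exact hne _ _ (by simp))
    (by rw [hsymm (1, a) (0, a), hsum a 1 0 2 (by decide) (by decide) (by decide)]
        exact hne _ _ (by simp))
    (by rw [hsymm (2, a) (0, a), hsymm (2, a) (1, a),
          hsum a 2 0 1 (by decide) (by decide) (by decide)]
        exact hne _ _ (by simp))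
  have h0 : ∀ a, f (1, a) (2, a) = f (0, 0) (0, 1) := fun a => by
    rw [← hsum a 0 1 2 (by decide) (by decide) (by decide), (htri a).1]
  have h1 : ∀ a, f (0, a) (2, a) = f (1, 0) (1, 1) := fun a => by
    rw [← hsum a 1 0 2 (by decide) (by decide) (by decide), hsymm (0, a) (1, a), (htri a).2.1]
  have h2 : ∀ a, f (0, a) (1, a) = f (2, 0) (2, 1) := fun a => by
    rw [← hsum a 2 0 1 (by decide) (by decide) (by decide), hsymm (0, a) (2, a),
      hsymm (1, a) (2, a), (htri a).2.2]
  obtain ⟨p, hp1, hp2, hp0⟩ := exists_perm_kleinColour (f (0, 0) (1, 0)) (f (0, 0) (2, 0))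
    (hne _ _ (by simp)) (hne _ _ (by simp)) (by rw [(htri 0).1]; exact hne _ _ (by simp))
  rw [(htri 0).1] at hp0
  rw [h2] at hp1
  rw [h1] at hp2
  rw [h0] at hp0
  refine ⟨p, ?_⟩
  rintro ⟨i, a⟩ ⟨j, b⟩ h
  rw [prism_adj] at h
  by_cases hab : a = b
  · subst hab
    fin_cases i <;> fin_cases j
    · simp at h
    · exact (h2 a).trans hp1
    · exact (h1 a).trans hp2
    · exact (hsymm _ _).trans ((h2 a).trans hp1)
    · simp at h
    · exact (h0 a).trans hp0
    · exact (hsymm _ _).trans ((h1 a).trans hp2)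
    · exact (hsymm _ _).trans ((h0 a).trans hp0)
    · simp at h
  · obtain rfl : i = j := by simpa [hab] using h
    have h3 : f (i, 0) (i, 1) = kleinColour (p (i + i)) := by
      fin_cases i
      · exact hp0
      · exact hp2
      · exact hp1
    fin_cases a <;> fin_cases b
    · simp at hab
    · exact h3
    · exact (hsymm _ _).trans h3
    · simp at hab

/-- The colour of the edge joining `u` and `v` in the prism. -/
def prismColour : Sym2 (Fin 3 × Fin 2) → Fin 3 :=
  Sym2.lift ⟨fun u v => u.1 + v.1, fun _ _ => add_comm _ _⟩

lemma eq_of_prism_adj : ∀ u v w : Fin 3 × Fin 2,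
    ((u.1 ≠ v.1 ∧ u.2 = v.2) ∨ (u.2 ≠ v.2 ∧ u.1 = v.1)) →
    ((u.1 ≠ w.1 ∧ u.2 = w.2) ∨ (u.2 ≠ w.2 ∧ u.1 = w.1)) → u.1 + v.1 = u.1 + w.1 → v = w := by
  decide +kernel

lemma exists_prism_adj : ∀ (u : Fin 3 × Fin 2) (k : Fin 3), ∃ v : Fin 3 × Fin 2,
    ((u.1 ≠ v.1 ∧ u.2 = v.2) ∨ (u.2 ≠ v.2 ∧ u.1 = v.1)) ∧ u.1 + v.1 = k := by
  decide +kernel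

lemma exists_prism_coloring :
    ∃ c : prism.lineGraph.Coloring (Fin 3), ∀ e, c e = prismColour e := by
  refine ⟨SimpleGraph.Coloring.mk (fun e => prismColour e) ?_, fun _ => rfl⟩
  rintro ⟨e, he⟩ ⟨e', he'⟩ ⟨hne, u, hu, hu'⟩ heq
  obtain ⟨v, rfl⟩ := hu
  obtain ⟨w, rfl⟩ := hu'
  refine hne (Subtype.ext ?_)
  simp only [eq_of_prism_adj u v w ((prism_adj u v).1 he) ((prism_adj u w).1 he') heq]

lemma exists_perm_of_distinct : ∀ a b c : Fin 3, a ≠ b → a ≠ c → b ≠ c →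
    ∃ p : Equiv.Perm (Fin 3), a = p 1 ∧ b = p 2 ∧ c = p 0 := by
  decide +kernel

lemma fin_three_eq_of_ne : ∀ a b c d : Fin 3, a ≠ b → a ≠ c → b ≠ c → a ≠ d → b ≠ d → c = d := by
  decide

/-- A triangle uses all three colours, so the edge from its vertex `i` to the other triangle has the
colour of the opposite edge `j k`, in both triangles alike. Modulo three, `j + k = i + i`, which is
why `u.1 + v.1` describes the colouring. -/
theorem exists_perm_prism_coloring (c : prism.lineGraph.Coloring (Fin 3)) :
    ∃ p : Equiv.Perm (Fin 3), ∀ e, c e = p (prismColour e) := by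
  classical
  set g : Fin 3 × Fin 2 → Fin 3 × Fin 2 → Fin 3 := fun u v =>
    if h : prism.Adj u v then c ⟨s(u, v), h⟩ else 0 with hg
  have hgc : ∀ u v (h : prism.Adj u v), c ⟨s(u, v), h⟩ = g u v := fun u v h => by
    simp [hg, h]
  have hsymm : ∀ u v, g v u = g u v := by
    intro u v
    by_cases h : prism.Adj u v
    · rw [← hgc u v h, ← hgc v u h.symm]
      congr 1
      exact Subtype.ext Sym2.eq_swap
    · simp [hg, h, prism.adj_comm v u]
  have hne : ∀ u v w, prism.Adj u v → prism.Adj u w → v ≠ w → g u v ≠ g u w := by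
    intro u v w hv hw hvw
    rw [← hgc u v hv, ← hgc u w hw]
    refine c.valid ⟨fun h => hvw ?_, u, Sym2.mem_mk_left u v, Sym2.mem_mk_left u w⟩
    exact Sym2.congr_right.1 (congrArg Subtype.val h)
  simp only [prism_adj] at hne
  have hd1 : ∀ a : Fin 2, g (0, a) (1, a) ≠ g (0, a) (2, a) := fun a =>
    hne _ _ _ (by simp) (by simp) (by simp)
  have hd2 : ∀ a : Fin 2, g (0, a) (1, a) ≠ g (1, a) (2, a) := fun a =>
    hsymm (1, a) (0, a) ▸ hne _ _ _ (by simp) (by simp) (by simp)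
  have hd3 : ∀ a : Fin 2, g (0, a) (2, a) ≠ g (1, a) (2, a) := fun a =>
    hsymm (2, a) (0, a) ▸ hsymm (2, a) (1, a) ▸ hne _ _ _ (by simp) (by simp) (by simp)
  have hs : ∀ (i j : Fin 3) (a : Fin 2), i ≠ j → g (i, a) (j, a) ≠ g (i, 0) (i, 1) := by
    intro i j a hij
    fin_cases a
    · exact hne _ _ _ (by simp [hij]) (by simp) (by simp)
    · rw [hsymm (i, 1) (i, 0)]
      exact hne _ _ _ (by simp [hij]) (by simp) (by simp)
  have h0 : ∀ a, g (1, a) (2, a) = g (0, 0) (0, 1) := fun a =>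
    fin_three_eq_of_ne _ _ _ _ (hd1 a) (hd2 a) (hd3 a) (hs 0 1 a (by decide))
      (hs 0 2 a (by decide))
  have h1 : ∀ a, g (0, a) (2, a) = g (1, 0) (1, 1) := fun a =>
    fin_three_eq_of_ne _ _ _ _ (hd2 a) (hd1 a) (hd3 a).symm
      (hsymm (1, a) (0, a) ▸ hs 1 0 a (by decide)) (hs 1 2 a (by decide))
  have h2 : ∀ a, g (0, a) (1, a) = g (2, 0) (2, 1) := fun a =>
    fin_three_eq_of_ne _ _ _ _ (hd3 a) (hd1 a).symm (hd2 a).symm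
      (hsymm (2, a) (0, a) ▸ hs 2 0 a (by decide)) (hsymm (2, a) (1, a) ▸ hs 2 1 a (by decide))
  obtain ⟨p, hp1, hp2, hp0⟩ := exists_perm_of_distinct _ _ _ (hd1 0) (hd2 0) (hd3 0)
  rw [h2] at hp1
  rw [h1] at hp2
  rw [h0] at hp0
  refine ⟨p, ?_⟩
  rintro ⟨e, h⟩
  induction e using Sym2.ind with
  | _ u v =>
  obtain ⟨i, a⟩ := u
  obtain ⟨j, b⟩ := v
  rw [hgc _ _ h]
  change g (i, a) (j, b) = p (i + j)
  rw [SimpleGraph.mem_edgeSet, prism_adj] at h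
  by_cases hab : a = b
  · subst hab
    fin_cases i <;> fin_cases j
    · simp at h
    · exact (h2 a).trans hp1
    · exact (h1 a).trans hp2
    · exact (hsymm _ _).trans ((h2 a).trans hp1)
    · simp at h
    · exact (h0 a).trans hp0
    · exact (hsymm _ _).trans ((h1 a).trans hp2)
    · exact (hsymm _ _).trans ((h0 a).trans hp0)
    · simp at h
  · obtain rfl : i = j := by simpa [hab] using h
    have h3 : g (i, 0) (i, 1) = p (i + i) := by
      fin_cases i
      · exact hp0
      · exact hp2
      · exact hp1
    fin_cases a <;> fin_cases b
    · simp at hab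
    · exact h3
    · exact (hsymm _ _).trans h3
    · simp at hab

theorem prism_coloring_unique (c c' : prism.lineGraph.Coloring (Fin 3)) :
    ∃ p : Equiv.Perm (Fin 3), ∀ e, c' e = p (c e) := by
  obtain ⟨p, hp⟩ := exists_perm_prism_coloring c
  obtain ⟨p', hp'⟩ := exists_perm_prism_coloring c'
  exact ⟨p.symm.trans p', fun e => by simp [hp, hp']⟩

/-- The map `att u` is a composite of bijections: neighbour to colour of the edge, colour to
position under `σ u`, position to vertex of degree two. -/
theorem IsPermutationAttachment.isAttachment {W : Type*} [Fintype W] {H : SimpleGraph W}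
    {att : Fin 3 × Fin 2 → Fin 3 × Fin 2 → W} (h : IsPermutationAttachment prism H att) :
    IsAttachment prism H att := by
  obtain ⟨c, t, σ, ht, hatt⟩ := h
  obtain ⟨p, hp⟩ := exists_perm_prism_coloring c
  have key : ∀ u v, prism.Adj u v → att u v = t ((σ u).symm (p (u.1 + v.1))) := by
    intro u v huv
    refine hatt u v huv _ ?_
    rw [hp, Equiv.apply_symm_apply]
    rfl
  refine fun u => ⟨fun v hv => ?_, fun v hv w hw hvw => ?_, fun w hw => ?_⟩
  · rw [key u v hv]
    exact ht.mapsTo (Set.mem_univ _)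
  · rw [key u v hv, key u w hw] at hvw
    have := ht.injOn (Set.mem_univ _) (Set.mem_univ _) hvw
    exact eq_of_prism_adj u v w ((prism_adj u v).1 hv) ((prism_adj u w).1 hw)
      (p.injective ((σ u).symm.injective this))
  · obtain ⟨j, -, rfl⟩ := ht.surjOn hw
    obtain ⟨v, hv, hk⟩ := exists_prism_adj u (p.symm (σ u j))
    refine ⟨v, (prism_adj u v).2 hv, ?_⟩
    rw [key u v ((prism_adj u v).2 hv), hk]
    simp

theorem exists_isPermutationAttachment_prism {W : Type*} [Fintype W] {H : SimpleGraph W}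
    {t : Fin 3 → W} (ht : Set.BijOn t Set.univ (twoVertices H)) :
    ∃ att, IsPermutationAttachment prism H att := by
  obtain ⟨c, hc⟩ := exists_prism_coloring
  -- The prism has as many vertices as there are permutations of three colours, namely six.
  have hcard : Fintype.card (Fin 3 × Fin 2) = Fintype.card (Equiv.Perm (Fin 3)) := by
    rw [Fintype.card_perm]; rfl
  refine ⟨fun u v => t (((Fintype.equivOfCardEq hcard) u).symm (prismColour s(u, v))), c, t,
    Fintype.equivOfCardEq hcard, ht, ?_⟩
  intro u v h j hj
  rw [hc] at hj
  simp [hj]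

/-! ### Sets of register contents as 256-bit masks -/

/-- An encoding of a group of order four by the digits `0`, `1`, `2`, `3`. -/
structure DigitCode (S : Type*) [AddCommGroup S] where
  val : ℕ → S
  add : ℕ → ℕ → ℕ
  neg : ℕ → ℕ
  add_lt : ∀ a < 4, ∀ b < 4, add a b < 4
  neg_lt : ∀ a < 4, neg a < 4
  val_add : ∀ a < 4, ∀ b < 4, val (add a b) = val a + val b
  val_neg : ∀ a < 4, val (neg a) = - val a
  val_eq_zero : ∀ a < 4, val a = 0 → a = 0
  val_inj : ∀ a < 4, ∀ b < 4, val a = val b → a = b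
  surj : ∀ s, ∃ a < 4, val a = s

def zmodFourCode : DigitCode (ZMod 4) where
  val a := (a : ZMod 4)
  add a b := (a + b) % 4
  neg a := (4 - a) % 4
  add_lt := by decide
  neg_lt := by decide
  val_add := by decide
  val_neg := by decide
  val_eq_zero := by decide
  val_inj := by decide
  surj := by decide

def kleinCode : DigitCode (ZMod 2 × ZMod 2) where
  val a := ((a : ZMod 2), ((a / 2 : ℕ) : ZMod 2))
  add a b := a ^^^ b
  neg a := a
  add_lt := by decide
  neg_lt := by decide
  val_add := by decide
  val_neg := by decide
  val_eq_zero := by decide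
  val_inj := by decide
  surj := by decide

/-- The digit of `p` in base four at position `i`. -/
def digit (p : ℕ) (i : Fin 4) : ℕ := p / 4 ^ (i : ℕ) % 4

/-- Replace the digit of `p` at position `i` by `d`. -/
def setDigit (p : ℕ) (i : Fin 4) (d : ℕ) : ℕ := p - digit p i * 4 ^ (i : ℕ) + d * 4 ^ (i : ℕ)

lemma digit_lt (p : ℕ) (i : Fin 4) : digit p i < 4 := Nat.mod_lt _ (by norm_num)

lemma digit_mul_le (p : ℕ) (i : Fin 4) : digit p i * 4 ^ (i : ℕ) ≤ p :=
  (Nat.mul_le_mul_right _ (Nat.mod_le _ _)).trans (Nat.div_mul_le_self _ _)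

lemma digit_setDigit {p d : ℕ} (hp : p < 256) (hd : d < 4) (i j : Fin 4) :
    digit (setDigit p i d) j = if j = i then d else digit p j := by
  have h : ∀ p < 256, ∀ d < 4, ∀ i j : Fin 4,
      digit (setDigit p i d) j = if j = i then d else digit p j := by decide +kernel
  exact h p hp d hd i j

lemma setDigit_lt {p d : ℕ} (hp : p < 256) (hd : d < 4) (i : Fin 4) : setDigit p i d < 256 := by
  have h : ∀ p < 256, ∀ d < 4, ∀ i : Fin 4, setDigit p i d < 256 := by decide +kernel
  exact h p hp d hd i

/-- The bit mask of all `p < 256` whose digit at position `i` is `0`. -/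
def zeroDigitMask (i : Fin 4) : ℕ :=
  match i with
  | 0 => 0x1111111111111111111111111111111111111111111111111111111111111111
  | 1 => 0x000f000f000f000f000f000f000f000f000f000f000f000f000f000f000f000f
  | 2 => 0x000000000000ffff000000000000ffff000000000000ffff000000000000ffff
  | 3 => 0x000000000000000000000000000000000000000000000000ffffffffffffffff

/-- The bit mask of all `p < 256` whose digit at position `i` is `d`. -/
def digitMask (i : Fin 4) (d : ℕ) : ℕ := zeroDigitMask i <<< (d * 4 ^ (i : ℕ))

lemma digitMask_spec {i : Fin 4} {d : ℕ} (hd : d < 4) {p : ℕ}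
    (h : (digitMask i d).testBit p = true) : p < 256 ∧ digit p i = d := by
  have h1 : ∀ i : Fin 4, ∀ d < 4, digitMask i d < 2 ^ 256 := by decide +kernel
  have h2 : ∀ i : Fin 4, ∀ d < 4, ∀ p < 256, (digitMask i d).testBit p = true → digit p i = d := by
    decide +kernel
  have hp : p < 256 := by
    by_contra hp
    have := Nat.testBit_lt_two_pow
      ((h1 i d hd).trans_le (Nat.pow_le_pow_right (by norm_num) (not_lt.1 hp)))
    simp [this] at h
  exact ⟨hp, h2 i d hd p hp h⟩

/-- Move the bits of `m` in such a way that a digit `d` at position `i` becomes `d'`. -/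
def moveDigit (m : ℕ) (i : Fin 4) (d d' : ℕ) : ℕ :=
  bif d.ble d' then m <<< ((d' - d) * 4 ^ (i : ℕ)) else m >>> ((d - d') * 4 ^ (i : ℕ))

/-- Only this direction is needed: a mask may lose elements, but whatever it contains must really be
attainable. -/
lemma testBit_moveDigit {m d d' q : ℕ} {i : Fin 4}
    (h : (moveDigit m i d d').testBit q = true) :
    ∃ p, m.testBit p = true ∧ q + d * 4 ^ (i : ℕ) = p + d' * 4 ^ (i : ℕ) := by
  unfold moveDigit at h
  cases hd : d.ble d' with
  | true =>
    rw [hd, cond_true, Nat.testBit_shiftLeft] at h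
    simp only [Bool.and_eq_true, decide_eq_true_eq, ge_iff_le] at h
    have hd' : d ≤ d' := Nat.le_of_ble_eq_true hd
    refine ⟨_, h.2, ?_⟩
    obtain ⟨e, rfl⟩ := Nat.exists_eq_add_of_le hd'
    rw [Nat.add_sub_cancel_left] at h ⊢
    have := h.1
    rw [add_mul]; omega
  | false =>
    rw [hd, cond_false, Nat.testBit_shiftRight] at h
    have hd' : d' ≤ d := by
      by_contra hlt
      rw [Nat.ble_eq_true_of_le (le_of_lt (not_le.1 hlt))] at hd
      cases hd
    refine ⟨_, h, ?_⟩
    obtain ⟨e, rfl⟩ := Nat.exists_eq_add_of_le hd'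
    rw [Nat.add_sub_cancel_left, add_mul]; omega

lemma testBit_moveDigit_digitMask {m d d' q : ℕ} {i : Fin 4} (hd : d < 4)
    (h : (moveDigit (m &&& digitMask i d) i d d').testBit q = true) :
    ∃ p < 256, m.testBit p = true ∧ digit p i = d ∧ q = setDigit p i d' := by
  obtain ⟨p, hp, hq⟩ := testBit_moveDigit h
  rw [Nat.testBit_and, Bool.and_eq_true] at hp
  obtain ⟨h1, h2⟩ := digitMask_spec hd hp.2
  refine ⟨p, h1, hp.1, h2, ?_⟩
  have := digit_mul_le p i
  rw [setDigit, h2]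
  rw [h2] at this
  omega

variable {S : Type*} [AddCommGroup S] (c : DigitCode S)

/-- The registers encoded by `p`. -/
def decode (p : ℕ) : Fin 4 → S := fun i => c.val (digit p i)

lemma decode_setDigit {p d : ℕ} (hp : p < 256) (hd : d < 4) (i : Fin 4) :
    decode c (setDigit p i d) = Function.update (decode c p) i (c.val d) := by
  funext j
  rw [decode, digit_setDigit hp hd, Function.update_apply]
  split_ifs <;> rfl

/-- The digit arithmetic on codes matches addition in one register, without carries into the others.
-/
lemma decode_setDigit_add {p t : ℕ} (hp : p < 256) (ht : t < 4) (i : Fin 4) :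
    decode c (setDigit p i (c.add (digit p i) t)) = decode c p + Pi.single i (c.val t) := by
  rw [decode_setDigit c hp (c.add_lt _ (digit_lt p i) _ ht), c.val_add _ (digit_lt p i) _ ht]
  funext j
  rcases eq_or_ne j i with rfl | hj
  · simp [decode]
  · simp [hj]

/-- The set of registers encoded by a bit mask. -/
def maskSet (m : ℕ) : Set (Fin 4 → S) := {x | ∃ p, m.testBit p = true ∧ decode c p = x}

/-- Add `t` to the register `i` in all elements of a bit mask. -/
def addDigit (m : ℕ) (i : Fin 4) (t : ℕ) : ℕ :=
  moveDigit (m &&& digitMask i 0) i 0 (c.add 0 t)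
  ||| moveDigit (m &&& digitMask i 1) i 1 (c.add 1 t)
  ||| moveDigit (m &&& digitMask i 2) i 2 (c.add 2 t)
  ||| moveDigit (m &&& digitMask i 3) i 3 (c.add 3 t)

lemma mem_maskSet_addDigit {m t : ℕ} {i : Fin 4} (ht : t < 4) {y : Fin 4 → S}
    (hy : y ∈ maskSet c (addDigit c m i t)) :
    ∃ x ∈ maskSet c m, y = x + Pi.single i (c.val t) := by
  obtain ⟨q, hq, rfl⟩ := hy
  have key : ∀ d < 4, (moveDigit (m &&& digitMask i d) i d (c.add d t)).testBit q = true →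
      ∃ x ∈ maskSet c m, decode c q = x + Pi.single i (c.val t) := by
    intro d hd h
    obtain ⟨p, hp, hm, rfl, rfl⟩ := testBit_moveDigit_digitMask hd h
    exact ⟨decode c p, ⟨p, hm, rfl⟩, decode_setDigit_add c hp ht i⟩
  simp only [addDigit, Nat.testBit_or, Bool.or_eq_true] at hq
  rcases hq with ((hq | hq) | hq) | hq
  · exact key 0 (by norm_num) hq
  · exact key 1 (by norm_num) hq
  · exact key 2 (by norm_num) hq
  · exact key 3 (by norm_num) hq

/-! ### Elimination of vertices and checking the tables -/

/-- One stage of the elimination: the vertex in the register `reg` gets its remaining edges, to the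
vertices in the registers `nbs` (`none` stands for the root, whose register is omitted), and is
then closed. -/
structure Stage where
  reg : Fin 4
  nbs : List (Option (Fin 4))

/-- Choose nonzero values on the edges from the register `r` to `nbs` in such a way that `k` holds
for the resulting registers. -/
def ChooseEdges (r : Fin 4) : List (Option (Fin 4)) → (Fin 4 → S) → ((Fin 4 → S) → Prop) → Prop
  | [], x, k => k x
  | none :: l, x, k => ∃ t, t ≠ 0 ∧ ChooseEdges r l (x + Pi.single r t) k
  | some j :: l, x, k => ∃ t, t ≠ 0 ∧ ChooseEdges r l (x + Pi.single r t + Pi.single j (-t)) k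

/-- Starting with boundary `x`, edge values can be chosen such that `η n` is the boundary
of the `n`-th closed vertex. -/
def Solvable : List Stage → (Fin 4 → S) → (ℕ → S) → Prop
  | [], _, _ => True
  | s :: P, x, η => ChooseEdges s.reg s.nbs x fun y =>
      y s.reg = η 0 ∧ Solvable P (Function.update y s.reg 0) fun n => η (n + 1)

lemma ChooseEdges.translate {r : Fin 4} {a : Fin 4 → S} {k k' : (Fin 4 → S) → Prop}
    (hk : ∀ y, k y → k' (y + a)) :
    ∀ {l : List (Option (Fin 4))} {x : Fin 4 → S}, ChooseEdges r l x k →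
      ChooseEdges r l (x + a) k'
  | [], _, h => hk _ h
  | none :: l, x, ⟨t, ht, h⟩ => by
    refine ⟨t, ht, ?_⟩
    have := ChooseEdges.translate (l := l) hk h
    rwa [add_right_comm] at this
  | some j :: l, x, ⟨t, ht, h⟩ => by
    refine ⟨t, ht, ?_⟩
    have := ChooseEdges.translate (l := l) hk h
    rwa [add_right_comm, add_right_comm x] at this

/-- Shifting the registers by `a` shifts the boundary found at the next closed vertex by its
coordinate of `a`; closing erases that coordinate and the rest persists. It is essential that `η'`
depends on `a` and `η` only, so that one translation serves all elements of a mask. -/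
lemma exists_solvable_translate (P : List Stage) :
    ∀ (a : Fin 4 → S) (η : ℕ → S), ∃ η', ∀ x, Solvable P x η' → Solvable P (x + a) η := by
  induction P with
  | nil => exact fun _ η => ⟨η, fun _ _ => trivial⟩
  | cons s P ih =>
    intro a η
    obtain ⟨η', h⟩ := ih (Function.update a s.reg 0) fun n => η (n + 1)
    refine ⟨fun n => Nat.casesOn n (η 0 - a s.reg) η', fun x hx => ?_⟩
    refine ChooseEdges.translate (fun y hy => ⟨?_, ?_⟩) hx
    · simp [hy.1]
    · convert h _ hy.2 using 1
      funext j
      rcases eq_or_ne j s.reg with rfl | hj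
      · simp
      · simp [hj]

/-- Whatever the prescribed boundaries are, one of the elements of the bit mask solves them. -/
def Good (P : List Stage) (m : ℕ) : Prop := ∀ η : ℕ → S, ∃ x ∈ maskSet c m, Solvable P x η

/-- Add the code `a` to all elements of a bit mask. -/
def translateMask (m a : ℕ) : ℕ :=
  addDigit c (addDigit c (addDigit c (addDigit c m 0 (digit a 0)) 1 (digit a 1)) 2 (digit a 2)) 3
    (digit a 3)

lemma mem_maskSet_translateMask {m a : ℕ} {y : Fin 4 → S}
    (hy : y ∈ maskSet c (translateMask c m a)) :
    ∃ x ∈ maskSet c m, y = x + decode c a := by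
  obtain ⟨x3, h3, rfl⟩ := mem_maskSet_addDigit c (digit_lt _ _) hy
  obtain ⟨x2, h2, rfl⟩ := mem_maskSet_addDigit c (digit_lt _ _) h3
  obtain ⟨x1, h1, rfl⟩ := mem_maskSet_addDigit c (digit_lt _ _) h2
  obtain ⟨x0, h0, rfl⟩ := mem_maskSet_addDigit c (digit_lt _ _) h1
  refine ⟨x0, h0, ?_⟩
  funext j
  fin_cases j <;> simp [decode]

lemma maskSet_mono {m m' : ℕ} (h : m &&& m' = m) : maskSet c m ⊆ maskSet c m' := by
  rintro x ⟨p, hp, rfl⟩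
  rw [← h, Nat.testBit_and, Bool.and_eq_true] at hp
  exact ⟨p, hp.2, rfl⟩

/-- The bit mask obtained by choosing the value of an edge from the register `r` to `nb`. -/
def edgeMask (r : Fin 4) (m : ℕ) : Option (Fin 4) → ℕ
  | none => addDigit c m r 1 ||| addDigit c m r 2 ||| addDigit c m r 3
  | some j => addDigit c (addDigit c m r 1) j (c.neg 1) |||
      addDigit c (addDigit c m r 2) j (c.neg 2) ||| addDigit c (addDigit c m r 3) j (c.neg 3)

/-- The bit mask obtained by choosing the values of the edges from the register `r` to `nbs`. -/
def edgesMask (r : Fin 4) : List (Option (Fin 4)) → ℕ → ℕ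
  | [], m => m
  | nb :: l, m => edgesMask r l (edgeMask c r m nb)

lemma DigitCode.val_ne_zero {t : ℕ} (ht : t < 4) (h0 : t ≠ 0) : c.val t ≠ 0 :=
  fun h => h0 (c.val_eq_zero t ht h)

lemma exists_chooseEdges {r : Fin 4} {k : (Fin 4 → S) → Prop} :
    ∀ {l : List (Option (Fin 4))} {m : ℕ}, (∃ y ∈ maskSet c (edgesMask c r l m), k y) →
      ∃ x ∈ maskSet c m, ChooseEdges r l x k
  | [], m, h => h
  | none :: l, m, h => by
    obtain ⟨y, hy, hk⟩ := exists_chooseEdges (l := l) h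
    obtain ⟨q, hq, rfl⟩ := hy
    have key : ∀ t < 4, t ≠ 0 → (addDigit c m r t).testBit q = true →
        ∃ x ∈ maskSet c m, ChooseEdges r (none :: l) x k := by
      intro t ht h0 h
      obtain ⟨x, hx, he⟩ := mem_maskSet_addDigit c ht ⟨q, h, rfl⟩
      exact ⟨x, hx, c.val t, c.val_ne_zero ht h0, he ▸ hk⟩
    simp only [edgeMask, Nat.testBit_or, Bool.or_eq_true] at hq
    rcases hq with (hq | hq) | hq
    · exact key 1 (by norm_num) (by norm_num) hq
    · exact key 2 (by norm_num) (by norm_num) hq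
    · exact key 3 (by norm_num) (by norm_num) hq
  | some j :: l, m, h => by
    obtain ⟨y, hy, hk⟩ := exists_chooseEdges (l := l) h
    obtain ⟨q, hq, rfl⟩ := hy
    have key : ∀ t < 4, t ≠ 0 → (addDigit c (addDigit c m r t) j (c.neg t)).testBit q = true →
        ∃ x ∈ maskSet c m, ChooseEdges r (some j :: l) x k := by
      intro t ht h0 h
      obtain ⟨x', hx', he'⟩ := mem_maskSet_addDigit c (c.neg_lt t ht) ⟨q, h, rfl⟩
      obtain ⟨x, hx, rfl⟩ := mem_maskSet_addDigit c ht hx'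
      rw [c.val_neg t ht] at he'
      exact ⟨x, hx, c.val t, c.val_ne_zero ht h0, he' ▸ hk⟩
    simp only [edgeMask, Nat.testBit_or, Bool.or_eq_true] at hq
    rcases hq with (hq | hq) | hq
    · exact key 1 (by norm_num) (by norm_num) hq
    · exact key 2 (by norm_num) (by norm_num) hq
    · exact key 3 (by norm_num) (by norm_num) hq

/-- The elements of a bit mask whose digit in the register `i` is `g`, with this digit erased. -/
def closeMask (m : ℕ) (i : Fin 4) (g : ℕ) : ℕ := moveDigit (m &&& digitMask i g) i g 0

lemma mem_maskSet_closeMask (h0 : c.val 0 = 0) {m g : ℕ} (hg : g < 4) {i : Fin 4} {y : Fin 4 → S}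
    (hy : y ∈ maskSet c (closeMask m i g)) :
    ∃ x ∈ maskSet c m, x i = c.val g ∧ y = Function.update x i 0 := by
  obtain ⟨q, hq, rfl⟩ := hy
  obtain ⟨p, hp, hm, rfl, rfl⟩ := testBit_moveDigit_digitMask hg hq
  exact ⟨decode c p, ⟨p, hm, rfl⟩, rfl, by rw [decode_setDigit c hp (by norm_num), h0]⟩

lemma DigitCode.val_zero : c.val 0 = 0 := by
  obtain ⟨a, ha, h⟩ := c.surj 0
  rwa [c.val_eq_zero a ha h] at h

/-- A translate of the mask `target` contains a member of the family `F`, which ones being encoded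
by `code`. -/
def covers (F : List (ℕ × ℕ)) (target code : ℕ) : Bool :=
  match F[code / 256]? with
  | none => false
  | some C => (C.1 &&& translateMask c target (code % 256)).beq C.1

/-- Check a table of families of bit masks: in every stage and for every member of the family, and
for every boundary prescribed at the closed vertex, the resulting mask contains a translate of a
member of the next family. Each mask comes with the codes of these four translates. -/
def checkFamilies : List Stage → List (ℕ × ℕ) → List (List (ℕ × ℕ)) → Bool
  | [], F, _ => F.all fun x => !(x.1.beq 0)
  | _ :: _, _, [] => false
  | s :: P, F, F' :: T =>
    (F.all fun x =>
      -- The codes are packed as four fields of 16 bits, one for each boundary value `0`, `1`, `2`,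
      -- `3`. In a field, the high byte is a position in `F'` and the low byte a translation of the
      -- four registers.
      covers c F' (closeMask (edgesMask c s.reg s.nbs x.1) s.reg 0) (x.2 % 65536) &&
      covers c F' (closeMask (edgesMask c s.reg s.nbs x.1) s.reg 1) (x.2 / 65536 % 65536) &&
      covers c F' (closeMask (edgesMask c s.reg s.nbs x.1) s.reg 2) (x.2 / 4294967296 % 65536) &&
      covers c F' (closeMask (edgesMask c s.reg s.nbs x.1) s.reg 3) (x.2 / 281474976710656)) &&
    checkFamilies P F' T

/-- Being good is inherited by larger masks and by translates, since all boundaries are quantified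
over. -/
lemma good_of_covers {P : List Stage} {F : List (ℕ × ℕ)} {target code : ℕ}
    (hF : ∀ x ∈ F, Good c P x.1) (h : covers c F target code = true) : Good c P target := by
  unfold covers at h
  split at h
  · cases h
  · rename_i C hC
    intro η
    obtain ⟨η', hη'⟩ := exists_solvable_translate P (-decode c (code % 256)) η
    obtain ⟨x, hx, hs⟩ := hF C (List.mem_of_getElem? hC) η'
    obtain ⟨y, hy, rfl⟩ :=
      mem_maskSet_translateMask c (maskSet_mono c (Nat.eq_of_beq_eq_true h) hx)
    have := hη' _ hs
    rw [add_neg_cancel_right] at this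
    exact ⟨y, hy, this⟩

lemma good_cons {s : Stage} {P : List Stage} {m : ℕ}
    (h : ∀ g < 4, Good c P (closeMask (edgesMask c s.reg s.nbs m) s.reg g)) :
    Good c (s :: P) m := by
  intro η
  obtain ⟨g, hg, hη⟩ := c.surj (η 0)
  obtain ⟨y, hy, hs⟩ := h g hg fun n => η (n + 1)
  obtain ⟨x, hx, hxg, rfl⟩ := mem_maskSet_closeMask c c.val_zero hg hy
  exact exists_chooseEdges c ⟨x, hx, hxg.trans hη, hs⟩

lemma good_of_checkFamilies : ∀ {P : List Stage} {F : List (ℕ × ℕ)} {T : List (List (ℕ × ℕ))},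
    checkFamilies c P F T = true → ∀ x ∈ F, Good c P x.1
  | [], F, _, h, x, hx => by
    intro η
    have := List.all_eq_true.1 h x hx
    have h0 : x.1 ≠ 0 := fun h0 => by rw [h0] at this; cases this
    obtain ⟨p, hp⟩ := Nat.exists_testBit_of_ne_zero h0
    exact ⟨_, ⟨p, hp, rfl⟩, trivial⟩
  | _ :: _, _, [], h, _, _ => by cases h
  | s :: P, F, F' :: T, h, x, hx => by
    rw [checkFamilies, Bool.and_eq_true] at h
    have hF := good_of_checkFamilies h.2
    have hx := List.all_eq_true.1 h.1 x hx
    simp only [Bool.and_eq_true] at hx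
    refine good_cons c fun g hg => ?_
    interval_cases g
    · exact good_of_covers c hF hx.1.1.1
    · exact good_of_covers c hF hx.1.1.2
    · exact good_of_covers c hF hx.1.2
    · exact good_of_covers c hF hx.2

/-- The mask `1` contains only the code `0`, that is, all registers empty. -/
theorem solvable_of_checkFamilies {P : List Stage} {a : ℕ} {T : List (List (ℕ × ℕ))}
    (h : checkFamilies c P [(1, a)] T = true) (η : ℕ → S) : Solvable P 0 η := by
  obtain ⟨x, ⟨p, hp, rfl⟩, hx⟩ := good_of_checkFamilies c h (1, a) (by simp) η
  have hp0 : p = 0 := by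
    cases p with
    | zero => rfl
    | succ n => simp [Nat.testBit_succ] at hp
  have : decode c p = 0 := by
    funext i
    simp [decode, digit, hp0, c.val_zero]
  rwa [this] at hx

/-! ### Exhaustive search for one boundary -/

/-- Add the code `t` to the register `i`. -/
def addAt (p : ℕ) (i : Fin 4) (t : ℕ) : ℕ := setDigit p i (c.add (digit p i) t)

lemma addAt_lt {p t : ℕ} (hp : p < 256) (ht : t < 4) (i : Fin 4) : addAt c p i t < 256 :=
  setDigit_lt hp (c.add_lt _ (digit_lt p i) _ ht) i

/-- The boolean search corresponding to `ChooseEdges`. -/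
def searchEdges (r : Fin 4) : List (Option (Fin 4)) → ℕ → (ℕ → Bool) → Bool
  | [], p, k => k p
  | none :: l, p, k => searchEdges r l (addAt c p r 1) k || searchEdges r l (addAt c p r 2) k ||
      searchEdges r l (addAt c p r 3) k
  | some j :: l, p, k => searchEdges r l (addAt c (addAt c p r 1) j (c.neg 1)) k ||
      searchEdges r l (addAt c (addAt c p r 2) j (c.neg 2)) k ||
      searchEdges r l (addAt c (addAt c p r 3) j (c.neg 3)) k

/-- The boolean search corresponding to `Solvable`. -/
def search : List Stage → ℕ → List ℕ → Bool
  | [], _, _ => true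
  | s :: P, p, η => searchEdges c s.reg s.nbs p fun q =>
      (digit q s.reg).beq (η.headD 0) && search P (setDigit q s.reg 0) η.tail

lemma DigitCode.exists_code {t : S} (h : t ≠ 0) :
    t = c.val 1 ∨ t = c.val 2 ∨ t = c.val 3 := by
  obtain ⟨a, ha, rfl⟩ := c.surj t
  interval_cases a
  · exact absurd c.val_zero h
  all_goals simp

/-- For refutations the search has to be complete: any choice of nonzero edge values is one of the
branches `1`, `2`, `3`. -/
lemma searchEdges_eq_true {r : Fin 4} {k : (Fin 4 → S) → Prop} {k' : ℕ → Bool}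
    (hk : ∀ q < 256, k (decode c q) → k' q = true) :
    ∀ {l : List (Option (Fin 4))} {p : ℕ}, p < 256 → ChooseEdges r l (decode c p) k →
      searchEdges c r l p k' = true
  | [], p, hp, h => hk p hp h
  | none :: l, p, hp, ⟨t, ht, h⟩ => by
    have key : ∀ a < 4, t = c.val a → searchEdges c r l (addAt c p r a) k' = true := by
      rintro a ha rfl
      refine searchEdges_eq_true hk (addAt_lt c hp ha r) ?_
      rwa [addAt, decode_setDigit_add c hp ha]
    simp only [searchEdges, Bool.or_eq_true]
    rcases c.exists_code ht with h1 | h2 | h3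
    · exact Or.inl (Or.inl (key 1 (by norm_num) h1))
    · exact Or.inl (Or.inr (key 2 (by norm_num) h2))
    · exact Or.inr (key 3 (by norm_num) h3)
  | some j :: l, p, hp, ⟨t, ht, h⟩ => by
    have key : ∀ a < 4, t = c.val a →
        searchEdges c r l (addAt c (addAt c p r a) j (c.neg a)) k' = true := by
      rintro a ha rfl
      have hp' := addAt_lt c hp ha r
      refine searchEdges_eq_true hk (addAt_lt c hp' (c.neg_lt a ha) j) ?_
      rwa [addAt, decode_setDigit_add c hp' (c.neg_lt a ha), c.val_neg a ha, addAt,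
        decode_setDigit_add c hp ha]
    simp only [searchEdges, Bool.or_eq_true]
    rcases c.exists_code ht with h1 | h2 | h3
    · exact Or.inl (Or.inl (key 1 (by norm_num) h1))
    · exact Or.inl (Or.inr (key 2 (by norm_num) h2))
    · exact Or.inr (key 3 (by norm_num) h3)

lemma search_eq_true : ∀ {P : List Stage} {p : ℕ} {η : List ℕ}, p < 256 → (∀ n ∈ η, n < 4) →
    Solvable P (decode c p) (fun n => c.val (η.getD n 0)) → search c P p η = true
  | [], _, _, _, _, _ => rfl
  | s :: P, p, η, hp, hη, h => by
    refine searchEdges_eq_true c (fun q hq hk => ?_) hp h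
    rw [Bool.and_eq_true]
    have h0 : η.getD 0 0 = η.headD 0 := by cases η <;> rfl
    have h4 : η.headD 0 < 4 := by
      cases η with
      | nil => norm_num
      | cons a l => exact hη a (by simp)
    refine ⟨Nat.beq_eq ▸ c.val_inj _ (digit_lt _ _) _ h4 (h0 ▸ hk.1), ?_⟩
    refine search_eq_true (setDigit_lt hq (by norm_num) _)
      (fun n hn => hη n (List.mem_of_mem_tail hn)) ?_
    rw [decode_setDigit c hq (by norm_num), c.val_zero]
    convert hk.2 using 3
    cases η <;> simp

theorem not_solvable_of_search {P : List Stage} {η : List ℕ} (hη : ∀ n ∈ η, n < 4)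
    (h : search c P 0 η = false) : ¬ Solvable P 0 (fun n => c.val (η.getD n 0)) := by
  intro hs
  have h0 : decode c 0 = 0 := by
    funext i
    simp [decode, digit, c.val_zero]
  rw [← h0] at hs
  rw [search_eq_true c (by norm_num) hη hs] at h
  cases h

end GroupConn

/-! ### Elimination orders and tables for the two graphs -/

namespace GroupConn

/-- The stages for the graph `H₁`: its vertices are closed in the order
`13 9 3 8 4 14 5 12 0 11 2 7 1 6`, and `10` is the root. -/
def firstGraphStages : List Stage :=
  -- Registers are reused: `13` starts in register `0` with neighbours `9` in register `1` and the
  -- root; once `13` is closed, register `0` holds `4`.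
  [⟨0, [some 1, none]⟩, ⟨1, [some 0, some 2]⟩, ⟨1, [some 3, some 2, some 0]⟩, ⟨2, [some 1]⟩, ⟨0,
   [some 2]⟩, ⟨2, [some 0]⟩, ⟨0, [some 2, none]⟩, ⟨0, [some 2, some 1]⟩, ⟨2, [some 0]⟩, ⟨1,
   [some 2]⟩, ⟨3, [some 0, some 2]⟩, ⟨2, [some 1]⟩, ⟨0, [some 1]⟩, ⟨1, [none]⟩]

/-- The stages for the graph `H₂`: its vertices are closed in the order
`2 6 1 7 12 0 10 11 13 8 5 9 14 4`, and `3` is the root. -/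
def secondGraphStages : List Stage :=
  [⟨0, [some 1, none, some 2]⟩, ⟨0, [some 1, some 3, some 2]⟩, ⟨1, [some 0]⟩, ⟨2, [some 1]⟩, ⟨2,
   [some 0, some 1]⟩, ⟨0, [some 2]⟩, ⟨3, [some 2, some 0]⟩, ⟨1, [some 3]⟩, ⟨0, [some 1]⟩, ⟨3,
   [none, some 1]⟩, ⟨2, [some 0]⟩, ⟨1, [some 0]⟩, ⟨1, [none, some 0]⟩, ⟨0, []⟩]

/-- The table for the group `ℤ₂ × ℤ₂` and the graph `H₁`. -/
def firstGraphTable : List (List (ℕ × ℕ)) := [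
  [(0x101, 0x112001101120011), (0x1001, 0x11021302130011), (0x11, 0x321032100110011)],
  [(0x8000400000001, 0x42004300400041), (0xa000100000001, 0x42017200420172),
   (0x1000600000001, 0x250004300430263), (0xc000000010001, 0x42004203b103b1)],
  [(0x1000200040008000200010008000400000000000000000008000400020001, 0x6000700040005),
   (0x5000a0005000a000800050002000100000000000000000008000500020001, 0x106010701040105),
   (0x8000400060001000600090009000600000000000000000008000600020001, 0x306030703040305),
   (0x30003000c000c000000000000000000080004000300010008000400030001, 0x206020702040205)],
  [(0x1208000000000000210400000000000000000000000000008401, 0x318011c02e000a0),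
   (0x5a0a000000000000840100000000000000000000000000008401, 0x53007200e100b28),
   (0x330c000000000000000000000000000084010000000000008401, 0xa18081c0f1006e0),
   (0x8401000000000000690600000000000000000000000000008401, 0x93004200d100c3c)],
  [(0x1000010001000000000100001000000000000001, 0x342018f0289018d),
   (0x1001000001000001000010000000000000000000000001000000000000001, 0x103000d000e000f),
   (0x1000001001000000000000000000001000000000100001000000000000001, 0x30300c100c200c3),
   (0x1001000000000001000010000010000000000000000000000010000000001, 0x90202000b000a),
   (0x1000000000000001010000001001010000000000000000001000000000000001, 0x90309020e010a0f),
   (0x100001011000000001000000000100000000000000000000010000000001, 0x70307020d01080a),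
   (0x10000100000000001000010000000000000000001100000000010001, 0xf020bcf0cc90bcd),
   (0x101000001011000100000000000000100000000000000001000000000000001, 0x703040d040e040f),
   (0x11001100001000000000000000000010000000000000011000000000000001, 0xb03060d060e060f),
   (0x10000000001000010011001010000000000000000000000010000000001, 0x5090902050b050a),
   (0x11001100000100000000000000000000000100000000010000010000000001, 0x6090c02060b060a),
   (0x101000001010010000000000010000100000000000000000000000000100001, 0x406040708010405),
   (0x100001000010011001001000000000000000000000000000100001, 0x50605070a010505),
   (0x1000010000000001010010010000010000000000000000001000010000000001, 0x5090e02050b050a),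
   (0x101100000001000100001000000000100000000000000001000010000000001, 0xd03040d040e040f),
   (0x1000100001100000000000000000010000100000000011000010000000001, 0x603060206010fc3)],
  [(0x1000000000000000010000000000000000000000000000000001, 0x210031004200210),
   (0x1040000000000000000400000000000000000000000000000001, 0x510062006100b10),
   (0x8000000000000018000000000000000000000000000000001, 0x7100a100c300710),
   (0x1200000000000000000000000000000000020000000000000001, 0x820096009500e20),
   (0x1010000000000000000100000000000000000000000000000001, 0x6200b1000200020),
   (0x1000000000000011000000000000000000000000000000001, 0x7100c1001200120),
   (0x1100000000000000000000000000000000010000000000000001, 0x9500d100e200820),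
   (0x1202000000000000000100000000000000000000000000000001, 0x8200b1000240024),
   (0x818000000000000000100000000000000000000000000000001, 0x24002411201120),
   (0x1000000000000210200000000000000000000000000000001, 0x710133000640064),
   (0x1000000000000401400000000000000000000000000000001, 0x124012412301230),
   (0x1044000000000000000000000000000000010000000000000001, 0x5100d100f300d10),
   (0x188000000000000000000000000000000010000000000000001, 0xf000a500e200e20),
   (0x5000000000000000040100000000000000000000000000000401, 0x5dc031010180310),
   (0x8001000000000000090000000000000000000000000000008001, 0x2100a9810180210),
   (0x1200000000000000120000000000000000000000000000000003, 0x8200ddc04200420)],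
  [(0x10101010000000000000000000000000000000000000000000000000, 0x1c400c004e000c0),
   (0x110011000000000000000000000000000000000, 0x280038404a00280),
   (0x1000000000001000010000000000010000000000000000000001000000000001, 0x2e1413042708130c),
   (0x100000001000000001000000010000000000000000000000000100000001, 0x16042c14220c1608),
   (0x10001000000000000100010000000000000000000000000000010001, 0x1d081b0c2f281b04),
   (0x1010001000001000000000000000000000000000000000000001000000000001, 0x2ac0051c262c0514),
   (0x1010000000000010000100000000000100000000000000000001000000000000, 0xc140e041e080c18),
   (0x1000000000001010000000000010000000000000000000001000000000001, 0x2e1414042808140c),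
   (0x1100000001001000000000000000000000000000000000000001000000000001, 0x29c0121c072c0728),
   (0x110000000000010000010000000000000001000000000001, 0x854114421480858),
   (0x1001100000010000000000000000000000000100000001, 0x6182b80092c0614),
   (0x100000001000000000010000000100000000000000000000000100000001, 0x18042c14240c1808),
   (0x100000001000000100000011000000000000000000000000000000001, 0xd180f1c1f2c0d14),
   (0x100000001000000000000000000000000001000000010000000100000001, 0x17c82dd023c017c4),
   (0x1000100000000000000000000000000000100010000000000010001, 0x1cc01ac42fe01acc),
   (0x1100110000000000000000000000000000000100000000000000010000, 0x808100c20280804),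
   (0x1000000010000100000000000100000000000000000100010000000000, 0x19c0158425c8158c),
   (0x101000000100010000000000001000100000000000000000000000000010001, 0xb080a5c31c00a54),
   (0x10001000010010010001000000000000000000000000000010001, 0xb580a0c32800a04),
   (0x100000001000011011001010000000000000000000000000100000001, 0x30183314090c0608)],
  [(0x101010101010101, 0xc030c030c030c03), (0x1010101001010101, 0x1003100310071007),
   (0x1001100110011001, 0xd030d030d030d03), (0x110011010011001, 0xf030f030f070f07),
   (0x11111111, 0x2000200010001),
   (0x1010001010101000000000000000000000000000000000000001010001000001, 0x2030208020b0200),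
   (0x1001100110010000000000000000001000000110000001, 0x485048b04870489),
   (0x1100110001001000000000000000000000000000000000000001001000100001, 0x606060206010605),
   (0x111000000001110000000000000000010000000000000011000000000000001, 0x10301020101010f),
   (0x100101101000010000000000000000000010000100100001, 0x485048104870483),
   (0x100010000010001100110000110001000000000000000000000000000000000, 0x3c903c803c103c0),
   (0x100010110100010100010000001000100000000000000000000000000000000, 0x58c058d05810580),
   (0x111000000001110100100000000100100000000000000001000000000000001, 0x70307020701070f),
   (0x1000000110000001011000100100011000000000000000001000000000000001, 0x1203120d1201120f),
   (0x10101010001010000101000100000100000000000000000000010000000001, 0x110911021101110a),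
   (0x10100000101000010110000111000000000000000000000010000000001, 0x80308020801080a),
   (0x11110011000011000000000000000000000100000000010000010000000001, 0x13031302130b130a),
   (0x100001100011100000000000000000000010100010000010000010000000001, 0x150915021501150a),
   (0x1101001001111000000000000000000000000000000000000001010001000001, 0x60906020601060a),
   (0x1000001000101000010000010001010000000000000000000001010001000001, 0x1600160816081600),
   (0x1010001000001010000010001010000000000000000000001010001000001, 0x2003200b200b2003),
   (0x100010100010010100000101000000001010001000001, 0x1d46280b1d4e2803),
   (0x1100000011000001001000010010000000000000000001000000110000001, 0x180c1800180c1800),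
   (0x1100000011000000110000001100000000000000000001000000110000001, 0x230e2302230e2302),
   (0x1100000011000100000011000000100000000000000001000000110000001, 0x220e2202220e2202),
   (0x1000110001000000000000000000000000110011000001000000110000001, 0x290e1e471e4b2902),
   (0x1000101000100000100010100010000000000000000000100010000010001, 0x2109210921012101),
   (0x10001010001000000100010100010000000000000000000100010000010001, 0x1708170817001700),
   (0x10001001000100001000100100010000000000000000001000100000010001, 0x240d240d24012401),
   (0x1000110001000001000100100010000000000000000001000100000010001, 0x1708170817041704),
   (0x10000101011010000100100010000100000000000000000000000000100001, 0x1106110211011105),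
   (0x10000100100001000100101001011000000000000000000000000000100001, 0x1203120712011205),
   (0x11001100110011000000000000000000000000001000010000000000100001, 0x1401140114011401),
   (0x100100011001100000000000000000000010010001000010000000000100001, 0x1506150215011505),
   (0x100100001001000100001001000010000000000000000000010000100100001, 0x180c1808180c1808),
   (0x100100001001000010010000100100000000000000000000010000100100001, 0x2503250725032507),
   (0x100100001001000001000010010000100000000000000000010000100100001, 0x2603260726032607),
   (0x11001100000000000000000000010010001000010010000100100001, 0x2c032c071fc91fcd),
   (0x1011011101001000000000000000000000000000000000000001001000100001, 0x20c0208020b020f),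
   (0x1000010001001000010010001000010000000000000000000001001000100001, 0x160c16081608160c),
   (0x1001000100001010010001000010000000000000000000001001000100001, 0x2706270227022706),
   (0x11001100000000000000000000000000000000000001000011111100001, 0x2cc1bc71bcb02cf),
   (0x11001100000000000000000000000000000000000001000111001110001, 0x2cf1cc71ccb02cc),
   (0x101000001010000000000000000000001110010010110001, 0x1a8604031a8e0401),
   (0x101000001010000001010000010100000000000000000000010100000101, 0x901090209010902),
   (0x101000001010000010100000101000000000000000000000010100000101, 0xa010a020a010a02),
   (0x1001000000001001011000000000011000000000000000001001000000001001, 0xb030b010b010b03),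
   (0x11001100000000001100110000000000000000000000000000110011, 0xe020e020e010e01),
   (0x1000000110000001001011011011010000000000000000001000000110000001, 0x190e190f19031902),
   (0x1100110000000000000000000000000011001100000000001100110010100101, 0x2acd2ac92d002d00),
   (0x110011000000000011001100000000001100110001101001, 0x2b892b8d2d402d40),
   (0x10100000101100101110110110100000000000000000000010100000101, 0x48519020487190a)],
  [(0x1111, 0x710071007100710),
   (0x1110000000000000000000000000000000010000000000000001, 0xe300d601a1007d0),
   (0x2060000000000000000000000000000000000000000000000600, 0x23110ad101e101f1),
   (0xc0080000000000000c00, 0x473056304531f22),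
   (0x5000000000000000000000000000005001, 0x230022006102130),
   (0xc04000000000000c000, 0x972036203521f32),
   (0x9800000000000000000000000000000000000000000000000009, 0xd3232000f30be3),
   (0x1110000000000000100100000000000000000000000000000001, 0xe301520321007d0),
   (0x101000000000000111000000000000000000000000000000001, 0x13300d2026100790),
   (0x1010000000000000010100000000000000000000000000000101, 0x2840152028401520),
   (0x1010000000000000101000000000000000000000000000000101, 0xda00d200da00d20),
   (0x1001000000000000011000000000000000000000000000001001, 0x1330294029401330),
   (0x707, 0x9100c2009100c20), (0x7007, 0xc30051005100c30),
   (0x1100000000000000110000000000000000000000000000000011, 0x1ad01ad026102610),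
   (0x3443, 0x1002051005101002), (0x4343, 0x910101209101012),
   (0x1090000000000000000900000000000000000000000000000001, 0x130012019100af0),
   (0x5000000000000015000000000000000000000000000000001, 0x2300220121006a0),
   (0x2211000000000000000000000000000000010000000000000001, 0x8d108d108d008d0),
   (0xdd000000000000000000000000000000000000000000000000, 0xbe00be00cd20cd2),
   (0x1900000000000000000000000000000000090000000000000001, 0x3011d000100bf0),
   (0x60000000000000000600000000000000000000000000000600, 0x231125a124312321),
   (0xc0000000000000000c00000000000000000000000000000c00, 0x1d121fa21e321d22),
   (0xa00000000000000a00000000000000000000000000000a000, 0x22a1201120212131),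
   (0x1000000000000112100000000000000000000000000000001, 0x3430332007900891),
   (0x813100000000000000000000000000000101, 0x5903520284005a0),
   (0x1521000000000000000000000000000000000000000000001001, 0x2e30294007d008d1),
   (0x1431000000000000000000000000000000000000000000001001, 0x2f3007d0294009f0),
   (0x3080000000000000000000000000000090200000000000000101, 0x17e319d015e02dd3),
   (0x34000000000000005200000000000001001, 0x129014b212b03930),
   (0x8500000000000000490000000000000000000000000000000011, 0x11201cd32d101110),
   (0x601000000000000010600000000000000000000000000000601, 0x1830182018102b60),
   (0x10c000000000000010c00000000000000000000000000000c01, 0x1bd027201bf01be0),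
   (0x100a000000000000a0010000000000000000000000000000a001, 0x1630162016102c70),
   (0x100a000000000000100a0000000000000000000000000000a001, 0xf700f600f500ff0),
   (0x1c000000000000001c00000000000000000000000000000c001, 0x27201e1236f01e32),
   (0x5200000000000000520000000000000000000000000000000025, 0x2ad1202020102a51),
   (0x5200000000000000002500000000000000000000000000000025, 0x2c71202020103111),
   (0x29000000000000290000000000000000000000000000000029, 0x24302b6124103011),
   (0x40300000000000050500000000000000601, 0x199215a02d9115a2),
   (0x800300000000000000000000000000000990000000000000a001, 0x13f012d32dd012f3),
   (0x4859000000000000001100000000000000000000000000000011, 0x12001300af33710),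
   (0x11000000000000845900000000000000000000000000000011, 0x2300220381006a2),
   (0x3300000000000000000000000000000000610000000000000025, 0x11d12dd11a1011e1),
   (0xcc000000000000000000000000000000cc00000000000000cc00, 0x279027901f221f22)],
  [(0x900000000000000000000000000000000000000000000000000000001, 0xd32013111230f11),
   (0x90000000000000000000000000000000000000000000000000001, 0xd01011311320f11),
   (0x5000000000000000000000000000000000001, 0x1208010c230911),
   (0x30000000000000000000000000001, 0x1212153103230322),
   (0x3000000000000000000000001, 0x1221151303230322), (0x3000000000001, 0x1810141303230322),
   (0x5000000000001, 0x1813091305230022), (0x1000100000001, 0xf01090103230221),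
   (0x2000200000001, 0xa000e0003230220), (0x300000001, 0x1312191103230322),
   (0x900000001, 0xf12191304230133), (0x90001, 0xf120e131a230001), (7, 0x181219131a230010),
   (0x100000001000000000000000000000000000000000001, 0x70208230d020911),
   (0x100010000000000000000000000000000000000000000000000000001, 0xb13060308030f11),
   (0xa000000000000000000000000000000010000000000000000, 0x1121001219100c32),
   (0xc000100000000, 0x130114111a010023),
   (0x1000000000000000900000000000000000000000000000000000000000001, 0x12100210f010e11),
   (0x5000000010000000000000000000000000000000000000001, 0x12000209010c33),
   (0x1000000010001000000000000000000000000000000000001, 0xb030b130b130b03),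
   (0x8000000040004000000000000000000000000000000000001, 0x30102030f100813),
   (0x1000000010000000000000000000100000000000000000000000000000001, 0x1012100210121002),
   (0xa000000000000000100000000000000000000000000000001, 0x1710171117101711),
   (0x8000000080000000000000000000400000000000000000000000000000001, 0x202030109100d12),
   (0x1000000000000000600000000000000000000000000000001, 0x1b111b101b101b11),
   (0x1000000000000000000000000000900000000000000000000000000000001, 0x10301130f011122),
   (0x1000100000000000000000000000000000000000000010000000000000001, 0x221022102010201),
   (0xc000000000000000000000000000000010000000000000001, 0x1612161216101610),
   (0x8000800000000000000000000000000000000000000020000000000000001, 0x222032009020f02),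
   (0x3000000000000000000000000000000000000000000000000000000000003, 0x1620163016001610),
   (0x30000000000000000000000000000000000000003, 0x1620163016001610),
   (0x300000000000000000003, 0x1620163016001610),
   (0x5000000000000000000000000000000000000000000000000000000000005, 0x1721173117011711),
   (0x50000000000000000000000000000000000000005, 0x1721173117011711),
   (0x500000000000000000005, 0x1721173117011711),
   (0x9000000000000000000000000000000000000000000000000000000000009, 0x1b211b311b011b11),
   (0x90000000000000000000000000000000000000009, 0x1b211b311b011b11),
   (0x900000000000000000009, 0x1b211b311b011b11),
   (0x100000000000100010000000000000000000000000000000000000001, 0x221022102010201),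
   (0xc000000000000000c00000000000000000000000000000000, 0x1612161216101610),
   (0x1000000010000000000000000000000010000000100000000000000000000, 0x1012100210121002),
   (0x10001000000000001000100000000000000000000, 0xb030b130b130b03),
   (0x1000a00000000000000000000000000000000000000010000000000000000, 0xe03002102010c23),
   (0x600000000000000060000000000000000, 0x1b111b101b101b11),
   (0xa0000000000000000000000000000000a0000000000000000, 0x1710171117101711),
   (0x8000000000000000000090000000000000000000000000000000000000001, 0x1b211b311b011b11),
   (0x500020001000000000000000000000000000000000000000000000001, 0x21082301110a11),
   (0x400030001000000000000000000000000000000000000000000000001, 0x201081301030b03),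
   (0x1000600010000000000000000000000000000000000000001, 0xb030b010b010b03),
   (0x1000a00000000000000000000000100000000000000000000000000000001, 0x1001100210011002),
   (0x1000100000000000100000000000100000000000000000000000000000001, 0x221022102010201),
   (0x1000100000002000100000000000000000000000000000001, 0x302013100110012),
   (0x1000000010002000100000000000000000000000000000001, 0x303030208010012),
   (0x800000003000100000000000000000000000000000001, 0xc33020100020811),
   (0x1000c0000000000000000000000000000000000010000000000000001, 0x202020302010201),
   (0x8000400000005000000000000000100000000000000000000000000000001, 0x12001101110113),
   (0x1000800040000000900000000000000000000000000000001, 0x1000000110012),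
   (0x40003000000000002000500000000000000000001, 0x303003200020811)],
  [(0xd000a00000001, 0xc02060004020e), (0x6000d00000001, 0x20601080104020a),
   (0xc000c00010001, 0xe060e06160a160a), (0x3000300020001, 0xd050d0407040705),
   (0x6000900020001, 0x109010801040105), (0x5000a00020001, 0xc000d00040005),
   (0x5000200030001, 0x805000d05040005), (0x2000900030001, 0x109070504040105),
   (0x3000500040001, 0x110604050308030c), (0x5000400050001, 0x906100409041004),
   (0x8000a00050001, 0xc00070004000f), (0x1000600060001, 0x1505060406041505),
   (0xa00070001, 0xc020c0004010b), (0x9000300080001, 0x5051404030d0309),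
   (0x6000400090001, 0x10601080104010a), (0x8000900090001, 0x14070a070a041404),
   (0xa0001000a0001, 0xb0410050b041005), (0x60000000b0001, 0x20900060104000e),
   (0xb0000000c0001, 0x30a000e02090006), (0x80003000c0001, 0x30a030e030d0309),
   (0x30004000c0001, 0x30a030e0308030c), (0x7000c0001, 0x10b030e020c0107),
   (0xc000c00000003, 0xc060f060c04160a), (0xa000500000005, 0x100412050b041808),
   (0xe000000000007, 0x20c01070104020f), (0xd00000007, 0x702080005020a),
   (0xb0007, 0x209020802040205), (0x9000600000009, 0x1305150406041709)],
  [(0xa01, 0x100000402000004), (0x6001, 0x4000002000104), (7, 0x4020800040104),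
   (0x43, 0x20801040004), (0x2801, 0x4000002000104), (0x4201, 0x10402000004),
   (0x1601, 0x100010401040100), (0x2301, 0x4000000040208), (0x3201, 0x4000001040208),
   (0x5401, 0x10400000200), (0x8901, 0x4000000040200), (0xa101, 0x4000000040000),
   (0xc03, 0x208020802000200), (0x1203, 0x401040004), (0x4403, 0x208020802000200),
   (0xc003, 0x208020802000200), (0x505, 0x4000000040000), (0x1405, 0x4010400040000),
   (0xa005, 0x4000000040000), (0x609, 0x100010401040100), (0x1809, 0x100000400000004),
   (0x9009, 0x100010401040100), (0x33, 0x208020802000200), (0x69, 0x100010401040100),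
   (0xa5, 0x4000000040000)],
  [(0x101, 0), (0x1001, 0), (0x11, 0)],
  [(1, 0)]]

/-- The table for the group `ℤ₄` and the graph `H₂`. -/
def secondGraphTable : List (List (ℕ × ℕ)) := [
  [(0x1100000010010101, 0x1740088014800b4), (0x1100110100000101, 0x8c014c00b80178),
   (0x110110010101, 0xb0017000840144), (0x1011001100001001, 0x17c0080014000bc)],
  [(0x110011010011001000000000000000011000011001111001011010111100101, 0x14300d3016300f3),
   (0x110011010011001101011011010011100000000000000001011010111100101, 0x243036102630341)],
  [(0x2000500020007000400030003000400000000000000000006000600010001, 0xb84010406860347),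
   (0x400030003000400030005000600050006000600010001, 0xa84020405860086),
   (0x2000500020007000000000000000000030005000600050006000600010001, 0xd07040400c60847),
   (0x500090005000c000000000000000000050008000d0008000c000c00010001, 0x9c50c0407c50e06)],
  [(0x190400000000000084090000000000000000000000000000c401, 0x480004d0485004f),
   (0x7202000000000000440300000000000000000000000000001601, 0x50a0200050f0202),
   (0x440300000000000053060000000000001601, 0x40a0282040f0280),
   (0x990200000000000000000000000000003803000000000000a101, 0x5cc02c305c102c1),
   (0x7202000000000000000000000000000053060000000000001601, 0x60a01cd060f01cf),
   (0xc505000000000000990400000000000000000000000000001c01, 0x200010202020043),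
   (0x9904000000000000850d0000000000001c01, 0x28200cc028000ce),
   (0x9902000000000000a3090000000000000000000000000000a101, 0x70f010107000103),
   (0xa3090000000000003803000000000000a101, 0x6c600c206cb00c0),
   (0x2209000000000000a9030000000000000000000000000000b101, 0x70a004f070f004d),
   (0x6505000000000000110600000000000000000000000000003403, 0x200004102020043),
   (0x110600000000000027050000000000003403, 0x282018d028000ce),
   (0xc5050000000000000000000000000000850d0000000000001c01, 0x80a0302080f0000),
   (0x1b0a00000000000000000000000000003a0a0000000000008803, 0x44b030e044c000c),
   (0x6505000000000000000000000000000027050000000000003403, 0x80d01cc08020000)],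
  [(0x2184000000000000000000000000000031c40000000000000609, 0x350001803580010),
   (0x906000000000000c23800000000000000000000000000004218, 0x1140250011c0258),
   (0x5a5a000000000000124800000000000000000000000000004812, 0x9140910091c0918),
   (0x8926000000000000000000000000000091640000000000004218, 0x8140718081c0710),
   (0x4812000000000000126c0000000000006c12, 0x5940590049c0498),
   (0x8425000000000000c83600000000000000000000000000004c13, 0xa94065c0a9c0654),
   (0xa4210000000000000000000000000000b6690000000000006c13, 0xc5810380c500f54),
   (0x6493000000000000c33e0000000000000000000000000000421a, 0xb14117c0b1c0e5c),
   (0x5a5e00000000000000000000000000005a5b0000000000004913, 0xd140d100d1c0d18)],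
  [(0x1100000000010000000000000000000111000000000100100010000000001, 0xb2a0929052f022b),
   (0x10100000000010110001000000000100000000000000001000010000000001, 0x306051f0a060d13),
   (0x10100100000110000000000000000000100001000001000100010000000001, 0x71f141b18290f13),
   (0x100011000000001101000001000001001000010000000001, 0x131307030e021801),
   (0x1000100100000100001001100000000100000000000000000010010000000001, 0x170b081b0c071c2b),
   (0x1000000100000110001001000000100100000000000000000010010000000001, 0x41b040b0107152b),
   (0x1011000001001000000000000000010010010000010001000010000000001, 0x1d231b2210230623),
   (0x1001100001100000000000000000000110010000010001000010000000001, 0x1017003f1c2f170f),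
   (0x110100000000010000000000000000001001001000001101000010000000001, 0x12f00031d2b1b2a),
   (0x1010010100000101100000010000010000000000000000000010010000000001, 0x16331e1b16131f13),
   (0x1001100000100101000010000010000110010000000001, 0x170b1a0b063b1c2b),
   (0x1011000001001110011000000001100000000000000001000010000000001, 0x13130813021b1d33),
   (0x100101100000100101001100000000111000010000000001, 0x31a123214130c03),
   (0x1010010100000101000000000000000010100101000001010010010000000001, 0x82f191b11161513),
   (0x1100101100001100000000000000000001001010000010000110110000000001, 0x1c270b321c070807),
   (0x110011010000001110010011000010001000010100000001, 0x192f0703121e0e32),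
   (0x101001000010000000000000000000001011011001100000011011000001, 0x11060d27100b1116),
   (0x101100111100000000000000000000001010000110000000110010010001, 0x7331a230f071222)],
  [(0x2106423025405201, 0x9c0088002400373), (0x4432025435404201, 0x39c0248023404e52),
   (0x4522025601243201, 0x46931c533df01dd3), (0x81209a1811a3201, 0x45901bf130b11a71),
   (0x2512522422451402, 0x3a9038502a533bd0), (0x2516523405205002, 0x37c335504a434bd0),
   (0x6007421224217003, 0x5630353024000e0), (0x4007512222457001, 0x66028632be007a0),
   (0x4024212570404507, 0x1f93285352e020d3), (0xc581885481845801, 0x3491105117722771),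
   (0x121812a1381aa801, 0xe90275029c111d0), (0xa1a28812a1203a01, 0x21c0498011f012c1),
   (0x4031024437445601, 0xd03cb251e350a3), (0x4412251553202501, 0x48901e5029f01063),
   (0x903182ab2013a01, 0xba30a630a232ee3), (0x532017214250603, 0xd300df00cb02d70),
   (0x2452612543501005, 0x155253c004d24d92), (0x1a1289209b0ab000, 0x199018502b112bd1),
   (0x8912912830812813, 0x3641160116c12581), (0x2015532635002603, 0x3e900d200de03fd0),
   (0x6005532625402603, 0x3e9041630a620a22), (0x2517512207450201, 0x66032d340b03153),
   (0x6441050711340705, 0x14d0015013720170), (0x2242251252363005, 0x425317702a634393),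
   (0x4d155808154d5000, 0x26b21350263214f2), (0x6524535034210601, 0x479333530e931552),
   (0x6401503431655003, 0x22524f304ff04cb0), (0x931a12a11813a003, 0xf9004f3258144d0),
   (0x6517500215255201, 0x4090545012e012d0), (0x5312122554036007, 0xf9054403fd02fd0),
   (0x6436436616440603, 0xc9056f00cb02c43), (0x4113133633610603, 0xbb22c500b9255d0)],
  [(0x200070006000000040000000000020000000000000001, 0x10c12c401041fcc),
   (0x7000400050001000000000000000200000000000000000000000200000000, 0x928092416440a2c),
   (0x2000400020005000000020004000000000000000000000006000000000001, 0x10b411a410bc67ac),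
   (0x100080001000a000000000009000200000000000000000008000100000000, 0xb2c04bc04b80c14),
   (0x5000800090001000000080004000c00000000, 0x14dc1a2c14d43bc4),
   (0x100000000000800080009000b000100000000000000000002000000000001, 0x75c074c07480d1c),
   (0x4000000000002000500010007000200000000000000000002000000000001, 0x180c5d4418042b1c),
   (0x4000000000002000000000000000000020007000400050002000000000001, 0x18543144185c491c),
   (0x2000400020005000000000000000000000003000400000006000000000001, 0x1bec3f081be43dec),
   (0x100020005000200000003000400000006000000000001, 0x370c5008370440ec),
   (0x8000800090005000500090000000800000000000000000000000000000000, 0x157c267815744384),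
   (0x8000800090004000000000000000000010004000c00040000000000000001, 0x6ac2f0806a42754),
   (0x6000400010004000000000000000000030002000200040000000000000001, 0x60c300806042748),
   (0x30005000200030002000200050000000000000000, 0x15ac215415a444ac),
   (0x100020001000800000000000000000000000800080002000a000100000001, 0x29c819fc19f84244),
   (0x1000300030002000000000000000000020000000000030002000000000001, 0xcc00c800c400dc),
   (0x800080002000200010000000800080000000000000000000a000100000001, 0x139c13984e58147c),
   (0x10002000200000002000800080002000a000100000001, 0x4cc80e980e9422ac),
   (0x500010005000200000001000200050000000200000000, 0x428475453e4042c),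
   (0x900000004000500010005000400000000000000000000000400000001, 0x20c020802040228),
   (0x500010005000400000003000000040000000400000001, 0x50c050805040528),
   (0x8000100000005000500000000000800000000000000000004000c00000001, 0x520c418c1d881d84),
   (0x400010002000600010003000600040000000000000000, 0x208446a8208c46bc),
   (0x5000200020002000200000002000400000000000000000000000400010001, 0xf844b380f8c4728),
   (0xa0000000200080009000b000100000000000000000002000000000001, 0x640c1cac5a041ca4),
   (0xa0000000200000000000000000009000b0000000a0002000000000001, 0x1d481d442e68701c),
   (0x4000100030002000000020005000200000000000000000006000000000001, 0x340c3d0834046bac),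
   (0x20005000200020004000200050006000000000001, 0x1c0c51081c0458e8),
   (0x300020008000100000000000900020000000000000000000a000100000001, 0x50bc38bc6a0438b4),
   (0x90002000100080001000a000a000100000001, 0x63bc33bc7a0433b4),
   (0x5000000010002000200050002000400000000000000000001000200000001, 0x80c08080804192c),
   (0xa0000000b0002000000000000000000080000000a00000001000200000001, 0x21f80dfc39040df4),
   (0x1000b0002000200080000000a00000001000200000001, 0x54883a083a045b2c),
   (0x100080001000a000a0001000200000002000200000001, 0x56f823142d04231c),
   (0xc00090000000000010005000c000400000000000000000000000400000001, 0x74542a082a044828),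
   (0x4000000030004000400020005000200000000000000000002000400000001, 0x19183d081b14191c),
   (0x4000000030004000000000000000000030005000400000002000400000001, 0x3e0c3e0857044d28),
   (0x2000400010000000000000000000000010002000600040003000200000001, 0x47c0478366c492c),
   (0x500020007000000000000000000000007000200050000000000000000, 0x54646c686ecc5468),
   (0x1000a0001000000000001000a00010000000000000000000a000100000001, 0x2918171c4fa8171c),
   (0xa0000000b00000001000b0002000200000000000000000000000000000001, 0x2128212428046d8c),
   (0x100020005000000020000000200050004000400010001, 0x43c04384afc1e18),
   (0xa000100000001000100000000000a00000000000000000002000a00010001, 0x83c048c04883c1c),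
   (0x100010007000200020007000000050000000000000000, 0x26b826b453e445c8),
   (0x2000100030003000100030000000000000000000000000003000200000000, 0x32803240314032c),
   (0x6000500010004000000030007000200000000000000000000000000000001, 0x1acc1ac85904482c),
   (0xd00090000000800010005000c00040000000000000001, 0x5c0c1ffc1ff84868),
   (0x100050006000500020004000000030002000000000001, 0x16b4770816bc5f1c),
   (0x4000100030002000000000000000000020004000200050006000000000001, 0x4a0c4e084a044e1c),
   (0x8000b0001000a00010002000000080000000000000000000a000000000001, 0x250c1abc1ab87984),
   (0x10002000000080001000a0008000b000a000000000001, 0x659c258c25885284),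
   (0x800080002000a0009000000030000000000000000000a000100000001, 0x5e48206c76682064),
   (0x80008000200020000000000000000000100020001000a000a000100000001, 0x2d782d744f586954),
   (0x4000000020006000500000005000200000000000000000003000200000001, 0x220c4c7422044b1c),
   (0x2000400010002000400010002000600000000000000000003000200000001, 0x4ac04a8356c552c),
   (0xa0001000a000000080009000100000003000200000001, 0x4eec14dc1e0414d4),
   (0x4000500020002000500020001000200000000000000000002000400000001, 0x190c19081b3c251c),
   (0x400020005000200030005000400000002000400000001, 0x5118660861d4511c),
   (0x4000500020002000000000000000000020002000400050002000400000001, 0x4484d1424fc044c),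
   (0x500020001000200020002000400050002000400000001, 0x1318510861fc131c),
   (0x500010000000c00000000000000000000000c000100010004000400010001, 0x57b44d38072c0728),
   (0x100020006000400030004000000000002000500020001, 0x4cd44cc460d44cd8),
   (0x6000000030005000000000000000000030005000600000002000000000000, 0x24dc721424d4711c),
   (0x500030002000200010005000600000002000000000001, 0x51805145c04051c),
   (0x2000500010007000000000000000000000005000200050000000200000000, 0x72856246ecc072c),
   (0x9000a0003000100010003000a00000000000000000002000000000001, 0xc00080004591c),
   (0x800090000000200010003000a00010000000000000000000a000100000001, 0x564823a42a0423ac),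
   (0x800090000000200000000000000000001000a00090001000a000100000001, 0x56c01440564014c),
   (0x10001000a00090002000800000003000a000100000001, 0x770c01146fc4011c),
   (0x1000a0001000200000000000000000009000100020008000a000100000001, 0x8dc08d808d468fc),
   (0x30002000800010000000000000000000100080001000a000a000100000001, 0xbfc0bf82d44695c),
   (0x8000800020000000000000000000900020003000a000a000100000001, 0x26f806ac4f5806a4),
   (0x5000000010002000000000000000000050003000500040001000200000001, 0x16c46b7816cc322c),
   (0xa0008000a00030000000000000000000a0001000200000002000200000001, 0x6ad816442c04164c),
   (0x1000a0000000a000a0001000a000000000000000000000003000200000001, 0x81808142904081c),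
   (0x500000005000200020005000000050003000200000001, 0xbbc0bb823044f1c),
   (0x30006000000000000000000050006000500030000000400000001, 0x5447308054c0548),
   (0x8000500000005000000000000000000090001000400080004000c00000001, 0x1bec6f081be47818),
   (0x8000500080001000500010000000c00000000000000000000000c00010001, 0x83c048c04880768),
   (0x300010004000500050006000500030000000000000000, 0x15b4448815bc26b8),
   (0x200000009000200000000000000000009000a00020000000b000300000001, 0x47c047858045704),
   (0x20008000800020009000a00020000000b000300000001, 0x46dc0f1c75a80f14),
   (0x70004000500070004000400020000000500000001, 0x10c62c401042158),
   (0x500020005000000020005000000050002000600040001, 0xbbc0bb80c9c1a7c),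
   (0x2000500010007000500010005000600000000000000000000000200000000, 0x157c47241574552c),
   (0x100030000000400030003000600010003000600000001, 0x9840aa87b8c0988),
   (0x30006000400030006000600040000000600040001, 0x40c04087ba40988)],
  [(0x1000100010001000000000000000000000000000000000001, 0x108000c0104000c),
   (0x1010100000001000000000000000000000000000001, 0x42404040608043c),
   (0x100000000000100010001000000000000000000000000000000000001, 0x604000c0634000c),
   (0x1000100010000000000000000000100000000000000000000000000000001, 0xc0104000c0108),
   (0x10010000000010010000000000000000000000001, 0xa140b0415301438),
   (0x100010001000000000001000000000000000000000001, 0x604000c0634000c),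
   (0x100010000010100000000000000000000010000000000000000000000000000, 0xc0e0c000c0d20),
   (0x1100010000000000000000000000000000000000100000000000000001, 0xf28023403000238),
   (0x1000000010000000000010000000000000000000000000001000000000001, 0xb140b040b340b24),
   (0x1000100010010000000000010000000000000000000000000000000000000001, 0x22c0b0404280530),
   (0x10000000110010000000010000000000000000000000000000000000000001, 0x2000e3004180b24),
   (0x1001000010000000100100000000000000000000000000000000000000001, 0x10404140b340604),
   (0x1000001010000000000010100000000000000000000000000000000000001, 0x2040c1408141624),
   (0x1000000010001010000010000000000000000000000000000000001, 0x100010c021c0424),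
   (0x1000100000000000000100000001100000000000000000000000000000000001, 0x108010804280a3c),
   (0x10100010001010000000000000000000000000001, 0x514000c0e3c000c),
   (0x10000010000000001010000000100000000000000000001, 0x834160402080c34),
   (0x10000001000000011000000100000000000000000001, 0xa14040c01080634),
   (0x1000000000000000000000011001000100000000000000000001, 0xc010801080104),
   (0x100000001001000000010001000000000000000000001, 0x438010401040b1c),
   (0x100000000000100000000000000000000000101000000000001000000000001, 0x700021002180210),
   (0x10100010000000000000000000000000000000000000101000000000001, 0x1040414043c0108),
   (0x101010001010001, 0x204000c0208000c),
   (0x101000000000000000001010000000000000000000000000000000000000101, 0x210070c03000700),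
   (0x10100010101000000000000000000000000000000000001, 0x204000c0208000c),
   (0x100100000000100100000001000000000000000000000000000000001, 0x1500082014380914),
   (0x1000010000000000000001001100100000000000000000, 0x408010406300a10),
   (0x101000000000001010000010000000000000000000100000000000000, 0x63c023c133c080c),
   (0x100000000000100000001010100000000000001, 0x52c0b1c082c0a3c),
   (0x100010010000000000010000000010000000000000000001, 0xf000f0c11080f04),
   (0x100000010000000000001000000100000001000000000001, 0x834070c01080104),
   (0x10011001100000000000000000001, 0x4240b0401080104),
   (0x10000010001000000000000000000000000000000000001010000000001, 0x8040414040c0804),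
   (0x1000000000010000000100010000100100000000000000000000000000000000, 0x10801040404042c),
   (0x100000000000100000000000101000000000000000000000001000000000001, 0x200020c0204073c),
   (0x101000000000001000001000001000000000001, 0xa24041c01080a34),
   (0x10101000000000000000000000101000000000001, 0x204000c0208000c),
   (0x100010010000100000000000000000000000000000010000000000001, 0x1040a0409340108),
   (0x1000000110000000000000000000000000000000000000000001100000000001, 0x228120413380218),
   (0x100010001000000000000000000000000001000100000001, 0x528022801080218),
   (0x1000000010010000000110010000000000000000000000000000000000000001, 0x22c000c0224041c),
   (0x1100000001000100000011000000000000000000000000000000000000001, 0x10c0108051c021c),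
   (0x1000100100000000000100011000000000000000000000000000000000000001, 0x52802280a180530),
   (0x10010000000110001001000000000000000000000000000000001, 0x1024023802340238),
   (0x1000100010000001000000000000000010000001000000000000000000000001, 0x108010802180218),
   (0x110000001100010000001000000000000000000000001, 0x21c01080634083c),
   (0x10011001100000010000000000000000000000001, 0x1128023802340230),
   (0x1000100010010000000000000000000000010000100000000000000000000001, 0x204140c02080838),
   (0x10000000010000000000000000000000110010001000000000000000000001, 0x2040a0402080810),
   (0x110010000100000010000000010000000000000000001, 0x218021811080218),
   (0x100100000000000000000000000100010001000010000000000000001, 0x234010401040234),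
   (0x101000000010000000001010000000000000000000000000100000000000001, 0x1040414043c0b24),
   (0x100000100010000000000000101000000000000000000000100000000000001, 0x4240404043c0834),
   (0x100010100000000000000000000000100010000000100000000000001, 0x2380414082c010c),
   (0x100010100000000000100010000000100000000000001, 0x1208000c0534000c),
   (0x100000101000000000001010000000100000000000001, 0x1624022802240404),
   (0x1010000000000000100010000010100000000000001, 0x43c04240404082c),
   (0x1000000010010000000000000000000010000000100000000001000000000001, 0x204033002080f38),
   (0x110010000000010000000100000000001000000000001, 0x438041c01080108),
   (0x1000100100000000000000000000000000000000100000010001000000000001, 0x218041c01080108),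
   (0x101000000000101000000000000000000000101000000000001, 0x20007300208073c),
   (0x110000000000100001001000000000000000000010000000000001, 0x630000006000428),
   (0x110000000000000000000000110001000000000010000000000001, 0x204140c01080104),
   (0x10000000100001000000000000000000000011000000000010000000000001, 0x104063008380104),
   (0x110000000000000000000000100001000000010010000000000001, 0x82c063401040104),
   (0x10000001000010010000000100010000000000001, 0xf000f0c0f080f04),
   (0x10001010001010000000000000000010000000001, 0x141c000c0428000c),
   (0x10001000110001000000100000001, 0x2140e1801080104),
   (0x1001000010001000000000000000000000000000000000010000100000001, 0x104051802180108),
   (0x100110001000100100000001, 0x604023c010c0108),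
   (0x10000000010011000000000000000000000000000000000010001000000001, 0x600042804041104),
   (0x1000100000011000100000011000000000000000000000000000000000000000, 0x1080418010c),
   (0x110010001100010000000100000000000000000000000000000000, 0x10801040104000c),
   (0x10010000000000000000000110010000000010000000000000001, 0x208010402101520),
   (0x100000100010000000000000000000000000100000001010100000000000000, 0xc0234000c0828),
   (0x100100010000000100000001000000000000000000001000000000001, 0x104141416380218),
   (0x1100000001000000000000000000010000001000100000001000000000000, 0x21c010802240d34),
   (0x1000000100010000000000000000000000010000100000010000000000000001, 0xc0604000c0108),
   (0x100010010000000000000000000100000001000010000000000000001, 0x23801040200050c),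
   (0x100001001000100000001000010001000000000000, 0xe04010401000200),
   (0x100100001000000000011000000000010000000000001, 0x604000c06340404),
   (0x100001001000100000000000010010000000000001, 0x152001040600073c),
   (0x100000101010100000000000000000000000000000000010000000001, 0x21002140f040300),
   (0x1010000000100010000010100000001, 0xc0b24000c0104),
   (0x100000010000100000000000000000001000100100000001, 0xf0c021c0c08021c),
   (0x100010010000000110010000000000000000000000000000000000001, 0x10240f240f200f2c),
   (0x1000000100010000000000000000000000011000000010000000000000000001, 0x1040504021c0108),
   (0x100000000010100000000000000000000010101010000000000000000000000, 0xc0818000c0420),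
   (0x10010000000000000000000000011000000000001000000100000001, 0x104040c01080108),
   (0x100010100010000000000010101000000000000000000000000000000000001, 0x220072008140234),
   (0x100000000000100010011001000100000000000000000000000000000001, 0x608010801080234),
   (0x100010000010101010000010000000000000000000001, 0x163402140200082c),
   (0x10100010000000000010101010000000000000000000001, 0x834070c022c0218),
   (0x1000100010010001000000000000000000010000000010000000000000000001, 0x10800000838),
   (0x1100000001001000000000000000000011000000010000000000000000001, 0x218021802180218),
   (0x1000110010000000100000000100010000000000000001, 0x104010401040104),
   (0x101000000010000000000000000000000000100010000010100000000000001, 0xc0204000c0838),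
   (0x100000000010000000000000000000000000101000001000101000000000001, 0xc0210000c0108),
   (0x100000001000000000000000000000001001000010001001000000000001, 0x2180218021c0210),
   (0x10000100000001000100100001000000000000000000000010000000000001, 0x108010405180218),
   (0x1000000010000000010011000100000000000000000010000000000001, 0x238000001040104),
   (0x10000000110001000000000001001000000000000000000010000000000001, 0xf3802000200073c),
   (0x100001001000110001000000000010000000000001, 0x604000c01040210),
   (0x11000000010010000100100010000000000001, 0x828020801040100),
   (0x10100000000000100000101000000000000000000000100010000000001, 0x22c000c0518000c),
   (0x10000000101000000000000000001010001010000000001, 0x518000c0208000c),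
   (0x1000010000001000000001001000000000000000000001000000100000001, 0x604082c041c0108),
   (0x11000000010001001000000010000100000001, 0x424080c06340104),
   (0x1000010000001100000000000000000010001100000001, 0xf04021002140210),
   (0x1010000010100000000010100010001, 0xa14000c0108000c),
   (0x1010000010100000000000000000000010100000101, 0x300030003000300),
   (0x1000000100000001000000000000000000010001000010000000100000000001, 0x214021802100218),
   (0x101000000010000000000000000000001010000010101000000000000000001, 0x208020002000200),
   (0x100100011000000000000000000100011000000010000000000000001, 0x21400000234),
   (0x100110000001000000000000000010000001000010010000000000000001, 0x23800000218),
   (0x110010000000000000000000010010000100110000000000000001, 0x730060401040600),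
   (0x101000100010100000000000000000000010000010000000100000000000001, 0xc0830000c0108),
   (0x110001000000100011001000000000000000000001000000000001, 0x104023405040204),
   (0x1000010011000000000000000000000010000100100001000000000001, 0x104023402340104),
   (0x100010010000100100000000000110010000000000001, 0x634010406300700),
   (0x1000000010010000000000000000000000001001000100011000000000001, 0x2000634000c0104),
   (0x10100000000000000010101000001010000010000000001, 0xf04021002100218),
   (0x1001000000011000000110001000000100000001, 0x104010c0108000c),
   (0x100010000010100010000010000010000000000000000000100010000000001, 0xc0210000c021c)],
  [(0x101010101010101, 0xd030d030d030d03), (0x1001100110011001, 0x1003100310031003),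
   (0x1101000010111001, 0x30e010304020101), (0x111100001111, 0x3000200030002),
   (0x11100101010101, 0xe03060a02020206), (0x1100001110010101, 0x2060b02020a0202),
   (0x1100100111001001, 0x703050207030502), (0x1111101000000101, 0x103000300020001),
   (0x1001011111000101, 0x14010a0315030b02), (0x1110100101010101, 0xe030101150b0103),
   (0x1110100110010101, 0xf030b02150b080d), (0x1100110110010101, 0xf030b0208010a03),
   (0x1101111100001001, 0x1040300030002), (0x110100111011001, 0x4021305020e0206),
   (0x1011100101101001, 0x20e0c0f030e0206), (0x1011011100001101, 0x120111030809110e),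
   (0x1101101100001101, 0x103030201011102), (0x1011101100001101, 0x10311030101030d),
   (0x1101101111000001, 0x7030903020a0202), (0x1001110011100101, 0x20e0a030502020a),
   (0x11001111100101, 0x14010b0a08090f0f), (0x110111011011000, 0x110613050c070a07),
   (0x1111100111000101, 0x703000300020001)],
  [(0x1111, 0x3000300030003), (0x4141, 0x1000300010003), (0x8211, 0x200030003),
   (0x9901, 0x3000000000003), (0x3103, 0x3000300000002), (0x9a01, 3), (0x8a03, 0x200000003),
   (0x6205, 0x1000200000001), (0xcd01, 0x3000200010000), (0x5503, 0x3000300000000),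
   (0x5603, 0x300020001), (0xa903, 0x3000200010000), (0x3305, 0x1000000030002),
   (0x707, 0x200000002), (0x4307, 0x200000003), (0x6107, 0x3000200010000),
   (0x7007, 0x3000000000001), (0x3213, 0x300020001), (0x4515, 0x3000200010000),
   (0x5419, 0x300020001), (0x8c15, 0x3000200010000), (0x2516, 0x3000200010000)],
  [(7, 0)],
  [(0xf, 0)],
  [(1, 0)]]

theorem solvable_firstGraphStages (η : ℕ → ZMod 2 × ZMod 2) : Solvable firstGraphStages 0 η :=
  solvable_of_checkFamilies kleinCode (a := 0x104000402080004) (T := firstGraphTable)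
    (by decide +kernel) η

theorem solvable_secondGraphStages (η : ℕ → ZMod 4) : Solvable secondGraphStages 0 η :=
  solvable_of_checkFamilies zmodFourCode (a := 0x114031802340024) (T := secondGraphTable)
    (by decide +kernel) η

theorem not_solvable_firstGraphStages : ¬ Solvable firstGraphStages 0 fun n =>
    zmodFourCode.val (([2, 2, 0, 1, 0, 1, 0, 2, 2, 0, 0, 0, 1, 1] : List ℕ).getD n 0) :=
  not_solvable_of_search _ (by decide) (by decide +kernel)

theorem not_solvable_secondGraphStages : ¬ Solvable secondGraphStages 0 fun n =>
    kleinCode.val (([0, 0, 0, 2, 1, 3, 0, 0, 2, 3, 3, 2, 1, 1] : List ℕ).getD n 0) :=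
  not_solvable_of_search _ (by decide) (by decide +kernel)

/-! ### From elimination stages to flows -/

section Arcs

variable {V ι S : Type*} [DecidableEq V] [Fintype ι] [AddCommGroup S]

/-- No edge is listed twice, not even in opposite directions, so only one term survives. -/
lemma sum_arcs_apply {A : ι → V × V} (hA : Function.Injective A) (hA' : ∀ i j, A i ≠ (A j).swap)
    (x : ι → S) (i : ι) :
    ∑ j, ((if A j = A i then x j else 0) - if A j = (A i).swap then x j else 0) = x i := by
  classical simp [hA.eq_iff, hA']

variable [Fintype V]

lemma sum_arcs (A : ι → V × V) (x : ι → S) (u : V) :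
    ∑ v, ∑ i, ((if A i = (u, v) then x i else 0) - if A i = (v, u) then x i else 0) =
      ∑ i, ((if (A i).1 = u then x i else 0) - if (A i).2 = u then x i else 0) := by
  rw [Finset.sum_comm]
  refine Finset.sum_congr rfl fun i _ => ?_
  rw [Finset.sum_sub_distrib]
  congr 1 <;> simp only [Prod.ext_iff] <;> split_ifs with h <;> simp [h]

/-- Flows in terms of the values on the arcs of a fixed orientation. -/
theorem exists_isFlow_iff_arcs {G : SimpleGraph V} {A : ι → V × V} (hA : Function.Injective A)
    (hA' : ∀ i j, A i ≠ (A j).swap)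
    (hG : ∀ u v, G.Adj u v ↔ (∃ i, A i = (u, v)) ∨ ∃ i, A i = (v, u)) (γ : V → S) :
    (∃ f, IsFlow G γ f) ↔ ∃ x : ι → S, (∀ i, x i ≠ 0) ∧
      ∀ u, ∑ i, ((if (A i).1 = u then x i else 0) - if (A i).2 = u then x i else 0) = γ u := by
  set F : (ι → S) → V → V → S := fun x u v =>
    ∑ i, ((if A i = (u, v) then x i else 0) - if A i = (v, u) then x i else 0) with hF
  have hanti : ∀ x u v, F x v u = - F x u v := fun x u v => by
    simp only [hF, ← Finset.sum_neg_distrib, neg_sub]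
  have happ : ∀ x i, F x (A i).1 (A i).2 = x i := fun x i => sum_arcs_apply hA hA' x i
  have hzero : ∀ x u v, ¬ G.Adj u v → F x u v = 0 := by
    intro x u v h
    rw [hG, not_or, not_exists, not_exists] at h
    simp [hF, h.1, h.2]
  constructor
  · rintro ⟨f, hf⟩
    refine ⟨fun i => f (A i).1 (A i).2, fun i => hf.ne_zero _ _ ((hG _ _).2 (Or.inl ⟨i, rfl⟩)),
      fun u => ?_⟩
    rw [← sum_arcs, ← hf.sum_eq u]
    refine Finset.sum_congr rfl fun v _ => ?_
    change F (fun i => f (A i).1 (A i).2) u v = f u v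
    by_cases h : G.Adj u v
    · rcases (hG u v).1 h with ⟨i, hi⟩ | ⟨i, hi⟩
      · have := happ (fun i => f (A i).1 (A i).2) i
        rwa [hi] at this
      · have := happ (fun i => f (A i).1 (A i).2) i
        rw [hi] at this
        rw [hanti, this, hf.antisymm, neg_neg]
    · rw [hzero _ _ _ h, hf.eq_zero _ _ h]
  · rintro ⟨x, hx, h⟩
    refine ⟨F x, ?_, ?_, ?_, ?_⟩
    · exact fun u v => hanti x u v
    · intro u v huv
      rcases (hG u v).1 huv with ⟨i, hi⟩ | ⟨i, hi⟩
      · have := happ x i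
        rw [hi] at this
        exact this ▸ hx i
      · have := happ x i
        rw [hi] at this
        rw [hanti, this]
        exact neg_ne_zero.2 (hx i)
    · exact fun u v huv => hzero x u v huv
    · intro u
      rw [← h u, ← sum_arcs]

lemma sum_arcs_eq_zero (A : ι → V × V) (x : ι → S) :
    ∑ u, ∑ i, ((if (A i).1 = u then x i else 0) - if (A i).2 = u then x i else 0) = 0 := by
  rw [Finset.sum_comm]
  exact Finset.sum_eq_zero fun i _ => by simp [Finset.sum_sub_distrib]

/-- The boundary at one vertex is determined by the others. -/
lemma forall_arcs_eq_of_ne {A : ι → V × V} {x : ι → S} {γ : V → S} (hγ : ∑ u, γ u = 0) (r : V)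
    (h : ∀ u, u ≠ r →
      ∑ i, ((if (A i).1 = u then x i else 0) - if (A i).2 = u then x i else 0) = γ u) (u : V) :
    ∑ i, ((if (A i).1 = u then x i else 0) - if (A i).2 = u then x i else 0) = γ u := by
  rcases eq_or_ne u r with rfl | hu
  · have h0 := (sum_arcs_eq_zero A x).trans hγ.symm
    rw [← Finset.add_sum_erase _ _ (Finset.mem_univ u),
      ← Finset.add_sum_erase _ γ (Finset.mem_univ u),
      Finset.sum_congr rfl fun v hv => h v (Finset.ne_of_mem_erase hv)] at h0
    exact add_right_cancel h0
  · exact h u hu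

/-- Turns degrees into counts over a concrete list of arcs, which can be decided. -/
lemma sum_adj_arcs {G : SimpleGraph V} [DecidableRel G.Adj] {A : ι → V × V}
    (hA : Function.Injective A) (hA' : ∀ i j, A i ≠ (A j).swap)
    (hG : ∀ u v, G.Adj u v ↔ (∃ i, A i = (u, v)) ∨ ∃ i, A i = (v, u)) (u : V) :
    ∑ v, (if G.Adj u v then 1 else 0) =
      ∑ i, ((if (A i).1 = u then 1 else 0) + if (A i).2 = u then 1 else 0) := by
  classical
  have key : ∀ v, (if G.Adj u v then 1 else 0) =
      ∑ i, ((if A i = (u, v) then 1 else 0) + if A i = (v, u) then 1 else 0) := by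
    intro v
    split_ifs with h
    · rcases (hG u v).1 h with ⟨j, hj⟩ | ⟨j, hj⟩
      · have hs : (v, u) = (A j).swap := by rw [hj]; rfl
        rw [← hj, hs]
        simp [hA.eq_iff, hA']
      · have hs : (u, v) = (A j).swap := by rw [hj]; rfl
        rw [← hj, hs]
        simp [hA.eq_iff, hA']
    · rw [hG, not_or, not_exists, not_exists] at h
      simp [h.1, h.2]
  rw [Finset.sum_congr rfl fun v _ => key v, Finset.sum_comm]
  refine Finset.sum_congr rfl fun i _ => ?_
  rw [Finset.sum_add_distrib]
  congr 1 <;> simp only [Prod.ext_iff] <;> split_ifs with h <;> simp [h]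

end Arcs

/-- The edges of `H₁`, directed towards the later vertex in `firstGraphOrder`. -/
def firstGraphArcs : Fin 21 → Fin 15 × Fin 15 :=
  ![(13, 9), (13, 10), (9, 4), (9, 8), (3, 2), (3, 8), (3, 4), (8, 11), (4, 14), (14, 5), (5, 0),
    (5, 10), (12, 0), (12, 11), (0, 1), (11, 7), (2, 1), (2, 7), (7, 6), (1, 6), (6, 10)]

/-- The edges of `H₂`, directed towards the later vertex in `secondGraphOrder`. -/
def secondGraphArcs : Fin 21 → Fin 15 × Fin 15 :=
  ![(2, 1), (2, 3), (2, 7), (6, 1), (6, 10), (6, 7), (1, 0), (7, 11), (12, 0), (12, 11), (0, 5),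
    (10, 5), (10, 13), (11, 8), (13, 9), (8, 3), (8, 9), (5, 4), (9, 4), (14, 3), (14, 4)]

def firstGraphOrder (n : ℕ) : Fin 15 :=
  -- Beyond the closed vertices the default is `2`, a vertex where the bad boundary used below is
  -- zero, in accordance with the default digit `0`. The same holds for the second order.
  ([13, 9, 3, 8, 4, 14, 5, 12, 0, 11, 2, 7, 1, 6] : List (Fin 15)).getD n 2

def secondGraphOrder (n : ℕ) : Fin 15 :=
  ([2, 6, 1, 7, 12, 0, 10, 11, 13, 8, 5, 9, 14, 4] : List (Fin 15)).getD n 2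

lemma adj_fromEdgeSet_image {V ι : Type*} [Fintype ι] [DecidableEq V] {A : ι → V × V}
    (hA : ∀ i, (A i).1 ≠ (A i).2) (u v : V) :
    (SimpleGraph.fromEdgeSet (Finset.univ.image fun i => s((A i).1, (A i).2) :
      Finset (Sym2 V))).Adj u v ↔ (∃ i, A i = (u, v)) ∨ ∃ i, A i = (v, u) := by
  simp only [SimpleGraph.fromEdgeSet_adj, Finset.coe_image, Finset.coe_univ, Set.image_univ,
    Set.mem_range, Sym2.eq_iff, ← exists_or, Prod.ext_iff]
  refine ⟨fun h => h.1, fun h => ⟨h, ?_⟩⟩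
  rintro rfl
  obtain ⟨i, h⟩ := h
  rcases h with h | h <;> exact hA i (h.1.trans h.2.symm)

lemma adj_H₁ (u v : Fin 15) : H₁.Adj u v ↔
    (∃ i, firstGraphArcs i = (u, v)) ∨ ∃ i, firstGraphArcs i = (v, u) := by
  rw [← adj_fromEdgeSet_image (by decide), H₁]
  have : commonEdges ∪ {s(3, 4), s(4, 14), s(14, 5)} =
      Finset.univ.image fun i => s((firstGraphArcs i).1, (firstGraphArcs i).2) := by
    decide +kernel
  rw [this]

lemma adj_H₂ (u v : Fin 15) : H₂.Adj u v ↔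
    (∃ i, secondGraphArcs i = (u, v)) ∨ ∃ i, secondGraphArcs i = (v, u) := by
  rw [← adj_fromEdgeSet_image (by decide), H₂]
  have : commonEdges ∪ {s(4, 5), s(3, 14), s(14, 4)} =
      Finset.univ.image fun i => s((secondGraphArcs i).1, (secondGraphArcs i).2) := by
    decide +kernel
  rw [this]

/-- The number of edges. -/
def edgeCount (P : List Stage) : ℕ := (P.map fun s => s.nbs.length).sum

variable {S : Type*} [AddCommGroup S]

/-- The registers after the edges from the register `r` to `nbs` got the values `t 0`, `t 1`, ... -/
def pushEdges (r : Fin 4) : List (Option (Fin 4)) → (Fin 4 → S) → (ℕ → S) → Fin 4 → S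
  | [], x, _ => x
  | none :: l, x, t => pushEdges r l (x + Pi.single r (t 0)) fun n => t (n + 1)
  | some j :: l, x, t =>
    pushEdges r l (x + Pi.single r (t 0) + Pi.single j (-t 0)) fun n => t (n + 1)

/-- The boundary of the `n`-th closed vertex, for the edge values `t 0`, `t 1`, ... -/
def closedBoundary : List Stage → (Fin 4 → S) → (ℕ → S) → ℕ → S
  | [], _, _, _ => 0
  | s :: _, x, t, 0 => pushEdges s.reg s.nbs x t s.reg
  | s :: P, x, t, n + 1 => closedBoundary P (Function.update (pushEdges s.reg s.nbs x t) s.reg 0)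
      (fun k => t (k + s.nbs.length)) n

/-- The nested choices are collected into one sequence of edge values, so that stages can be
compared with functions on the arcs. -/
lemma chooseEdges_iff {r : Fin 4} {k : (Fin 4 → S) → Prop} :
    ∀ {l : List (Option (Fin 4))} {x : Fin 4 → S}, ChooseEdges r l x k ↔
      ∃ t : ℕ → S, (∀ n < l.length, t n ≠ 0) ∧ k (pushEdges r l x t)
  | [], x => ⟨fun h => ⟨0, by simp, h⟩, fun ⟨_, _, h⟩ => h⟩
  | none :: l, x => by
    constructor
    · rintro ⟨a, ha, h⟩
      obtain ⟨t, ht, hk⟩ := chooseEdges_iff.1 h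
      exact ⟨fun n => Nat.casesOn (motive := fun _ => S) n a t, Nat.rec (fun _ => ha) fun n _ hn =>
        ht n (Nat.lt_of_succ_lt_succ hn), hk⟩
    · rintro ⟨t, ht, hk⟩
      exact ⟨t 0, ht 0 (Nat.succ_pos _), chooseEdges_iff.2
        ⟨fun n => t (n + 1), fun n hn => ht _ (Nat.succ_lt_succ hn), hk⟩⟩
  | some j :: l, x => by
    constructor
    · rintro ⟨a, ha, h⟩
      obtain ⟨t, ht, hk⟩ := chooseEdges_iff.1 h
      exact ⟨fun n => Nat.casesOn (motive := fun _ => S) n a t, Nat.rec (fun _ => ha) fun n _ hn =>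
        ht n (Nat.lt_of_succ_lt_succ hn), hk⟩
    · rintro ⟨t, ht, hk⟩
      exact ⟨t 0, ht 0 (Nat.succ_pos _), chooseEdges_iff.2
        ⟨fun n => t (n + 1), fun n hn => ht _ (Nat.succ_lt_succ hn), hk⟩⟩

lemma pushEdges_congr {r : Fin 4} : ∀ {l : List (Option (Fin 4))} {x : Fin 4 → S} {t t' : ℕ → S},
    (∀ n < l.length, t n = t' n) → pushEdges r l x t = pushEdges r l x t'
  | [], _, _, _, _ => rfl
  | none :: l, x, t, t', h => by
    rw [pushEdges, pushEdges, h 0 (Nat.succ_pos _)]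
    exact pushEdges_congr fun n hn => h _ (Nat.succ_lt_succ hn)
  | some j :: l, x, t, t', h => by
    rw [pushEdges, pushEdges, h 0 (Nat.succ_pos _)]
    exact pushEdges_congr fun n hn => h _ (Nat.succ_lt_succ hn)

lemma solvable_iff : ∀ {P : List Stage} {x : Fin 4 → S} {η : ℕ → S}, Solvable P x η ↔
    ∃ t : ℕ → S, (∀ n < edgeCount P, t n ≠ 0) ∧ ∀ n < P.length, closedBoundary P x t n = η n
  | [], x, η => ⟨fun _ => ⟨0, by simp [edgeCount], by simp⟩, fun _ => trivial⟩
  | s :: P, x, η => by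
    have hc : edgeCount (s :: P) = s.nbs.length + edgeCount P := by simp [edgeCount]
    rw [Solvable, chooseEdges_iff, hc]
    constructor
    · rintro ⟨t, ht, h0, h⟩
      obtain ⟨t', ht', h'⟩ := solvable_iff.1 h
      -- The values chosen in this stage, followed by those of the later stages.
      set a : ℕ → S := fun n => if n < s.nbs.length then t n else t' (n - s.nbs.length) with ha
      have hpush : pushEdges s.reg s.nbs x a = pushEdges s.reg s.nbs x t :=
        pushEdges_congr fun n hn => by simp [ha, hn]
      have htail : (fun k => a (k + s.nbs.length)) = t' := by
        funext k
        simp [ha]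
      refine ⟨a, fun n hn => ?_, fun n hn => ?_⟩
      · by_cases h1 : n < s.nbs.length
        · simpa [ha, h1] using ht n h1
        · simpa [ha, h1] using ht' (n - s.nbs.length) (by omega)
      · cases n with
        | zero => rw [closedBoundary, hpush, h0]
        | succ n => rw [closedBoundary, hpush, htail, h' n (Nat.lt_of_succ_lt_succ hn)]
    · rintro ⟨t, ht, h⟩
      exact ⟨t, fun n hn => ht n (Nat.lt_add_right _ hn), h 0 (Nat.succ_pos _), solvable_iff.2
        ⟨fun k => t (k + s.nbs.length), fun n hn => ht _ (by omega),
          fun n hn => h (n + 1) (Nat.succ_lt_succ hn)⟩⟩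

/-- Stages that close the vertices in the order given by `ord`, except for the root `r`, with edges
directed by `A`, describe the boundaries of nowhere-zero functions on these edges. -/
theorem solvable_iff_arcs {V : Type*} [Fintype V] [DecidableEq V] {P : List Stage} {m : ℕ}
    {A : Fin m → V × V} {ord : ℕ → V} {r : V} (hm : edgeCount P = m)
    (hord : ∀ u, u ≠ r → ∃ n < P.length, ord n = u)
    (hA : ∀ (t : ℕ → S), ∀ n < P.length, closedBoundary P 0 t n =
      ∑ i, ((if (A i).1 = ord n then t i else 0) - if (A i).2 = ord n then t i else 0))
    {γ : V → S} (hγ : ∑ u, γ u = 0) :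
    Solvable P 0 (fun n => γ (ord n)) ↔ ∃ x : Fin m → S, (∀ i, x i ≠ 0) ∧
      ∀ u, ∑ i, ((if (A i).1 = u then x i else 0) - if (A i).2 = u then x i else 0) = γ u := by
  rw [solvable_iff, hm]
  constructor
  · rintro ⟨t, ht, h⟩
    refine ⟨fun i => t i, fun i => ht i i.2, forall_arcs_eq_of_ne hγ r fun u hu => ?_⟩
    obtain ⟨n, hn, rfl⟩ := hord u hu
    rw [← h n hn, hA t n hn]
  · rintro ⟨x, hx, h⟩
    refine ⟨fun n => if hn : n < m then x ⟨n, hn⟩ else 0, fun n hn => by simpa [hn] using hx _,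
      fun n hn => ?_⟩
    rw [hA _ n hn, ← h]
    simp

/-- This ties the register program to the graph. The arcs are numbered in the order in which the
stages choose their values and directed away from the vertex being closed, so both sides are the
same signed sum of edge values in every abelian group. -/
lemma closedBoundary_firstGraphStages (t : ℕ → S) (n : ℕ) (hn : n < firstGraphStages.length) :
    closedBoundary firstGraphStages 0 t n =
      ∑ i, ((if (firstGraphArcs i).1 = firstGraphOrder n then t i else 0) -
        if (firstGraphArcs i).2 = firstGraphOrder n then t i else 0) := by
  change n < 14 at hn
  interval_cases n <;>
    simp [firstGraphStages, closedBoundary, pushEdges, Fin.sum_univ_succ, firstGraphArcs,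
      firstGraphOrder] <;> abel

lemma exists_firstGraphOrder_eq (u : Fin 15) (hu : u ≠ 10) :
    ∃ n < firstGraphStages.length, firstGraphOrder n = u := by
  revert u
  decide

lemma closedBoundary_secondGraphStages (t : ℕ → S) (n : ℕ) (hn : n < secondGraphStages.length) :
    closedBoundary secondGraphStages 0 t n =
      ∑ i, ((if (secondGraphArcs i).1 = secondGraphOrder n then t i else 0) -
        if (secondGraphArcs i).2 = secondGraphOrder n then t i else 0) := by
  change n < 14 at hn
  interval_cases n <;>
    simp [secondGraphStages, closedBoundary, pushEdges, Fin.sum_univ_succ, secondGraphArcs,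
      secondGraphOrder] <;> abel

lemma exists_secondGraphOrder_eq (u : Fin 15) (hu : u ≠ 3) :
    ∃ n < secondGraphStages.length, secondGraphOrder n = u := by
  revert u
  decide

end GroupConn

namespace GroupConn

/-! ### Cuts of the two pieces -/

/-- A lower bound for the size of a cut, plus the number of vertices in `M` on its side encoded
by the bit mask `m`, if only the vertices below `k` were assigned to the sides. -/
def cutBound (L : List (ℕ × ℕ)) (M : List ℕ) (k m : ℕ) : ℕ :=
  L.countP (fun e => e.1.blt k && e.2.blt k && (m.testBit e.1 != m.testBit e.2)) +
    M.countP (fun i => i.blt k && m.testBit i)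

/-- Search for a cut of size less than three, where the vertices in `M` on one side add to the
size. -/
def cutSearch (L : List (ℕ × ℕ)) (M : List ℕ) : ℕ → ℕ → ℕ → Bool
  | 0, k, m => Nat.ble 3 (cutBound L M k m) || m.beq 0 || m.beq (2 ^ k - 1)
  | n + 1, k, m => Nat.ble 3 (cutBound L M k m) ||
      (cutSearch L M n (k + 1) m && cutSearch L M n (k + 1) (m ||| 2 ^ k))

/-- Edges and marked vertices already decided keep contributing in every completion, which justifies
pruning at three. -/
lemma cutBound_le {L : List (ℕ × ℕ)} {M : List ℕ} {k m : ℕ} {y : ℕ → Bool}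
    (hm : ∀ i < k, m.testBit i = y i) :
    cutBound L M k m ≤ L.countP (fun e => y e.1 != y e.2) + M.countP y := by
  refine Nat.add_le_add (List.countP_mono_left fun e _ h => ?_)
    (List.countP_mono_left fun i _ h => ?_)
  · simp only [Bool.and_eq_true, Nat.blt_eq] at h
    rw [← hm _ h.1.1, ← hm _ h.1.2]
    exact h.2
  · simp only [Bool.and_eq_true, Nat.blt_eq] at h
    rw [← hm _ h.1]
    exact h.2

/-- The mask `m` records the sides of the first `k` vertices under `y`. The search succeeds on both
branches at vertex `k`; the one that agrees with `y` is followed. The exceptional outcomes are the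
two trivial sides. -/
lemma cutSearch_spec {L : List (ℕ × ℕ)} {M : List ℕ} {y : ℕ → Bool} :
    ∀ {n k m : ℕ}, (∀ i, m.testBit i = (decide (i < k) && y i)) → cutSearch L M n k m = true →
      3 ≤ L.countP (fun e => y e.1 != y e.2) + M.countP y ∨ (∀ i < k + n, y i = false) ∨
        ∀ i < k + n, y i = true := by
  intro n
  induction n with
  | zero =>
    intro k m hm h
    have hm' : ∀ i < k, m.testBit i = y i := fun i hi => by simp [hm, hi]
    simp only [cutSearch, Bool.or_eq_true] at h
    rcases h with (h | h) | h
    · exact Or.inl ((Nat.le_of_ble_eq_true h).trans (cutBound_le hm'))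
    · refine Or.inr (Or.inl fun i hi => ?_)
      rw [← hm' i hi, Nat.eq_of_beq_eq_true h, Nat.zero_testBit]
    · refine Or.inr (Or.inr fun i hi => ?_)
      rw [← hm' i hi, Nat.eq_of_beq_eq_true h, Nat.testBit_two_pow_sub_one]
      exact decide_eq_true hi
  | succ n ih =>
    intro k m hm h
    have hm' : ∀ i < k, m.testBit i = y i := fun i hi => by simp [hm, hi]
    simp only [cutSearch, Bool.or_eq_true, Bool.and_eq_true] at h
    rcases h with h | ⟨h0, h1⟩
    · exact Or.inl ((Nat.le_of_ble_eq_true h).trans (cutBound_le hm'))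
    · rw [← Nat.succ_add_eq_add_succ]
      cases hy : y k with
      | false =>
        refine ih (fun i => ?_) h0
        rw [hm]
        rcases lt_trichotomy i k with hi | rfl | hi
        · simp [hi, Nat.lt_succ_of_lt hi]
        · simp [hy]
        · simp [hi.not_gt, Nat.not_lt.2 (Nat.succ_le_of_lt hi)]
      | true =>
        refine ih (fun i => ?_) h1
        rw [Nat.testBit_or, Nat.testBit_two_pow, hm]
        rcases lt_trichotomy i k with hi | rfl | hi
        · simp [hi, hi.ne', Nat.lt_succ_of_lt hi]
        · simp [hy]
        · simp [hi.not_gt, hi.ne, Nat.not_lt.2 (Nat.succ_le_of_lt hi)]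

/-- The edges of `A`, as a list of pairs of numbers. -/
def arcList {m n : ℕ} (A : Fin m → Fin n × Fin n) : List (ℕ × ℕ) :=
  List.ofFn fun i => ((A i).1.val, (A i).2.val)

theorem three_le_cutSize_of_cutSearch {m n : ℕ} {G : SimpleGraph (Fin n)}
    {A : Fin m → Fin n × Fin n} (hA : Function.Injective A) (hA' : ∀ i j, A i ≠ (A j).swap)
    (hG : ∀ i, G.Adj (A i).1 (A i).2) {M : List (Fin n)} (hM : M.Nodup)
    (h : cutSearch (arcList A) (M.map Fin.val) n 0 0 = true) (Y : Set (Fin n)) (hY : Y.Nonempty)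
    (hYc : Yᶜ.Nonempty) : 3 ≤ cutSize G Y + (Y ∩ {w | w ∈ M}).ncard := by
  classical
  set y : ℕ → Bool := fun i => decide (∃ hi : i < n, (⟨i, hi⟩ : Fin n) ∈ Y) with hy
  have hyv : ∀ v : Fin n, y v = decide (v ∈ Y) := fun v => by simp [hy]
  have hcut : (arcList A).countP (fun e => y e.1 != y e.2) ≤ cutSize G Y := by
    convert countP_le_cutSize (G := G) (L := List.ofFn A) (List.nodup_ofFn.2 hA) ?_ Y using 1
    · have : arcList A = (List.ofFn A).map fun e => (e.1.val, e.2.val) := by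
        rw [List.map_ofFn]; rfl
      rw [this, List.countP_map]
      congr 1
      funext e
      simp [hyv]
    · intro e he
      obtain ⟨i, rfl⟩ := (List.mem_ofFn' _ _).1 he
      refine ⟨hG i, fun hs => ?_⟩
      obtain ⟨j, hj⟩ := (List.mem_ofFn' _ _).1 hs
      exact hA' j i hj
  have hmark : (M.map Fin.val).countP y = (Y ∩ {w | w ∈ M}).ncard := by
    rw [List.countP_map, List.countP_eq_length_filter, ← List.toFinset_card_of_nodup (hM.filter _),
      ← Set.ncard_coe_finset]
    congr 1
    ext w
    simp [hyv, and_comm]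
  rcases cutSearch_spec (y := y) (by simp) h with h | h | h
  · omega
  · obtain ⟨v, hv⟩ := hY
    have := h v (by omega)
    simp [hyv, hv] at this
  · obtain ⟨v, hv⟩ := hYc
    have := h v (by omega)
    rw [hyv, decide_eq_true_eq] at this
    exact absurd this hv

/-! ### The pieces H₁ and H₂, and the final assembly -/

lemma injective_firstGraphArcs : Function.Injective firstGraphArcs := by
  decide +kernel

lemma injective_secondGraphArcs : Function.Injective secondGraphArcs := by
  decide +kernel

lemma firstGraphArcs_ne_swap : ∀ i j, firstGraphArcs i ≠ (firstGraphArcs j).swap := by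
  decide +kernel

lemma secondGraphArcs_ne_swap : ∀ i j, secondGraphArcs i ≠ (secondGraphArcs j).swap := by
  decide +kernel

theorem exists_isFlow_H₁_iff {S : Type*} [AddCommGroup S] {γ : Fin 15 → S} (hγ : ∑ u, γ u = 0) :
    (∃ f, IsFlow H₁ γ f) ↔ Solvable firstGraphStages 0 fun n => γ (firstGraphOrder n) :=
  (exists_isFlow_iff_arcs injective_firstGraphArcs firstGraphArcs_ne_swap adj_H₁ γ).trans
    (solvable_iff_arcs rfl exists_firstGraphOrder_eq closedBoundary_firstGraphStages hγ).symm

theorem exists_isFlow_H₂_iff {S : Type*} [AddCommGroup S] {γ : Fin 15 → S} (hγ : ∑ u, γ u = 0) :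
    (∃ f, IsFlow H₂ γ f) ↔ Solvable secondGraphStages 0 fun n => γ (secondGraphOrder n) :=
  (exists_isFlow_iff_arcs injective_secondGraphArcs secondGraphArcs_ne_swap adj_H₂ γ).trans
    (solvable_iff_arcs rfl exists_secondGraphOrder_eq closedBoundary_secondGraphStages hγ).symm

theorem flowConnected_H₁ : FlowConnected H₁ (ZMod 2 × ZMod 2) :=
  fun _ hγ => (exists_isFlow_H₁_iff hγ).2 (solvable_firstGraphStages _)

theorem flowConnected_H₂ : FlowConnected H₂ (ZMod 4) :=
  fun _ hγ => (exists_isFlow_H₂_iff hγ).2 (solvable_secondGraphStages _)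

theorem exists_not_isFlow_H₁ :
    ∃ γ : Fin 15 → ZMod 4, ∑ u, γ u = 0 ∧ ¬ ∃ f, IsFlow H₁ γ f := by
  have h0 : ∑ u : Fin 15,
      -- The boundary refuted in `not_solvable_firstGraphStages`, listed by vertices instead of by
      -- the order of elimination.
      (![2, 1, 0, 0, 0, 0, 1, 0, 1, 2, 0, 0, 2, 2, 1] : Fin 15 → ZMod 4) u = 0 := by
    decide
  refine ⟨_, h0, fun h => not_solvable_firstGraphStages ?_⟩
  rw [exists_isFlow_H₁_iff h0] at h
  convert h using 2 with n
  rcases lt_or_ge n 14 with hn | hn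
  · revert n; decide
  · rw [firstGraphOrder, List.getD_eq_default _ _ hn, List.getD_eq_default _ _ hn]; rfl

theorem exists_not_isFlow_H₂ :
    ∃ γ : Fin 15 → ZMod 2 × ZMod 2, ∑ u, γ u = 0 ∧ ¬ ∃ f, IsFlow H₂ γ f := by
  have h0 : ∑ u : Fin 15,
      (kleinCode.val ∘ ![3, 0, 0, 0, 1, 3, 0, 2, 3, 2, 0, 0, 1, 2, 1]) u = 0 := by
    decide
  refine ⟨_, h0, fun h => not_solvable_secondGraphStages ?_⟩
  rw [exists_isFlow_H₂_iff h0] at h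
  convert h using 2 with n
  rcases lt_or_ge n 14 with hn | hn
  · revert n; decide
  · rw [secondGraphOrder, List.getD_eq_default _ _ hn, List.getD_eq_default _ _ hn]; rfl

lemma degree_H₁ (u : Fin 15) [Fintype (H₁.neighborSet u)] :
    H₁.degree u = if u ∈ [12, 13, 14] then 2 else 3 := by
  classical
  rw [degree_eq_sum, sum_adj_arcs injective_firstGraphArcs firstGraphArcs_ne_swap adj_H₁]
  have h : ∀ u, ∑ i, ((if (firstGraphArcs i).1 = u then 1 else 0) +
      if (firstGraphArcs i).2 = u then 1 else 0) = if u ∈ [12, 13, 14] then 2 else 3 := by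
    decide +kernel
  exact h u

lemma degree_H₂ (u : Fin 15) [Fintype (H₂.neighborSet u)] :
    H₂.degree u = if u ∈ [12, 13, 14] then 2 else 3 := by
  classical
  rw [degree_eq_sum, sum_adj_arcs injective_secondGraphArcs secondGraphArcs_ne_swap adj_H₂]
  have h : ∀ u, ∑ i, ((if (secondGraphArcs i).1 = u then 1 else 0) +
      if (secondGraphArcs i).2 = u then 1 else 0) = if u ∈ [12, 13, 14] then 2 else 3 := by
    decide +kernel
  exact h u

lemma twoVertices_H₁ : twoVertices H₁ = {w | w ∈ [12, 13, 14]} := by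
  ext w
  simp only [twoVertices, Set.mem_ofPred_eq, degree_H₁]
  split_ifs with h <;> simp [h]

lemma twoVertices_H₂ : twoVertices H₂ = {w | w ∈ [12, 13, 14]} := by
  ext w
  simp only [twoVertices, Set.mem_ofPred_eq, degree_H₂]
  split_ifs with h <;> simp [h]

theorem three_le_cutSize_H₁ (Y : Set (Fin 15)) (hY : Y.Nonempty) (hYc : Yᶜ.Nonempty) :
    3 ≤ cutSize H₁ Y + (Y ∩ twoVertices H₁).ncard := by
  rw [twoVertices_H₁]
  exact three_le_cutSize_of_cutSearch injective_firstGraphArcs firstGraphArcs_ne_swap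
    (fun i => (adj_H₁ _ _).2 (Or.inl ⟨i, rfl⟩)) (by decide) (by decide +kernel) Y hY hYc

theorem three_le_cutSize_H₂ (Y : Set (Fin 15)) (hY : Y.Nonempty) (hYc : Yᶜ.Nonempty) :
    3 ≤ cutSize H₂ Y + (Y ∩ twoVertices H₂).ncard := by
  rw [twoVertices_H₂]
  exact three_le_cutSize_of_cutSearch injective_secondGraphArcs secondGraphArcs_ne_swap
    (fun i => (adj_H₂ _ _).2 (Or.inl ⟨i, rfl⟩)) (by decide) (by decide +kernel) Y hY hYc

lemma bijOn_twoVertices {H : SimpleGraph (Fin 15)} (h : twoVertices H = {w | w ∈ [12, 13, 14]}) :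
    Set.BijOn ![12, 13, 14] Set.univ (twoVertices H) := by
  rw [h]
  refine ⟨fun i _ => ?_, ?_, ?_⟩
  · fin_cases i <;> simp
  · rw [Set.injOn_univ]; decide
  · intro w hw
    rw [Set.image_univ, Set.mem_range]
    revert w
    decide

/-- Around every vertex all three colours occur, and the nonzero elements of the Klein group add up
to zero. -/
lemma sum_kleinColour_prism [DecidableRel prism.Adj] (p : Equiv.Perm (Fin 3)) (u : Fin 3 × Fin 2) :
    (∑ v, if prism.Adj u v then kleinColour (p (u.1 + v.1)) else 0) = 0 := by
  have h : ∀ (p : Equiv.Perm (Fin 3)) (u : Fin 3 × Fin 2),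
      (∑ v : Fin 3 × Fin 2, if (u.1 ≠ v.1 ∧ u.2 = v.2) ∨ (u.2 ≠ v.2 ∧ u.1 = v.1) then
        kleinColour (p (u.1 + v.1)) else 0) = 0 := by
    decide +kernel
  simp only [prism_adj]
  convert h p u

theorem exists_isAttachment_completeGraph : ∃ att, IsAttachment K₄ H₁ att := by
  -- The differences `1`, `2`, `3` go to the three vertices of degree two; the entry for difference
  -- `0` is never used by an edge.
  refine ⟨fun u v => ![12, 12, 13, 14] (v - u), fun u => ?_⟩
  rw [twoVertices_H₁]
  refine ⟨fun v hv => ?_, fun v hv w hw => ?_, fun w hw => ?_⟩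
  · have h : ∀ u v : Fin 4, u ≠ v →
        (![12, 12, 13, 14] : Fin 4 → Fin 15) (v - u) ∈ [12, 13, 14] := by decide
    exact h u v hv
  · have h : ∀ u v w : Fin 4, u ≠ v → u ≠ w →
        (![12, 12, 13, 14] : Fin 4 → Fin 15) (v - u) = ![12, 12, 13, 14] (w - u) → v = w := by
      decide
    exact h u v w hv hw
  · have h : ∀ u : Fin 4, ∀ w : Fin 15, w ∈ [12, 13, 14] →
        ∃ v, u ≠ v ∧ (![12, 12, 13, 14] : Fin 4 → Fin 15) (v - u) = w := by
      decide +kernel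
    exact h u w hw

theorem isCubicExample_completeGraph {att : Fin 4 → Fin 4 → Fin 15} (h : IsAttachment K₄ H₁ att) :
    IsCubicExample (ZMod 2 × ZMod 2) (ZMod 4) (replaceVertices K₄ H₁ att) := by
  classical
  refine isCubicExample_iff.2 ⟨cubicConnected_completeGraph.replaceVertices h (fun w hw => ?_)
    three_le_cutSize_H₁ flowConnected_H₁, ?_⟩
  · rw [twoVertices_H₁] at hw
    rw [degree_H₁]
    exact if_neg hw
  · obtain ⟨γ, hγ, hγ'⟩ := exists_not_isFlow_H₁
    -- With `τ` equal to `1`, the base boundary is `3` at each of four vertices, with sum `12 = 0`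
    -- in `ℤ₄`.
    refine not_flowConnected_replaceVertices hγ hγ' (τ := fun _ _ => 1) ?_ fun f hf => ?_
    · have h : (∑ u : Fin 4, ∑ v : Fin 4, if u ≠ v then (1 : ZMod 4) else 0) = 0 := by decide
      convert h
    · refine exists_forall_eq_one_of_isFlow_completeGraph ?_
      convert hf

theorem isCubicExample_prism {att : Fin 3 × Fin 2 → Fin 3 × Fin 2 → Fin 15}
    (h : IsPermutationAttachment prism H₂ att) :
    IsCubicExample (ZMod 4) (ZMod 2 × ZMod 2) (replaceVertices prism H₂ att) := by
  classical
  refine isCubicExample_iff.2 ⟨cubicConnected_prism.replaceVertices h.isAttachment (fun w hw => ?_)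
    three_le_cutSize_H₂ flowConnected_H₂, ?_⟩
  · rw [twoVertices_H₂] at hw
    rw [degree_H₂]
    exact if_neg hw
  · obtain ⟨γ, hγ, hγ'⟩ := exists_not_isFlow_H₂
    obtain ⟨-, -, σ, -⟩ := h
    -- The vertex `u` waits for the flow belonging to the permutation `σ u`. A flow for `p`
    -- therefore agrees with `τ` at `σ.symm p`.
    refine not_flowConnected_replaceVertices hγ hγ'
      (τ := fun u v => kleinColour (σ u (u.1 + v.1))) ?_ fun f hf => ?_
    · exact Finset.sum_eq_zero fun u _ => sum_kleinColour_prism _ _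
    · simp only [sum_kleinColour_prism] at hf
      obtain ⟨p, hp⟩ := exists_perm_of_isFlow_prism hf
      refine ⟨σ.symm p, fun v hv => ?_⟩
      rw [hp _ _ hv, Equiv.apply_symm_apply]

end GroupConn

theorem mainTheorem3 :
    -- existence
    (∃ (V : Type) (_ : Fintype V) (G : SimpleGraph V),
      IsCubicExample (ZMod 4) (ZMod 2 × ZMod 2) G) ∧
    (∃ (V : Type) (_ : Fintype V) (G : SimpleGraph V),
      IsCubicExample (ZMod 2 × ZMod 2) (ZMod 4) G) ∧
    -- the complete graph on four vertices, with its vertices replaced by copies of `H₁`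
    ((∃ att, IsAttachment K₄ H₁ att) ∧
      ∀ att, IsAttachment K₄ H₁ att →
        IsCubicExample (ZMod 2 × ZMod 2) (ZMod 4) (replaceVertices K₄ H₁ att)) ∧
    -- the 3-prism, whose 3-edge-colouring is unique up to a permutation of the colours,
    -- with its vertices replaced by copies of `H₂`
    (∀ c c' : prism.lineGraph.Coloring (Fin 3), ∃ p : Equiv.Perm (Fin 3), ∀ e, c' e = p (c e)) ∧
    ((∃ att, IsPermutationAttachment prism H₂ att) ∧
      ∀ att, IsPermutationAttachment prism H₂ att →
        IsCubicExample (ZMod 4) (ZMod 2 × ZMod 2) (replaceVertices prism H₂ att)) ∧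
    -- infinite families by substituting triangles for vertices
    (∀ (V : Type) [Fintype V] (G : SimpleGraph V),
      (IsCubicExample (ZMod 4) (ZMod 2 × ZMod 2) G →
        TriangleFamily (ZMod 4) (ZMod 2 × ZMod 2) G) ∧
      (IsCubicExample (ZMod 2 × ZMod 2) (ZMod 4) G →
        TriangleFamily (ZMod 2 × ZMod 2) (ZMod 4) G)) := by
  obtain ⟨att₁, h₁⟩ := exists_isAttachment_completeGraph
  obtain ⟨att₂, h₂⟩ := exists_isPermutationAttachment_prism (bijOn_twoVertices twoVertices_H₂)
  exact ⟨⟨_, _, _, isCubicExample_prism h₂⟩, ⟨_, _, _, isCubicExample_completeGraph h₁⟩,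
    ⟨⟨att₁, h₁⟩, fun _ => isCubicExample_completeGraph⟩, prism_coloring_unique,
    ⟨⟨att₂, h₂⟩, fun _ => isCubicExample_prism⟩, fun V _ G =>
      ⟨triangleFamily_of_isCubicExample flowConnected_triangle_zmod_four,
        triangleFamily_of_isCubicExample flowConnected_triangle_klein⟩⟩
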